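/- Let $n\ge 3$ and let $\Omega\subset\mathbb{R}^n$ be a bounded domain (connected open set) with $C^1$ boundary. For $A\in C(\overline{\Omega},\mathbb{C}^n)$ and $q\in L^\infty(\Omega,\mathbb{C})$ let $$L_{A,q}=\sum_{j=1}^n(D_j+A_j)^2+q,\qquad D=i^{-1}\nabla .$$ Write $a\cdot b=\sum_j a_jb_j$ (no conjugation), $A^2=A\cdot A$, and for $u,g\in H^1(\Omega)$ put $$B_{A,q}(u,g)=\int_\Omega\big(\nabla u\cdot\nabla g+iA\cdot(u\nabla g-g\nabla u)+(A^2+q)ug\big)\,dx .$$ A function $u\in H^1(\Omega)$ solves $L_{A,q}u=0$ in $\Omega$ in the sense of distributions if $B_{A,q}(u,\varphi)=0$ for all $\varphi\in C_0^\infty(\Omega)$. Let $u|_{\partial\Omega}$ denote the trace of $u\in H^1(\Omega)$ in $H^{1/2}(\partial\Omega)=H^1(\Omega)/H^1_0(\Omega)$, where $H^1_0(\Omega)$ is the closure of $C_0^\infty(\Omega)$ in $H^1(\Omega)$. For a solution $u$, the element $(\partial_\nu u+i(A\cdot\nu)u)|_{\partial\Omega}$ of the dual space $H^{-1/2}(\partial\Omega)$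 is defined by $$\langle\partial_\nu u+i(A\cdot\nu)u,\,g|_{\partial\Omega}\rangle_{\partial\Omega}=B_{A,q}(u,g)\quad\text{for all } g\in H^1(\Omega).$$ Let $$C_{A,q}=\{(u|_{\partial\Omega},(\partial_\nu u+i(A\cdot\nu)u)|_{\partial\Omega}) : u\in H^1(\Omega),\ L_{A,q}u=0\text{ in }\Omega\}$$ be the set of Cauchy data. Let $A_1,A_2\in C(\overline{\Omega},\mathbb{C}^n)$ and $q_1,q_2\in L^\infty(\Omega,\mathbb{C})$ satisfy $C_{A_1,q_1}=C_{A_2,q_2}$. Then $$\tau\cdot(A_1-A_2)(x_0)=0$$ for every $x_0\in\partial\Omega$ and every unit tangent vector $\tau\in T_{x_0}(\partial\Omega)$. (It is not assumed that the Dirichlet problem for $L_{A_j,q_j}$ in $\Omega$ is well posed.) -/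

import Mathlib

open MeasureTheory TopologicalSpace
open scoped Distributions ContDiff ENNReal

noncomputable section

namespace MagneticSchrodinger

variable {n : ℕ}

/-! ### Domains with `C¹` boundary and tangent vectors -/

/-- `ρ` is a `C¹` defining function of `Ω` near the point `x`: in an open neighbourhood `U` of `x`,
`Ω = {ρ > 0}` and `∂Ω = {ρ = 0}`, and the differential of `ρ` does not vanish at `x`. -/
def IsLocalDefiningFunction (Ω : Set (EuclideanSpace ℝ (Fin n))) (x : EuclideanSpace ℝ (Fin n))
    (ρ : EuclideanSpace ℝ (Fin n) → ℝ) : Prop :=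
  ∃ U : Set (EuclideanSpace ℝ (Fin n)), IsOpen U ∧ x ∈ U ∧ ContDiffOn ℝ 1 ρ U ∧
    (∀ y ∈ U, y ∈ Ω ↔ 0 < ρ y) ∧ (∀ y ∈ U, y ∈ frontier Ω ↔ ρ y = 0) ∧ fderiv ℝ ρ x ≠ 0

/-- `Ω` has `C¹` boundary. -/
def HasC1Boundary (Ω : Set (EuclideanSpace ℝ (Fin n))) : Prop :=
  ∀ x ∈ frontier Ω, ∃ ρ, IsLocalDefiningFunction Ω x ρ

/-- `τ ∈ T_x(∂Ω)`: the tangent space at `x` is the kernel of the differential of a defining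
function (any two defining functions near `x` have proportional differentials at `x`). -/
def IsTangentVector (Ω : Set (EuclideanSpace ℝ (Fin n))) (x τ : EuclideanSpace ℝ (Fin n)) : Prop :=
  ∃ ρ, IsLocalDefiningFunction Ω x ρ ∧ fderiv ℝ ρ x τ = 0

/-! ### The Sobolev spaces `H¹(Ω)`, `H¹₀(Ω)` and the trace space `H^{1/2}(∂Ω)` -/

/-- Lebesgue measure on `Ω`. -/
abbrev vol (Ω : Opens (EuclideanSpace ℝ (Fin n))) : Measure (EuclideanSpace ℝ (Fin n)) :=
  volume.restrict (Ω : Set (EuclideanSpace ℝ (Fin n)))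

/-- The partial derivative `∂_j φ`. -/
def partialDeriv (j : Fin n) (φ : EuclideanSpace ℝ (Fin n) → ℂ) (x : EuclideanSpace ℝ (Fin n)) : ℂ :=
  fderiv ℝ φ x (EuclideanSpace.single j 1)

/-- The gradient `∇φ`, with values in `ℂⁿ`. -/
def gradient (φ : EuclideanSpace ℝ (Fin n) → ℂ) (x : EuclideanSpace ℝ (Fin n)) :
    EuclideanSpace ℂ (Fin n) :=
  WithLp.toLp 2 fun j => partialDeriv j φ x

/-- The bilinear (not sesquilinear) product `a · b = ∑ a_j b_j` on `ℂⁿ`. -/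
def dot (a b : EuclideanSpace ℂ (Fin n)) : ℂ := ∑ j, a j * b j

/-- The Hilbert space `L²(Ω, ℂ) × L²(Ω, ℂⁿ)`. -/
abbrev L2Pair (Ω : Opens (EuclideanSpace ℝ (Fin n))) : Type :=
  WithLp 2 (Lp ℂ 2 (vol Ω) × Lp (EuclideanSpace ℂ (Fin n)) 2 (vol Ω))

/-- `G ∈ L²(Ω, ℂⁿ)` is the weak gradient of `u ∈ L²(Ω)`. -/
def IsWeakGradient (Ω : Opens (EuclideanSpace ℝ (Fin n)))
    (u : Lp ℂ 2 (vol Ω)) (G : Lp (EuclideanSpace ℂ (Fin n)) 2 (vol Ω)) : Prop :=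
  ∀ (φ : 𝓓(Ω, ℂ)) (j : Fin n),
    ∫ x in Ω, u x * partialDeriv j φ x = - ∫ x in Ω, G x j * φ x

theorem continuous_partialDeriv {Ω : Opens (EuclideanSpace ℝ (Fin n))} (φ : 𝓓(Ω, ℂ)) (j : Fin n) :
    Continuous (partialDeriv j φ) :=
  (φ.contDiff.continuous_fderiv (by simp)).clm_apply continuous_const

theorem hasCompactSupport_partialDeriv {Ω : Opens (EuclideanSpace ℝ (Fin n))} (φ : 𝓓(Ω, ℂ))
    (j : Fin n) : HasCompactSupport (partialDeriv j φ) :=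
  φ.hasCompactSupport.fderiv_apply ℝ _

theorem memLp_test {Ω : Opens (EuclideanSpace ℝ (Fin n))} (φ : 𝓓(Ω, ℂ)) : MemLp φ 2 (vol Ω) :=
  (φ.continuous.memLp_of_hasCompactSupport φ.hasCompactSupport).restrict _

theorem memLp_partialDeriv {Ω : Opens (EuclideanSpace ℝ (Fin n))} (φ : 𝓓(Ω, ℂ)) (j : Fin n) :
    MemLp (partialDeriv j φ) 2 (vol Ω) :=
  ((continuous_partialDeriv φ j).memLp_of_hasCompactSupport
    (hasCompactSupport_partialDeriv φ j)).restrict _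

theorem memLp_gradient {Ω : Opens (EuclideanSpace ℝ (Fin n))} (φ : 𝓓(Ω, ℂ)) :
    MemLp (gradient φ) 2 (vol Ω) :=
  MemLp.of_eval_piLp fun j => memLp_partialDeriv φ j

theorem memLp_coord {Ω : Opens (EuclideanSpace ℝ (Fin n))}
    (G : Lp (EuclideanSpace ℂ (Fin n)) 2 (vol Ω)) (j : Fin n) :
    MemLp (fun x => G x j) 2 (vol Ω) :=
  (Lp.memLp G).eval_piLp j

/-- `H¹(Ω)`, realised as the space of pairs `(u, ∇u)` with `u ∈ L²(Ω)` and weak gradient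
`∇u ∈ L²(Ω, ℂⁿ)`, with the norm `(‖u‖² + ‖∇u‖²)^{1/2}`. -/
def H1 (Ω : Opens (EuclideanSpace ℝ (Fin n))) : Submodule ℂ (L2Pair Ω) where
  carrier := {w | IsWeakGradient Ω w.fst w.snd}
  zero_mem' := by
    intro φ j
    have h1 : ∫ x in Ω, (0 : Lp ℂ 2 (vol Ω)) x * partialDeriv j φ x = 0 := by
      refine integral_eq_zero_of_ae ?_
      filter_upwards [Lp.coeFn_zero ℂ 2 (vol Ω)] with x hx
      rw [hx, Pi.zero_apply, zero_mul]
    have h2 : ∫ x in Ω, (0 : Lp (EuclideanSpace ℂ (Fin n)) 2 (vol Ω)) x j * φ x = 0 := by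
      refine integral_eq_zero_of_ae ?_
      filter_upwards [Lp.coeFn_zero (EuclideanSpace ℂ (Fin n)) 2 (vol Ω)] with x hx
      rw [hx, Pi.zero_apply, PiLp.zero_apply, zero_mul]
      rfl
    simp only [WithLp.zero_fst, WithLp.zero_snd]
    rw [h1, h2, neg_zero]
  add_mem' := by
    intro v w hv hw φ j
    have h1 : ∫ x in Ω, (v.fst + w.fst) x * partialDeriv j φ x
        = (∫ x in Ω, v.fst x * partialDeriv j φ x) + ∫ x in Ω, w.fst x * partialDeriv j φ x := by
      refine Eq.trans (integral_congr_ae ?_)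
        (integral_add ((Lp.memLp v.fst).integrable_mul (memLp_partialDeriv φ j))
          ((Lp.memLp w.fst).integrable_mul (memLp_partialDeriv φ j)))
      filter_upwards [Lp.coeFn_add v.fst w.fst] with x hx
      rw [hx, Pi.add_apply, add_mul]
    have h2 : ∫ x in Ω, (v.snd + w.snd) x j * φ x
        = (∫ x in Ω, v.snd x j * φ x) + ∫ x in Ω, w.snd x j * φ x := by
      refine Eq.trans (integral_congr_ae ?_)
        (integral_add ((memLp_coord v.snd j).integrable_mul (memLp_test φ))
          ((memLp_coord w.snd j).integrable_mul (memLp_test φ)))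
      filter_upwards [Lp.coeFn_add v.snd w.snd] with x hx
      rw [hx, Pi.add_apply, PiLp.add_apply, add_mul]
    simp only [WithLp.add_fst, WithLp.add_snd]
    rw [h1, h2, hv φ j, hw φ j, neg_add]
  smul_mem' := by
    intro c w hw φ j
    have h1 : ∫ x in Ω, (c • w.fst) x * partialDeriv j φ x
        = c * ∫ x in Ω, w.fst x * partialDeriv j φ x := by
      rw [← integral_const_mul]
      refine integral_congr_ae ?_
      filter_upwards [Lp.coeFn_smul c w.fst] with x hx
      rw [hx, Pi.smul_apply, smul_eq_mul, mul_assoc]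
    have h2 : ∫ x in Ω, (c • w.snd) x j * φ x = c * ∫ x in Ω, w.snd x j * φ x := by
      rw [← integral_const_mul]
      refine integral_congr_ae ?_
      filter_upwards [Lp.coeFn_smul c w.snd] with x hx
      rw [hx, Pi.smul_apply, PiLp.smul_apply, smul_eq_mul, mul_assoc]
    simp only [WithLp.smul_fst, WithLp.smul_snd]
    rw [h1, h2, hw φ j, mul_neg]

/-- The function underlying an element of `H¹(Ω)`. -/
def fn {Ω : Opens (EuclideanSpace ℝ (Fin n))} (u : H1 Ω) : Lp ℂ 2 (vol Ω) :=
  (u : L2Pair Ω).fst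

/-- The weak gradient of an element of `H¹(Ω)`. -/
def grad {Ω : Opens (EuclideanSpace ℝ (Fin n))} (u : H1 Ω) :
    Lp (EuclideanSpace ℂ (Fin n)) 2 (vol Ω) :=
  (u : L2Pair Ω).snd

theorem isWeakGradient_test {Ω : Opens (EuclideanSpace ℝ (Fin n))} (φ : 𝓓(Ω, ℂ)) :
    IsWeakGradient Ω ((memLp_test φ).toLp φ) ((memLp_gradient φ).toLp (gradient φ)) := by
  intro ψ j
  have hdφ : Differentiable ℝ φ := φ.contDiff.differentiable (by simp)
  have hdψ : Differentiable ℝ ψ := ψ.contDiff.differentiable (by simp)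
  have e1 : ∫ x in Ω, ((memLp_test φ).toLp φ) x * partialDeriv j ψ x
      = ∫ x, φ x * partialDeriv j ψ x := by
    rw [← setIntegral_eq_integral_of_forall_compl_eq_zero (s := (Ω : Set _))
      (f := fun x => φ x * partialDeriv j ψ x)]
    · refine integral_congr_ae ?_
      filter_upwards [(memLp_test φ).coeFn_toLp] with x hx
      rw [hx]
    · intro x hx
      rw [image_eq_zero_of_notMem_tsupport fun h => hx (φ.tsupport_subset h), zero_mul]
  have e2 : ∫ x in Ω, ((memLp_gradient φ).toLp (gradient φ)) x j * ψ x
      = ∫ x, partialDeriv j φ x * ψ x := by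
    rw [← setIntegral_eq_integral_of_forall_compl_eq_zero (s := (Ω : Set _))
      (f := fun x => partialDeriv j φ x * ψ x)]
    · refine integral_congr_ae ?_
      filter_upwards [(memLp_gradient φ).coeFn_toLp] with x hx
      rw [hx]
      rfl
    · intro x hx
      rw [image_eq_zero_of_notMem_tsupport fun h => hx (ψ.tsupport_subset h), mul_zero]
  rw [e1, e2]
  refine integral_mul_fderiv_eq_neg_fderiv_mul_of_integrable
    (v := EuclideanSpace.single j (1 : ℝ)) ?_ ?_ ?_ (fun x _ => hdφ x) (fun x _ => hdψ x)
  · exact ((continuous_partialDeriv φ j).mul ψ.continuous).integrable_of_hasCompactSupport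
      ψ.hasCompactSupport.mul_left
  · exact (φ.continuous.mul (continuous_partialDeriv ψ j)).integrable_of_hasCompactSupport
      φ.hasCompactSupport.mul_right
  · exact (φ.continuous.mul ψ.continuous).integrable_of_hasCompactSupport
      φ.hasCompactSupport.mul_right

theorem gradient_add_test {Ω : Opens (EuclideanSpace ℝ (Fin n))} (φ ψ : 𝓓(Ω, ℂ)) :
    gradient (φ + ψ : 𝓓(Ω, ℂ)) = gradient φ + gradient ψ := by
  ext x j
  have hφ : DifferentiableAt ℝ φ x := φ.contDiff.differentiable (by simp) x
  have hψ : DifferentiableAt ℝ ψ x := ψ.contDiff.differentiable (by simp) x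
  simp [gradient, partialDeriv, fderiv_add hφ hψ]

theorem gradient_smul_test {Ω : Opens (EuclideanSpace ℝ (Fin n))} (c : ℂ) (φ : 𝓓(Ω, ℂ)) :
    gradient (c • φ : 𝓓(Ω, ℂ)) = c • gradient φ := by
  ext x j
  have hφ : DifferentiableAt ℝ φ x := φ.contDiff.differentiable (by simp) x
  simp [gradient, partialDeriv, fderiv_const_smul hφ c]

/-- The inclusion `C₀^∞(Ω) → H¹(Ω)`, `φ ↦ (φ, ∇φ)`. -/
def ofTest (Ω : Opens (EuclideanSpace ℝ (Fin n))) : 𝓓(Ω, ℂ) →ₗ[ℂ] H1 Ω where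
  toFun φ := ⟨WithLp.toLp 2 ((memLp_test φ).toLp φ, (memLp_gradient φ).toLp (gradient φ)),
    isWeakGradient_test φ⟩
  map_add' φ ψ := by
    refine Subtype.ext ?_
    change WithLp.toLp 2 (_, _) = WithLp.toLp 2 (_, _) + WithLp.toLp 2 (_, _)
    rw [← WithLp.toLp_add, Prod.mk_add_mk, ← MemLp.toLp_add, ← MemLp.toLp_add]
    congr 3
    exact gradient_add_test φ ψ
  map_smul' c φ := by
    refine Subtype.ext ?_
    change WithLp.toLp 2 (_, _) = c • WithLp.toLp 2 (_, _)
    rw [← WithLp.toLp_smul, Prod.smul_mk, ← MemLp.toLp_const_smul, ← MemLp.toLp_const_smul]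
    congr 3
    exact gradient_smul_test c φ

/-- `H¹₀(Ω)`, the closure of `C₀^∞(Ω)` in `H¹(Ω)`. -/
def H10 (Ω : Opens (EuclideanSpace ℝ (Fin n))) : Submodule ℂ (H1 Ω) :=
  (LinearMap.range (ofTest Ω)).topologicalClosure

/-- The trace space `H^{1/2}(∂Ω) = H¹(Ω) / H¹₀(Ω)`, with the quotient topology. -/
abbrev TraceSpace (Ω : Opens (EuclideanSpace ℝ (Fin n))) : Type := H1 Ω ⧸ H10 Ω

/-- The trace `u ↦ u|_{∂Ω}` from `H¹(Ω)` onto `H^{1/2}(∂Ω)`. -/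
def trace (Ω : Opens (EuclideanSpace ℝ (Fin n))) : H1 Ω →ₗ[ℂ] TraceSpace Ω := (H10 Ω).mkQ

/-- `H^{-1/2}(∂Ω)`, the dual of `H^{1/2}(∂Ω)` (bilinear pairing). -/
abbrev DualTraceSpace (Ω : Opens (EuclideanSpace ℝ (Fin n))) : Type := TraceSpace Ω →L[ℂ] ℂ

/-! ### The magnetic Schrödinger operator and its Cauchy data -/

/-- The form
`∫_Ω (∇u · ∇g + i A · (u ∇g - g ∇u) + (A² + q) u g) dx`.
For `g = φ ∈ C₀^∞(Ω)` it is the distributional pairing `⟨L_{A,q} u, φ⟩`, where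
`L_{A,q} = ∑ (D_j + A_j)² + q` and `D = i⁻¹ ∇`. -/
def magneticForm (Ω : Opens (EuclideanSpace ℝ (Fin n)))
    (A : EuclideanSpace ℝ (Fin n) → EuclideanSpace ℂ (Fin n)) (q : EuclideanSpace ℝ (Fin n) → ℂ)
    (u g : H1 Ω) : ℂ :=
  ∫ x in Ω, (dot (grad u x) (grad g x)
    + Complex.I * dot (A x) (fn u x • grad g x - fn g x • grad u x)
    + (dot (A x) (A x) + q x) * fn u x * fn g x)

/-- `L_{A,q} u = 0` in `Ω` in the sense of distributions. -/
def IsSolution (Ω : Opens (EuclideanSpace ℝ (Fin n)))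
    (A : EuclideanSpace ℝ (Fin n) → EuclideanSpace ℂ (Fin n)) (q : EuclideanSpace ℝ (Fin n) → ℂ)
    (u : H1 Ω) : Prop :=
  ∀ φ : 𝓓(Ω, ℂ), magneticForm Ω A q u (ofTest Ω φ) = 0

/-- `ℓ ∈ H^{-1/2}(∂Ω)` is the trace of `∂_ν u + i (A · ν) u` on `∂Ω`, i.e. its pairing with the
boundary values of any `g ∈ H¹(Ω)` is given by `magneticForm`. -/
def IsNormalTrace (Ω : Opens (EuclideanSpace ℝ (Fin n)))
    (A : EuclideanSpace ℝ (Fin n) → EuclideanSpace ℂ (Fin n)) (q : EuclideanSpace ℝ (Fin n) → ℂ)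
    (u : H1 Ω) (ℓ : DualTraceSpace Ω) : Prop :=
  ∀ g : H1 Ω, ℓ (trace Ω g) = magneticForm Ω A q u g

/-- The set `C_{A,q}` of Cauchy data `(u|_{∂Ω}, (∂_ν u + i (A · ν) u)|_{∂Ω})` of the solutions
`u ∈ H¹(Ω)` of `L_{A,q} u = 0` in `Ω`. -/
def cauchyData (Ω : Opens (EuclideanSpace ℝ (Fin n)))
    (A : EuclideanSpace ℝ (Fin n) → EuclideanSpace ℂ (Fin n)) (q : EuclideanSpace ℝ (Fin n) → ℂ) :
    Set (TraceSpace Ω × DualTraceSpace Ω) :=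
  {p | ∃ u : H1 Ω, IsSolution Ω A q u ∧ p.1 = trace Ω u ∧ IsNormalTrace Ω A q u p.2}

end MagneticSchrodinger

end

/-! The Cauchy data are tested on solutions that concentrate at `x₀`. Let `ν` be the inner unit
normal there, let `y = x₀ - εν` be a pole just outside `Ω`, and consider `U = |x - y|^{2-n}` and `V
= ⟨x - y, τ⟩ |x - y|^{-n}`, both harmonic away from `y`. Corrections `z`, `w` are found such that `U
+ z` solves the first equation and `V + w` the transpose of the second, which is the equation for
`-A₂`. Equal Cauchy data force the two magnetic forms to agree at this pair
(`magneticForm_eq_of_cauchyData_eq`). The second order parts cancel, and what remains is a first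
order form in `A₁ - A₂` plus a zero order term.

The leading contribution is the integral of `(A₁ - A₂) · (U ∇V - V ∇U)`, whose kernel is homogeneous
of degree `2 - 2n` about `y`. After multiplication by `ε^{n-2}` and the substitution `x = x₀ + εz`,
the domain turns into a half space and the potentials are frozen at `x₀` (`tendsto_blowup`). By the
symmetries of the half space only the component along `τ` survives, with a positive constant
(`integral_kern_eq`, `integral_kern_self_pos`). It remains to see that all other terms are
`o(ε^{2-n})`.

Let `a` bound the `L²` norms of `U` and `|x - y| ∇U`, and `b` those of `V` and `|x - y| ∇V`. Against
`φ ∈ H¹₀(Ω)` one writes `φ ∇U = (|x - y|⁻¹ φ)(|x - y| ∇U)`, so Hardy's inequality bounds the defect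
of `U` in the equation by a multiple of `a`. Hence `z` is `O(a)` both in `H¹` and in `L²` with
weight `|x - y|⁻²` (`exists_solution_of_harmonic`); likewise `w` is `O(b)`. Every error term is then
`O(ab)` (`exists_norm_lowerForm_harmonic_le`). Here `b²` may be taken `O(ε^{2-n})`, whereas `a² =
o(ε^{2-n})` because its integrand carries an extra factor `|x - y|²`.

The Dirichlet problem may be ill posed. Gårding's inequality and a Poincaré inequality modulo
finitely many functionals make the form coercive on a subspace of `H¹₀(Ω)` of finite codimension.
The directions that `H¹₀(Ω)` cannot reach are supplied by a fixed finite-dimensional space of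
bounded `H¹` functions (`exists_solution_correction`). On that space, boundedness and a uniform
bound for the integral of `|x - y|⁻²` replace Hardy's inequality. -/

namespace MagneticSchrodinger

open scoped InnerProductSpace

/-! ### Solvability of coercive problems up to finite-dimensional corrections -/

section Abstract

variable {H X : Type*} [NormedAddCommGroup H] [InnerProductSpace ℂ H] [CompleteSpace H]
  [NormedAddCommGroup X] [NormedSpace ℂ X]

/-- An operator that is coercive on the orthogonal complement of a finite-dimensional space maps
that complement onto a closed subspace. -/
theorem isClosed_map_orthogonal_of_coercive (S : H →L[ℂ] H) (F : Submodule ℂ H) {c : ℝ}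
    (hc : 0 < c) (hco : ∀ w ∈ Fᗮ, c * ‖w‖ ^ 2 ≤ (⟪w, S w⟫_ℂ).re) :
    IsClosed ((Fᗮ.map (S : H →ₗ[ℂ] H) : Submodule ℂ H) : Set H) := by
  have hbelow : ∀ w ∈ Fᗮ, ‖w‖ ≤ c⁻¹ * ‖S w‖ := by
    intro w hw
    have h1 := hco w hw
    have h2 : (⟪w, S w⟫_ℂ).re ≤ ‖w‖ * ‖S w‖ :=
      (Complex.re_le_norm _).trans (norm_inner_le_norm _ _)
    rcases (norm_nonneg w).eq_or_lt with h0 | h0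
    · rw [← h0]; positivity
    · rw [le_inv_mul_iff₀ hc]
      nlinarith
  have hanti : AntilipschitzWith (Real.toNNReal c⁻¹) (S.comp Fᗮ.subtypeL) := by
    refine AddMonoidHomClass.antilipschitz_of_bound _ fun w => ?_
    rw [Real.coe_toNNReal _ (by positivity)]
    exact hbelow w w.2
  have := hanti.isClosed_range (S.comp Fᗮ.subtypeL).uniformContinuous
  convert this using 1
  ext x
  simp

/-- The sum is closed, so density suffices: a vector `h` orthogonal to both `F` and `S(Fᗮ)`
satisfies `⟪S h, h⟫ = 0`, and coercivity forces `h = 0`. Thus `S` has range of finite codimension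
even if it is not injective. -/
theorem map_orthogonal_sup_eq_top_of_coercive (S : H →L[ℂ] H) (F : Submodule ℂ H)
    [FiniteDimensional ℂ F] {c : ℝ}
    (hc : 0 < c) (hco : ∀ w ∈ Fᗮ, c * ‖w‖ ^ 2 ≤ (⟪w, S w⟫_ℂ).re) :
    Fᗮ.map (S : H →ₗ[ℂ] H) ⊔ F = ⊤ := by
  have hcl : IsClosed ((Fᗮ.map (S : H →ₗ[ℂ] H) ⊔ F : Submodule ℂ H) : Set H) :=
    Submodule.isClosed_sup_finiteDimensional _ _ (isClosed_map_orthogonal_of_coercive S F hc hco)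
  rw [← hcl.submodule_topologicalClosure_eq, Submodule.topologicalClosure_eq_top_iff,
    Submodule.eq_bot_iff]
  intro h hh
  rw [Submodule.mem_orthogonal] at hh
  have hF : h ∈ Fᗮ := by
    rw [Submodule.mem_orthogonal]
    exact fun u hu => hh u (Submodule.mem_sup_right hu)
  have h0 : ⟪S h, h⟫_ℂ = 0 := hh _ (Submodule.mem_sup_left ⟨h, hF, rfl⟩)
  have h1 := hco h hF
  rw [← inner_conj_symm, h0] at h1
  simp only [map_zero, Complex.zero_re] at h1
  have : ‖h‖ ^ 2 ≤ 0 := by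
    by_contra hlt
    push Not at hlt
    nlinarith
  simpa using this.antisymm (by positivity)

/-- If `T ∘ j` is coercive up to a finite-dimensional space, then the equations `T v = T u` with
`u` in a subspace `Y` can be solved boundedly in terms of `T u`, by an element of the range of `j`
up to a correction in a fixed finite-dimensional subspace of `Y`. -/
theorem exists_finiteDimensional_solve (j : H →L[ℂ] X) (T : X →L[ℂ] H) (F : Submodule ℂ H)
    [FiniteDimensional ℂ F] {c : ℝ} (hc : 0 < c)
    (hco : ∀ w ∈ Fᗮ, c * ‖w‖ ^ 2 ≤ (⟪w, T (j w)⟫_ℂ).re) (Y : Submodule ℂ X) :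
    ∃ E : Submodule ℂ X, E ≤ Y ∧ FiniteDimensional ℂ E ∧ ∃ C : ℝ, ∀ u ∈ Y, ∃ w : H, ∃ e ∈ E,
      T (j w + e) = T u ∧ ‖w‖ ≤ C * ‖T u‖ ∧ ‖e‖ ≤ C * ‖T u‖ := by
  set S : H →L[ℂ] H := T.comp j with hS
  set M : Submodule ℂ H := Fᗮ.map (S : H →ₗ[ℂ] H) with hM
  have hMcl : IsClosed (M : Set H) := isClosed_map_orthogonal_of_coercive S F hc hco
  have htop : M ⊔ F = ⊤ := map_orthogonal_sup_eq_top_of_coercive S F hc hco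
  have hfin : FiniteDimensional ℂ (H ⧸ M) := by
    refine Module.Finite.of_surjective (M.mkQ.comp F.subtype) ?_
    intro x
    obtain ⟨x, rfl⟩ := M.mkQ_surjective x
    obtain ⟨m, hm, f, hf, rfl⟩ := Submodule.mem_sup.1 (htop ▸ Submodule.mem_top (x := x))
    refine ⟨⟨f, hf⟩, ?_⟩
    have : M.mkQ m = 0 := by simpa using hm
    simp only [LinearMap.comp_apply, Submodule.subtype_apply]
    rw [map_add, this, zero_add]
  set f : Y →ₗ[ℂ] H ⧸ M := (M.mkQ.comp (T : X →ₗ[ℂ] H)).comp Y.subtype with hf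
  -- A linear section of `u ↦ [T u]` over its range in `H ⧸ M`. Its image `E` is finite-dimensional,
  -- lies in `Y`, and satisfies `T Y ≤ M + T E`: whatever `S` cannot reach is reached from within
  -- `Y`.
  obtain ⟨g, hg⟩ := f.rangeRestrict.exists_rightInverse_of_surjective f.range_rangeRestrict
  set E : Submodule ℂ X := (LinearMap.range g).map Y.subtype with hE
  have hEY : E ≤ Y := Submodule.map_subtype_le _ _
  have hEfin : FiniteDimensional ℂ E := inferInstance
  refine ⟨E, hEY, hEfin, ?_⟩
  set R : Submodule ℂ H := M ⊔ E.map (T : X →ₗ[ℂ] H) with hR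
  have hRcl : IsClosed (R : Set H) := Submodule.isClosed_sup_finiteDimensional _ _ hMcl
  have : CompleteSpace R := hRcl.completeSpace_coe
  have : CompleteSpace E := FiniteDimensional.complete ℂ E
  -- The map `(w, e) ↦ T (j w) + T e` is onto the closed subspace `R`, so the open mapping theorem
  -- supplies the constant.
  let G₀ : (Fᗮ × E) →L[ℂ] H := (S.comp Fᗮ.subtypeL).coprod (T.comp E.subtypeL)
  have hG₀ : ∀ p, G₀ p ∈ R := fun p =>
    Submodule.add_mem_sup ⟨p.1, p.1.2, rfl⟩ ⟨p.2, p.2.2, rfl⟩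
  let G : (Fᗮ × E) →L[ℂ] R := G₀.codRestrict R hG₀
  have hGs : Function.Surjective G := by
    rintro ⟨r, hr⟩
    obtain ⟨_, ⟨w, hw, rfl⟩, _, ⟨e, he, rfl⟩, rfl⟩ := Submodule.mem_sup.1 hr
    exact ⟨(⟨w, hw⟩, ⟨e, he⟩), rfl⟩
  obtain ⟨C, -, hC⟩ := G.exists_preimage_norm_le hGs
  refine ⟨C, fun u hu => ?_⟩
  have hTu : T u ∈ R := by
    let y : Y := ⟨u, hu⟩
    have h1 : f (g (f.rangeRestrict y)) = f y :=
      congrArg Subtype.val (LinearMap.congr_fun hg (f.rangeRestrict y))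
    have h2 : T u - T (g (f.rangeRestrict y)) ∈ M := by
      rw [← Submodule.Quotient.eq]
      exact h1.symm
    have h3 : (g (f.rangeRestrict y) : X) ∈ E := ⟨_, ⟨_, rfl⟩, rfl⟩
    rw [← sub_add_cancel (T u) (T (g (f.rangeRestrict y)))]
    exact Submodule.add_mem_sup h2 ⟨_, h3, rfl⟩
  obtain ⟨p, hp, hpn⟩ := hC ⟨T u, hTu⟩
  refine ⟨p.1, p.2, p.2.2, ?_, ?_, ?_⟩
  · rw [map_add]
    exact congrArg Subtype.val hp
  · exact (norm_fst_le p).trans hpn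
  · exact (norm_snd_le p).trans hpn

/-- The operator representing a bilinear form, after applying a conjugation to the second
argument. -/
theorem exists_operator_of_bilinear (B : X →L[ℂ] X →L[ℂ] ℂ) (j : H →L[ℂ] X) (J : X → X)
    (hadd : ∀ u v, J (u + v) = J u + J v) (hsmul : ∀ (c : ℂ) u, J (c • u) = starRingEnd ℂ c • J u)
    (hnorm : ∀ u, ‖J u‖ = ‖u‖) :
    ∃ T : X →L[ℂ] H, ∀ (u : X) (φ : H), ⟪φ, T u⟫_ℂ = B u (J (j φ)) := by
  have hbound : ∀ u φ, ‖starRingEnd ℂ (B u (J (j φ)))‖ ≤ (‖B‖ * ‖j‖ * ‖u‖) * ‖φ‖ := fun u φ => by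
    rw [Complex.norm_conj]
    refine (B.le_opNorm₂ _ _).trans ?_
    rw [hnorm]
    calc ‖B‖ * ‖u‖ * ‖j φ‖ ≤ ‖B‖ * ‖u‖ * (‖j‖ * ‖φ‖) := by gcongr; exact j.le_opNorm φ
      _ = _ := by ring
  -- Since `J` is conjugate linear, `φ ↦ B u (J (j φ))` is antilinear; its conjugate is the
  -- functional to which Riesz representation applies.
  let ℓ : X → (H →L[ℂ] ℂ) := fun u => LinearMap.mkContinuous
    { toFun := fun φ => starRingEnd ℂ (B u (J (j φ)))
      map_add' := fun φ ψ => by rw [map_add, hadd, map_add, map_add]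
      map_smul' := fun c φ => by
        rw [map_smul, hsmul, map_smul, smul_eq_mul, map_mul, Complex.conj_conj]
        rfl } (‖B‖ * ‖j‖ * ‖u‖) (hbound u)
  have hℓ : ∀ u φ, ℓ u φ = starRingEnd ℂ (B u (J (j φ))) := fun _ _ => rfl
  let T₀ : X → H := fun u => (InnerProductSpace.toDual ℂ H).symm (ℓ u)
  have hT₀ : ∀ u φ, ⟪φ, T₀ u⟫_ℂ = B u (J (j φ)) := fun u φ => by
    rw [← inner_conj_symm, InnerProductSpace.toDual_symm_apply, hℓ, Complex.conj_conj]
  refine ⟨LinearMap.mkContinuous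
    { toFun := T₀
      map_add' := fun u v => ext_inner_left ℂ fun φ => by
        rw [inner_add_right, hT₀, hT₀, hT₀, map_add, _root_.add_apply]
      map_smul' := fun c u => ext_inner_left ℂ fun φ => by
        rw [RingHom.id_apply, inner_smul_right, hT₀, hT₀, map_smul]
        rfl } (‖B‖ * ‖j‖) fun u => ?_, hT₀⟩
  change ‖(InnerProductSpace.toDual ℂ H).symm (ℓ u)‖ ≤ _
  rw [LinearIsometryEquiv.norm_map]
  exact LinearMap.mkContinuous_norm_le _ (by positivity) _

/-- Solvability of a coercive variational problem, up to a finite-dimensional correction. -/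
theorem exists_finiteDimensional_solve_form (B : X →L[ℂ] X →L[ℂ] ℂ) (j : H →L[ℂ] X) (J : X → X)
    (hadd : ∀ u v, J (u + v) = J u + J v) (hsmul : ∀ (c : ℂ) u, J (c • u) = starRingEnd ℂ c • J u)
    (hnorm : ∀ u, ‖J u‖ = ‖u‖) (s : Finset (X →L[ℂ] ℂ)) {c : ℝ} (hc : 0 < c)
    (hco : ∀ w : H, (∀ L ∈ s, L (j w) = 0) → c * ‖w‖ ^ 2 ≤ (B (j w) (J (j w))).re)
    (Y : Submodule ℂ X) :
    ∃ E : Submodule ℂ X, E ≤ Y ∧ FiniteDimensional ℂ E ∧ ∃ C : ℝ, 0 ≤ C ∧ ∀ u ∈ Y, ∀ m : ℝ, 0 ≤ m →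
      (∀ φ : H, ‖B u (J (j φ))‖ ≤ m * ‖φ‖) → ∃ w : H, ∃ e ∈ E,
        (∀ φ : H, B (j w + e) (J (j φ)) = B u (J (j φ))) ∧ ‖w‖ ≤ C * m ∧ ‖e‖ ≤ C * m := by
  obtain ⟨T, hT⟩ := exists_operator_of_bilinear B j J hadd hsmul hnorm
  classical
  -- `F` is spanned by the Riesz representatives of the functionals `L ∘ j`, so that all of these
  -- vanish on `Fᗮ`.
  let z : (X →L[ℂ] ℂ) → H := fun L => (InnerProductSpace.toDual ℂ H).symm (L.comp j)
  let F : Submodule ℂ H := Submodule.span ℂ (s.image z : Finset H)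
  have h0 : ∀ w ∈ Fᗮ, ∀ L ∈ s, L (j w) = 0 := by
    intro w hw L hL
    have h := (Submodule.mem_orthogonal _ _).1 hw (z L)
      (Submodule.subset_span (Finset.mem_coe.2 (Finset.mem_image_of_mem z hL)))
    rw [InnerProductSpace.toDual_symm_apply] at h
    exact h
  obtain ⟨E, hEY, hE, C, hC⟩ := exists_finiteDimensional_solve j T F hc
    (fun w hw => by rw [hT]; exact hco w (h0 w hw)) Y
  refine ⟨E, hEY, hE, |C|, abs_nonneg C, fun u hu m hm hb => ?_⟩
  obtain ⟨w, e, he, h1, h2, h3⟩ := hC u hu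
  -- Testing with `φ = T u` gives `‖T u‖² ≤ m ‖T u‖`.
  have hTu : ‖T u‖ ≤ m := by
    have h := hb (T u)
    rw [← hT, inner_self_eq_norm_sq_to_K] at h
    simp only [Complex.coe_algebraMap, norm_pow, Complex.norm_real, norm_norm] at h
    rcases (norm_nonneg (T u)).eq_or_lt with h0 | h0
    · rw [← h0]; exact hm
    · nlinarith
  have hle : C * ‖T u‖ ≤ |C| * m :=
    mul_le_mul (le_abs_self C) hTu (norm_nonneg _) (abs_nonneg C)
  refine ⟨w, e, he, fun φ => ?_, h2.trans hle, h3.trans hle⟩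
  rw [← hT, ← hT, h1]

end Abstract

end MagneticSchrodinger

namespace MagneticSchrodinger

variable {n : ℕ} {Ω : Opens (EuclideanSpace ℝ (Fin n))}

/-! ### Basic facts about `H¹(Ω)` -/

theorem norm_dot_le (a b : EuclideanSpace ℂ (Fin n)) : ‖dot a b‖ ≤ ‖a‖ * ‖b‖ := by
  rw [EuclideanSpace.norm_eq, EuclideanSpace.norm_eq]
  refine (norm_sum_le _ _).trans ?_
  simp only [norm_mul]
  exact Real.sum_mul_le_sqrt_mul_sqrt _ _ _

theorem dot_comm (a b : EuclideanSpace ℂ (Fin n)) : dot a b = dot b a :=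
  Finset.sum_congr rfl fun _ _ => mul_comm _ _

theorem dot_add_right (a b c : EuclideanSpace ℂ (Fin n)) : dot a (b + c) = dot a b + dot a c := by
  simp [dot, mul_add, Finset.sum_add_distrib]

theorem dot_sub_right (a b c : EuclideanSpace ℂ (Fin n)) : dot a (b - c) = dot a b - dot a c := by
  simp [dot, mul_sub, Finset.sum_sub_distrib]

theorem dot_smul_right (a b : EuclideanSpace ℂ (Fin n)) (c : ℂ) :
    dot a (c • b) = c * dot a b := by
  simp only [dot, PiLp.smul_apply, smul_eq_mul, Finset.mul_sum]
  exact Finset.sum_congr rfl fun _ _ => by ring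

theorem dot_sub_left (a b c : EuclideanSpace ℂ (Fin n)) : dot (a - b) c = dot a c - dot b c := by
  rw [dot_comm, dot_sub_right, dot_comm c, dot_comm c]

theorem dot_neg_left (a b : EuclideanSpace ℂ (Fin n)) : dot (-a) b = -dot a b := by
  simp [dot]

theorem aestronglyMeasurable_dot {α : Type*} [MeasurableSpace α] {μ : Measure α}
    {f g : α → EuclideanSpace ℂ (Fin n)}
    (hf : AEStronglyMeasurable f μ) (hg : AEStronglyMeasurable g μ) :
    AEStronglyMeasurable (fun x => dot (f x) (g x)) μ := by
  unfold dot
  refine Finset.aestronglyMeasurable_fun_sum _ fun j _ => ?_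
  exact ((EuclideanSpace.proj (𝕜 := ℂ) j).continuous.comp_aestronglyMeasurable hf).mul
    ((EuclideanSpace.proj (𝕜 := ℂ) j).continuous.comp_aestronglyMeasurable hg)

theorem fn_add_ae (u v : H1 Ω) : fn (u + v) =ᵐ[vol Ω] fn u + fn v :=
  Lp.coeFn_add (fn u) (fn v)

theorem grad_add_ae (u v : H1 Ω) : grad (u + v) =ᵐ[vol Ω] grad u + grad v :=
  Lp.coeFn_add (grad u) (grad v)

theorem fn_smul_ae (c : ℂ) (u : H1 Ω) : fn (c • u) =ᵐ[vol Ω] c • ⇑(fn u) :=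
  Lp.coeFn_smul c (fn u)

theorem grad_smul_ae (c : ℂ) (u : H1 Ω) : grad (c • u) =ᵐ[vol Ω] c • ⇑(grad u) :=
  Lp.coeFn_smul c (grad u)

theorem norm_sq_eq (u : H1 Ω) : ‖u‖ ^ 2 = ‖fn u‖ ^ 2 + ‖grad u‖ ^ 2 :=
  WithLp.prod_norm_sq_eq_of_L2 (u : L2Pair Ω)

theorem norm_fn_le (u : H1 Ω) : ‖fn u‖ ≤ ‖u‖ := by
  refine le_of_sq_le_sq ?_ (norm_nonneg _)
  rw [norm_sq_eq u]
  nlinarith [sq_nonneg ‖grad u‖]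

theorem norm_grad_le (u : H1 Ω) : ‖grad u‖ ≤ ‖u‖ := by
  refine le_of_sq_le_sq ?_ (norm_nonneg _)
  rw [norm_sq_eq u]
  nlinarith [sq_nonneg ‖fn u‖]

theorem memLp_fn (u : H1 Ω) : MemLp (fn u) 2 (vol Ω) := Lp.memLp _

theorem memLp_grad (u : H1 Ω) : MemLp (grad u) 2 (vol Ω) := Lp.memLp _

/-- The underlying function as a continuous linear map. -/
noncomputable def fnL (Ω : Opens (EuclideanSpace ℝ (Fin n))) : H1 Ω →L[ℂ] Lp ℂ 2 (vol Ω) :=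
  LinearMap.mkContinuous
    { toFun := fn
      map_add' := fun _ _ => rfl
      map_smul' := fun _ _ => rfl } 1 fun u => by
      rw [one_mul]
      exact norm_fn_le u

/-- The weak gradient as a continuous linear map. -/
noncomputable def gradL (Ω : Opens (EuclideanSpace ℝ (Fin n))) :
    H1 Ω →L[ℂ] Lp (EuclideanSpace ℂ (Fin n)) 2 (vol Ω) :=
  LinearMap.mkContinuous
    { toFun := grad
      map_add' := fun _ _ => rfl
      map_smul' := fun _ _ => rfl } 1 fun u => by
      rw [one_mul]
      exact norm_grad_le u

theorem fnL_apply (u : H1 Ω) : fnL Ω u = fn u := rfl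

theorem sq_norm_Lp_two {α F : Type*} [MeasurableSpace α] {μ : Measure α} [NormedAddCommGroup F]
    (f : Lp F 2 μ) : ‖f‖ ^ 2 = ∫ x, ‖f x‖ ^ 2 ∂μ := by
  have h := (Lp.memLp f).eLpNorm_eq_integral_rpow_norm (by norm_num) (by norm_num)
  have h0 : 0 ≤ ∫ x, ‖f x‖ ^ 2 ∂μ := integral_nonneg fun _ => by positivity
  rw [Lp.norm_def, h, ENNReal.toReal_ofReal (by positivity)]
  simp only [ENNReal.toReal_ofNat, Real.rpow_ofNat]
  rw [← Real.rpow_natCast, ← Real.rpow_mul h0]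
  norm_num

/-- The Cauchy–Schwarz inequality for integrals. -/
theorem integral_norm_mul_norm_le {α F G : Type*} [MeasurableSpace α] {μ : Measure α}
    [NormedAddCommGroup F] [NormedAddCommGroup G] {f : α → F} {g : α → G} {a b : ℝ}
    (hf : MemLp f 2 μ) (hg : MemLp g 2 μ) (ha : 0 ≤ a) (hb : 0 ≤ b)
    (hfa : ∫ x, ‖f x‖ ^ 2 ∂μ ≤ a ^ 2) (hgb : ∫ x, ‖g x‖ ^ 2 ∂μ ≤ b ^ 2) :
    ∫ x, ‖f x‖ * ‖g x‖ ∂μ ≤ a * b := by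
  have h := integral_mul_norm_le_Lp_mul_Lq (μ := μ) (f := fun x => ‖f x‖) (g := fun x => ‖g x‖)
    (Real.HolderConjugate.two_two) (by simpa using hf.norm) (by simpa using hg.norm)
  simp only [Real.rpow_ofNat, norm_norm] at h
  refine h.trans ?_
  rw [← Real.sqrt_eq_rpow, ← Real.sqrt_eq_rpow]
  gcongr
  · exact Real.sqrt_le_iff.2 ⟨ha, hfa⟩
  · exact Real.sqrt_le_iff.2 ⟨hb, hgb⟩

/-- Integration against a square integrable function, as a functional on `L²`. -/
theorem exists_integral_mul_clm {α : Type*} [MeasurableSpace α] {μ : Measure α} {ψ : α → ℂ}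
    (hψ : MemLp ψ 2 μ) : ∃ L : Lp ℂ 2 μ →L[ℂ] ℂ, ∀ f, L f = ∫ x, f x * ψ x ∂μ := by
  refine ⟨innerSL ℂ (hψ.star.toLp _), fun f => ?_⟩
  rw [innerSL_apply_apply, L2.inner_def]
  refine integral_congr_ae ?_
  filter_upwards [hψ.star.coeFn_toLp] with x hx
  rw [hx]
  simp

/-- For a fixed test function both sides of the weak gradient identity are continuous in the pair,
so the space is an intersection of closed sets. The completeness that follows is what Riesz
representation and the open mapping theorem require. -/
theorem isClosed_H1 : IsClosed (H1 Ω : Set (L2Pair Ω)) := by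
  have : (H1 Ω : Set (L2Pair Ω)) = ⋂ (φ : 𝓓(Ω, ℂ)) (j : Fin n),
      {w : L2Pair Ω | ∫ x in Ω, w.fst x * partialDeriv j φ x = - ∫ x in Ω, w.snd x j * φ x} := by
    ext w
    simp only [Set.mem_iInter, Set.mem_ofPred_eq]
    rfl
  rw [this]
  refine isClosed_iInter fun φ => isClosed_iInter fun j => ?_
  obtain ⟨L₁, hL₁⟩ := exists_integral_mul_clm (memLp_partialDeriv φ j)
  obtain ⟨L₂, hL₂⟩ := exists_integral_mul_clm (memLp_test φ)
  let P := (EuclideanSpace.proj j : EuclideanSpace ℂ (Fin n) →L[ℂ] ℂ).compLpL 2 (vol Ω)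
  have h2 : ∀ G : Lp (EuclideanSpace ℂ (Fin n)) 2 (vol Ω),
      ∫ x in Ω, G x j * φ x = L₂ (P G) := by
    intro G
    rw [hL₂]
    refine integral_congr_ae ?_
    filter_upwards [(EuclideanSpace.proj j :
      EuclideanSpace ℂ (Fin n) →L[ℂ] ℂ).coeFn_compLpL (p := 2) G] with x hx
    rw [hx]
    rfl
  simp only [h2, ← hL₁]
  refine isClosed_eq ?_ ?_
  · exact L₁.continuous.comp (WithLp.prod_continuous_ofLp 2 _ _).fst
  · exact ((L₂.continuous.comp P.continuous).comp (WithLp.prod_continuous_ofLp 2 _ _).snd).neg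

instance completeSpace_H1 : CompleteSpace (H1 Ω) := isClosed_H1.completeSpace_coe

instance completeSpace_H10 : CompleteSpace (H10 Ω) :=
  (Submodule.isClosed_topologicalClosure _).completeSpace_coe

theorem ofTest_mem_H10 (φ : 𝓓(Ω, ℂ)) : ofTest Ω φ ∈ H10 Ω :=
  Submodule.le_topologicalClosure _ ⟨φ, rfl⟩

/-- Closed conditions on `H¹₀(Ω)` can be checked on test functions. -/
theorem H10_induction {P : H1 Ω → Prop} (hP : IsClosed {u | P u})
    (h : ∀ φ, P (ofTest Ω φ)) {u : H1 Ω} (hu : u ∈ H10 Ω) : P u := by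
  have hsub : ((LinearMap.range (ofTest Ω) : Submodule ℂ (H1 Ω)) : Set (H1 Ω)) ⊆ {u | P u} := by
    rintro _ ⟨φ, rfl⟩
    exact h φ
  exact closure_minimal hsub hP hu

theorem fn_ofTest (φ : 𝓓(Ω, ℂ)) : fn (ofTest Ω φ) =ᵐ[vol Ω] φ := (memLp_test φ).coeFn_toLp

theorem grad_ofTest (φ : 𝓓(Ω, ℂ)) : grad (ofTest Ω φ) =ᵐ[vol Ω] gradient φ :=
  (memLp_gradient φ).coeFn_toLp

end MagneticSchrodinger

namespace MagneticSchrodinger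

variable {n : ℕ} {Ω : Opens (EuclideanSpace ℝ (Fin n))}

/-! ### The magnetic form as a bounded bilinear form -/

theorem exists_ae_bound {α F : Type*} [MeasurableSpace α] {μ : Measure α} [NormedAddCommGroup F]
    {f : α → F} (hf : MemLp f ⊤ μ) : ∃ K : ℝ, 0 ≤ K ∧ ∀ᵐ x ∂μ, ‖f x‖ ≤ K := by
  refine ⟨(eLpNorm f ⊤ μ).toReal, ENNReal.toReal_nonneg, ?_⟩
  filter_upwards [ae_le_eLpNormEssSup (f := f) (μ := μ)] with x hx
  rw [← eLpNorm_exponent_top] at hx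
  simpa using ENNReal.toReal_mono hf.2.ne hx

/-- The integrand of `lowerForm`. -/
noncomputable def lowerIntegrand (A : EuclideanSpace ℝ (Fin n) → EuclideanSpace ℂ (Fin n))
    (Q : EuclideanSpace ℝ (Fin n) → ℂ) (u g : H1 Ω) (x : EuclideanSpace ℝ (Fin n)) : ℂ :=
  Complex.I * dot (A x) (fn u x • grad g x - fn g x • grad u x) + Q x * fn u x * fn g x

/-- The lower order form `∫_Ω (i A · (u ∇g - g ∇u) + Q u g) dx`. -/
noncomputable def lowerForm (A : EuclideanSpace ℝ (Fin n) → EuclideanSpace ℂ (Fin n))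
    (Q : EuclideanSpace ℝ (Fin n) → ℂ) (u g : H1 Ω) : ℂ :=
  ∫ x in Ω, lowerIntegrand A Q u g x

/-- The Dirichlet form `∫_Ω ∇u · ∇g dx`. -/
noncomputable def gradForm (u g : H1 Ω) : ℂ := ∫ x in Ω, dot (grad u x) (grad g x)

/-- A majorant of the integrands of the lower order forms. -/
noncomputable def lowerMajorant (u g : H1 Ω) (x : EuclideanSpace ℝ (Fin n)) : ℝ :=
  ‖fn u x‖ * ‖grad g x‖ + ‖fn g x‖ * ‖grad u x‖ + ‖fn u x‖ * ‖fn g x‖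

theorem integrable_lowerMajorant (u g : H1 Ω) : Integrable (lowerMajorant u g) (vol Ω) :=
  (((memLp_fn u).norm.integrable_mul (memLp_grad g).norm).add
    ((memLp_fn g).norm.integrable_mul (memLp_grad u).norm)).add
    ((memLp_fn u).norm.integrable_mul (memLp_fn g).norm)

theorem integral_sq_fn (u : H1 Ω) : ∫ x in Ω, ‖fn u x‖ ^ 2 = ‖fn u‖ ^ 2 :=
  (sq_norm_Lp_two (fn u)).symm

theorem integral_sq_grad (u : H1 Ω) : ∫ x in Ω, ‖grad u x‖ ^ 2 = ‖grad u‖ ^ 2 :=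
  (sq_norm_Lp_two (grad u)).symm

/-- The products of `L²` norms are kept apart because Gårding's inequality has to absorb the mixed
ones into the gradient term. -/
theorem integral_lowerMajorant_le_of_norms (u g : H1 Ω) :
    ∫ x in Ω, lowerMajorant u g x
      ≤ ‖fn u‖ * ‖grad g‖ + ‖fn g‖ * ‖grad u‖ + ‖fn u‖ * ‖fn g‖ := by
  unfold lowerMajorant
  rw [integral_add, integral_add]
  · refine add_le_add (add_le_add ?_ ?_) ?_
    · exact integral_norm_mul_norm_le (memLp_fn u) (memLp_grad g) (norm_nonneg _) (norm_nonneg _)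
        (integral_sq_fn u).le (integral_sq_grad g).le
    · exact integral_norm_mul_norm_le (memLp_fn g) (memLp_grad u) (norm_nonneg _) (norm_nonneg _)
        (integral_sq_fn g).le (integral_sq_grad u).le
    · exact integral_norm_mul_norm_le (memLp_fn u) (memLp_fn g) (norm_nonneg _) (norm_nonneg _)
        (integral_sq_fn u).le (integral_sq_fn g).le
  · exact (memLp_fn u).norm.integrable_mul (memLp_grad g).norm
  · exact (memLp_fn g).norm.integrable_mul (memLp_grad u).norm
  · exact ((memLp_fn u).norm.integrable_mul (memLp_grad g).norm).add
      ((memLp_fn g).norm.integrable_mul (memLp_grad u).norm)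
  · exact (memLp_fn u).norm.integrable_mul (memLp_fn g).norm

theorem integral_lowerMajorant_le (u g : H1 Ω) :
    ∫ x in Ω, lowerMajorant u g x ≤ 3 * ‖u‖ * ‖g‖ := by
  have h1 : ‖fn u‖ * ‖grad g‖ ≤ ‖u‖ * ‖g‖ :=
    mul_le_mul (norm_fn_le u) (norm_grad_le g) (norm_nonneg _) (norm_nonneg _)
  have h2 : ‖fn g‖ * ‖grad u‖ ≤ ‖g‖ * ‖u‖ :=
    mul_le_mul (norm_fn_le g) (norm_grad_le u) (norm_nonneg _) (norm_nonneg _)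
  have h3 : ‖fn u‖ * ‖fn g‖ ≤ ‖u‖ * ‖g‖ :=
    mul_le_mul (norm_fn_le u) (norm_fn_le g) (norm_nonneg _) (norm_nonneg _)
  refine (integral_lowerMajorant_le_of_norms u g).trans ?_
  linarith

variable {A : EuclideanSpace ℝ (Fin n) → EuclideanSpace ℂ (Fin n)}
  {Q : EuclideanSpace ℝ (Fin n) → ℂ}

/-- The constant depends only on the essential suprema of `A` and `Q`. Its uniformity in `u` and `g`
reduces the later estimates of the lower order terms to integrals of `lowerMajorant`. -/
theorem exists_norm_lowerIntegrand_le (hA : MemLp A ⊤ (vol Ω)) (hQ : MemLp Q ⊤ (vol Ω)) :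
    ∃ K : ℝ, 0 ≤ K ∧ ∀ u g : H1 Ω, ∀ᵐ x ∂vol Ω,
      ‖lowerIntegrand A Q u g x‖ ≤ K * lowerMajorant u g x := by
  obtain ⟨a, ha, hAa⟩ := exists_ae_bound hA
  obtain ⟨b, hb, hQb⟩ := exists_ae_bound hQ
  refine ⟨a + b, by positivity, fun u g => ?_⟩
  filter_upwards [hAa, hQb] with x hx1 hx2
  unfold lowerIntegrand lowerMajorant
  have h1 : ‖Complex.I * dot (A x) (fn u x • grad g x - fn g x • grad u x)‖
      ≤ a * (‖fn u x‖ * ‖grad g x‖ + ‖fn g x‖ * ‖grad u x‖) := by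
    rw [norm_mul, Complex.norm_I, one_mul]
    refine (norm_dot_le _ _).trans ?_
    refine mul_le_mul hx1 ?_ (norm_nonneg _) ha
    refine (norm_sub_le _ _).trans ?_
    rw [norm_smul, norm_smul]
  have h2 : ‖Q x * fn u x * fn g x‖ ≤ b * (‖fn u x‖ * ‖fn g x‖) := by
    rw [norm_mul, norm_mul, mul_assoc]
    exact mul_le_mul_of_nonneg_right hx2 (by positivity)
  refine (norm_add_le _ _).trans ((add_le_add h1 h2).trans ?_)
  have e1 : 0 ≤ b * (‖fn u x‖ * ‖grad g x‖ + ‖fn g x‖ * ‖grad u x‖) := by positivity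
  have e2 : 0 ≤ a * (‖fn u x‖ * ‖fn g x‖) := by positivity
  nlinarith

theorem aestronglyMeasurable_lowerIntegrand (hA : AEStronglyMeasurable A (vol Ω))
    (hQ : AEStronglyMeasurable Q (vol Ω)) (u g : H1 Ω) :
    AEStronglyMeasurable (lowerIntegrand A Q u g) (vol Ω) := by
  refine AEStronglyMeasurable.add ?_ ?_
  · refine AEStronglyMeasurable.const_mul (aestronglyMeasurable_dot hA ?_) _
    exact ((memLp_fn u).1.smul (memLp_grad g).1).sub ((memLp_fn g).1.smul (memLp_grad u).1)
  · exact (hQ.mul (memLp_fn u).1).mul (memLp_fn g).1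

theorem integrable_lowerIntegrand (hA : MemLp A ⊤ (vol Ω)) (hQ : MemLp Q ⊤ (vol Ω))
    (u g : H1 Ω) : Integrable (lowerIntegrand A Q u g) (vol Ω) := by
  obtain ⟨K, -, h⟩ := exists_norm_lowerIntegrand_le hA hQ
  exact ((integrable_lowerMajorant u g).const_mul K).mono'
    (aestronglyMeasurable_lowerIntegrand hA.1 hQ.1 u g) (h u g)

theorem exists_norm_lowerForm_le (hA : MemLp A ⊤ (vol Ω)) (hQ : MemLp Q ⊤ (vol Ω)) :
    ∃ K : ℝ, 0 ≤ K ∧ ∀ u g : H1 Ω, ‖lowerForm A Q u g‖ ≤ K * ∫ x in Ω, lowerMajorant u g x := by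
  obtain ⟨K, hK, h⟩ := exists_norm_lowerIntegrand_le hA hQ
  refine ⟨K, hK, fun u g => ?_⟩
  rw [← integral_const_mul]
  exact norm_integral_le_of_norm_le ((integrable_lowerMajorant u g).const_mul K) (h u g)

theorem integrable_dot_grad (u g : H1 Ω) :
    Integrable (fun x => dot (grad u x) (grad g x)) (vol Ω) :=
  ((memLp_grad u).norm.integrable_mul (memLp_grad g).norm).mono'
    (aestronglyMeasurable_dot (memLp_grad u).1 (memLp_grad g).1)
    (ae_of_all _ fun _ => norm_dot_le _ _)

theorem norm_gradForm_le (u g : H1 Ω) : ‖gradForm u g‖ ≤ ‖u‖ * ‖g‖ := by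
  have h1 : ‖gradForm u g‖ ≤ ∫ x in Ω, ‖grad u x‖ * ‖grad g x‖ :=
    norm_integral_le_of_norm_le ((memLp_grad u).norm.integrable_mul (memLp_grad g).norm)
      (ae_of_all _ fun _ => norm_dot_le _ _)
  have h2 := integral_norm_mul_norm_le (memLp_grad u) (memLp_grad g) (norm_nonneg _)
    (norm_nonneg _) (integral_sq_grad u).le (integral_sq_grad g).le
  exact h1.trans (h2.trans
    (mul_le_mul (norm_grad_le u) (norm_grad_le g) (norm_nonneg _) (norm_nonneg _)))

theorem lowerForm_add_right (hA : MemLp A ⊤ (vol Ω)) (hQ : MemLp Q ⊤ (vol Ω)) (u g h : H1 Ω) :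
    lowerForm A Q u (g + h) = lowerForm A Q u g + lowerForm A Q u h := by
  unfold lowerForm
  rw [← integral_add (integrable_lowerIntegrand hA hQ u g) (integrable_lowerIntegrand hA hQ u h)]
  refine integral_congr_ae ?_
  filter_upwards [fn_add_ae g h, grad_add_ae g h] with x h1 h2
  simp only [lowerIntegrand, h1, h2, Pi.add_apply, dot_sub_right, dot_smul_right, dot_add_right]
  ring

theorem lowerForm_smul_right (c : ℂ) (u g : H1 Ω) :
    lowerForm A Q u (c • g) = c * lowerForm A Q u g := by
  unfold lowerForm
  rw [← integral_const_mul]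
  refine integral_congr_ae ?_
  filter_upwards [fn_smul_ae c g, grad_smul_ae c g] with x h1 h2
  simp only [lowerIntegrand, h1, h2, Pi.smul_apply, dot_sub_right, dot_smul_right, smul_eq_mul]
  ring

/-- The first order term is antisymmetric, so an exchange of the arguments reverses `A`. Linearity
in the first argument is inherited from the second in this way. -/
theorem lowerForm_comm (u g : H1 Ω) : lowerForm A Q u g = lowerForm (-A) Q g u := by
  unfold lowerForm
  refine integral_congr_ae (ae_of_all _ fun x => ?_)
  simp only [lowerIntegrand, Pi.neg_apply, dot_neg_left, dot_sub_right]
  ring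

theorem lowerForm_add_left (hA : MemLp A ⊤ (vol Ω)) (hQ : MemLp Q ⊤ (vol Ω)) (u v g : H1 Ω) :
    lowerForm A Q (u + v) g = lowerForm A Q u g + lowerForm A Q v g := by
  rw [lowerForm_comm, lowerForm_add_right hA.neg hQ, ← lowerForm_comm, ← lowerForm_comm]

theorem lowerForm_smul_left (c : ℂ) (u g : H1 Ω) :
    lowerForm A Q (c • u) g = c * lowerForm A Q u g := by
  rw [lowerForm_comm, lowerForm_smul_right, ← lowerForm_comm]

theorem gradForm_comm (u g : H1 Ω) : gradForm u g = gradForm g u :=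
  integral_congr_ae (ae_of_all _ fun _ => dot_comm _ _)

theorem gradForm_add_right (u g h : H1 Ω) : gradForm u (g + h) = gradForm u g + gradForm u h := by
  unfold gradForm
  rw [← integral_add (integrable_dot_grad u g) (integrable_dot_grad u h)]
  refine integral_congr_ae ?_
  filter_upwards [grad_add_ae g h] with x h2
  simp only [h2, Pi.add_apply, dot_add_right]

theorem gradForm_smul_right (c : ℂ) (u g : H1 Ω) : gradForm u (c • g) = c * gradForm u g := by
  unfold gradForm
  rw [← integral_const_mul]
  refine integral_congr_ae ?_
  filter_upwards [grad_smul_ae c g] with x h2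
  simp only [h2, Pi.smul_apply, dot_smul_right]

variable {q : EuclideanSpace ℝ (Fin n) → ℂ}

theorem memLp_top_dot_add (hA : MemLp A ⊤ (vol Ω)) (hq : MemLp q ⊤ (vol Ω)) :
    MemLp (fun x => dot (A x) (A x) + q x) ⊤ (vol Ω) := by
  obtain ⟨a, ha, hAa⟩ := exists_ae_bound hA
  refine MemLp.add (memLp_top_of_bound (aestronglyMeasurable_dot hA.1 hA.1) (a * a) ?_) hq
  filter_upwards [hAa] with x hx
  exact (norm_dot_le _ _).trans (mul_le_mul hx hx (norm_nonneg _) ha)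

theorem magneticForm_eq (hA : MemLp A ⊤ (vol Ω)) (hq : MemLp q ⊤ (vol Ω)) (u g : H1 Ω) :
    magneticForm Ω A q u g
      = gradForm u g + lowerForm A (fun x => dot (A x) (A x) + q x) u g := by
  unfold magneticForm gradForm lowerForm
  rw [← integral_add (integrable_dot_grad u g)
    (integrable_lowerIntegrand hA (memLp_top_dot_add hA hq) u g)]
  refine integral_congr_ae (ae_of_all _ fun x => ?_)
  simp only [lowerIntegrand]
  ring

/-- For the bilinear pairing the transpose of `L_{A,q}` is `L_{-A,q}`. This is why the second test
solution belongs to `-A₂`, without any conjugation of the coefficients. -/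
theorem magneticForm_comm (u g : H1 Ω) :
    magneticForm Ω A q u g = magneticForm Ω (-A) q g u := by
  unfold magneticForm
  refine integral_congr_ae (ae_of_all _ fun x => ?_)
  have e : dot (-A x) (-A x) = dot (A x) (A x) := by
    simp [dot]
  simp only [Pi.neg_apply, e, dot_neg_left, dot_sub_right, dot_comm (grad u x) (grad g x)]
  ring

/-- The magnetic form is a bounded bilinear form on `H¹(Ω)`. -/
theorem exists_magneticForm_clm (hA : MemLp A ⊤ (vol Ω)) (hq : MemLp q ⊤ (vol Ω)) :
    ∃ B : H1 Ω →L[ℂ] H1 Ω →L[ℂ] ℂ, ∀ u g, B u g = magneticForm Ω A q u g := by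
  set Q := fun x => dot (A x) (A x) + q x with hQdef
  have hQ : MemLp Q ⊤ (vol Ω) := memLp_top_dot_add hA hq
  obtain ⟨K, hK, hb⟩ := exists_norm_lowerForm_le hA hQ
  have hr : ∀ u g h, magneticForm Ω A q u (g + h)
      = magneticForm Ω A q u g + magneticForm Ω A q u h := fun u g h => by
    rw [magneticForm_eq hA hq, magneticForm_eq hA hq, magneticForm_eq hA hq, gradForm_add_right,
      lowerForm_add_right hA hQ]
    ring
  have hs : ∀ (c : ℂ) u g, magneticForm Ω A q u (c • g) = c * magneticForm Ω A q u g :=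
    fun c u g => by
      rw [magneticForm_eq hA hq, magneticForm_eq hA hq, gradForm_smul_right,
        lowerForm_smul_right]
      ring
  have hl : ∀ u v g, magneticForm Ω A q (u + v) g
      = magneticForm Ω A q u g + magneticForm Ω A q v g := fun u v g => by
    rw [magneticForm_eq hA hq, magneticForm_eq hA hq, magneticForm_eq hA hq, gradForm_comm,
      gradForm_add_right, lowerForm_add_left hA hQ, gradForm_comm g, gradForm_comm g]
    ring
  have hsl : ∀ (c : ℂ) u g, magneticForm Ω A q (c • u) g = c * magneticForm Ω A q u g :=
    fun c u g => by
      rw [magneticForm_eq hA hq, magneticForm_eq hA hq, gradForm_comm, gradForm_smul_right,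
        lowerForm_smul_left, gradForm_comm g]
      ring
  refine ⟨LinearMap.mkContinuous₂ (LinearMap.mk₂ ℂ (magneticForm Ω A q) hl hsl hr hs)
    (1 + K * 3) fun u g => ?_, fun u g => rfl⟩
  rw [LinearMap.mk₂_apply, magneticForm_eq hA hq]
  have h1 := norm_gradForm_le u g
  have h2 := hb u g
  have h3 := mul_le_mul_of_nonneg_left (integral_lowerMajorant_le u g) hK
  refine (norm_add_le _ _).trans ?_
  linarith

end MagneticSchrodinger

namespace MagneticSchrodinger

variable {n : ℕ} {Ω : Opens (EuclideanSpace ℝ (Fin n))}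

/-! ### Complex conjugation on `H¹(Ω)` -/

/-- Complex conjugation on `ℂⁿ`. -/
noncomputable def conjVec (v : EuclideanSpace ℂ (Fin n)) : EuclideanSpace ℂ (Fin n) :=
  WithLp.toLp 2 fun j => starRingEnd ℂ (v j)

theorem conjVec_apply (v : EuclideanSpace ℂ (Fin n)) (j : Fin n) :
    conjVec v j = starRingEnd ℂ (v j) := rfl

theorem norm_conjVec (v : EuclideanSpace ℂ (Fin n)) : ‖conjVec v‖ = ‖v‖ := by
  simp [EuclideanSpace.norm_eq, conjVec_apply]

theorem continuous_conjVec : Continuous (conjVec : EuclideanSpace ℂ (Fin n) → _) := by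
  refine (PiLp.continuous_toLp 2 _).comp (continuous_pi fun j => ?_)
  exact Complex.continuous_conj.comp (EuclideanSpace.proj (𝕜 := ℂ) j).continuous

theorem dot_conjVec_self (v : EuclideanSpace ℂ (Fin n)) : dot v (conjVec v) = (‖v‖ ^ 2 : ℝ) := by
  rw [EuclideanSpace.norm_sq_eq, Complex.ofReal_sum]
  refine Finset.sum_congr rfl fun j _ => ?_
  rw [conjVec_apply, Complex.mul_conj, Complex.normSq_eq_norm_sq]

/-- The complex conjugate of a test function. -/
noncomputable def conjTest (φ : 𝓓(Ω, ℂ)) : 𝓓(Ω, ℂ) where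
  toFun := fun x => starRingEnd ℂ (φ x)
  contDiff' := Complex.conjCLE.contDiff.comp φ.contDiff
  hasCompactSupport' := φ.hasCompactSupport.comp_left (map_zero (starRingEnd ℂ))
  tsupport_subset' := (closure_mono (Function.support_comp_subset (map_zero (starRingEnd ℂ)) φ)).trans
    φ.tsupport_subset

theorem conjTest_apply (φ : 𝓓(Ω, ℂ)) (x : EuclideanSpace ℝ (Fin n)) :
    conjTest φ x = starRingEnd ℂ (φ x) := rfl

theorem partialDeriv_conjTest (φ : 𝓓(Ω, ℂ)) (j : Fin n) (x : EuclideanSpace ℝ (Fin n)) :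
    partialDeriv j (conjTest φ) x = starRingEnd ℂ (partialDeriv j φ x) := by
  have hφ : DifferentiableAt ℝ φ x := φ.contDiff.differentiable (by simp) x
  have h : HasFDerivAt (conjTest φ) ((Complex.conjCLE : ℂ →L[ℝ] ℂ).comp (fderiv ℝ φ x)) x :=
    (Complex.conjCLE : ℂ →L[ℝ] ℂ).hasFDerivAt.comp x hφ.hasFDerivAt
  rw [partialDeriv, h.fderiv]
  rfl

theorem memLp_conj_fn (u : H1 Ω) : MemLp (fun x => starRingEnd ℂ (fn u x)) 2 (vol Ω) :=
  (memLp_fn u).star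

theorem memLp_conj_grad (u : H1 Ω) : MemLp (fun x => conjVec (grad u x)) 2 (vol Ω) :=
  (memLp_grad u).of_le (continuous_conjVec.comp_aestronglyMeasurable (memLp_grad u).1)
    (ae_of_all _ fun _ => (norm_conjVec _).le)

theorem isWeakGradient_conj (u : H1 Ω) :
    IsWeakGradient Ω ((memLp_conj_fn u).toLp _) ((memLp_conj_grad u).toLp _) := by
  intro φ j
  have h := congrArg (starRingEnd ℂ) (u.2 (conjTest φ) j)
  rw [map_neg, ← integral_conj, ← integral_conj] at h
  have e1 : ∫ x in Ω, ((memLp_conj_fn u).toLp _) x * partialDeriv j φ x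
      = ∫ x in Ω, starRingEnd ℂ (fn u x * partialDeriv j (conjTest φ) x) := by
    refine integral_congr_ae ?_
    filter_upwards [(memLp_conj_fn u).coeFn_toLp] with x hx
    rw [hx, partialDeriv_conjTest, map_mul, Complex.conj_conj]
  have e2 : ∫ x in Ω, ((memLp_conj_grad u).toLp _) x j * φ x
      = ∫ x in Ω, starRingEnd ℂ (grad u x j * conjTest φ x) := by
    refine integral_congr_ae ?_
    filter_upwards [(memLp_conj_grad u).coeFn_toLp] with x hx
    rw [hx, conjVec_apply, conjTest_apply, map_mul, Complex.conj_conj]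
  rw [e1, e2]
  exact h

/-- The complex conjugate of an element of `H¹(Ω)`. -/
noncomputable def conjH1 (u : H1 Ω) : H1 Ω :=
  ⟨WithLp.toLp 2 ((memLp_conj_fn u).toLp _, (memLp_conj_grad u).toLp _), isWeakGradient_conj u⟩

theorem fn_conjH1 (u : H1 Ω) : fn (conjH1 u) =ᵐ[vol Ω] fun x => starRingEnd ℂ (fn u x) :=
  (memLp_conj_fn u).coeFn_toLp

theorem grad_conjH1 (u : H1 Ω) : grad (conjH1 u) =ᵐ[vol Ω] fun x => conjVec (grad u x) :=
  (memLp_conj_grad u).coeFn_toLp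

theorem H1_ext {u v : H1 Ω} (h1 : fn u =ᵐ[vol Ω] fn v) (h2 : grad u =ᵐ[vol Ω] grad v) : u = v := by
  refine Subtype.ext ((WithLp.equiv 2 _).injective (Prod.ext ?_ ?_))
  · exact Lp.ext h1
  · exact Lp.ext h2

theorem norm_fn_conjH1 (u : H1 Ω) : ‖fn (conjH1 u)‖ = ‖fn u‖ := by
  refine (sq_eq_sq₀ (norm_nonneg _) (norm_nonneg _)).1 ?_
  rw [← integral_sq_fn, ← integral_sq_fn]
  refine integral_congr_ae ?_
  filter_upwards [fn_conjH1 u] with x hx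
  rw [hx, Complex.norm_conj]

theorem norm_grad_conjH1 (u : H1 Ω) : ‖grad (conjH1 u)‖ = ‖grad u‖ := by
  refine (sq_eq_sq₀ (norm_nonneg _) (norm_nonneg _)).1 ?_
  rw [← integral_sq_grad, ← integral_sq_grad]
  refine integral_congr_ae ?_
  filter_upwards [grad_conjH1 u] with x hx
  rw [hx, norm_conjVec]

theorem norm_conjH1 (u : H1 Ω) : ‖conjH1 u‖ = ‖u‖ := by
  refine (sq_eq_sq₀ (norm_nonneg _) (norm_nonneg _)).1 ?_
  rw [norm_sq_eq, norm_sq_eq, norm_fn_conjH1, norm_grad_conjH1]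

theorem conjH1_add (u v : H1 Ω) : conjH1 (u + v) = conjH1 u + conjH1 v := by
  refine H1_ext ?_ ?_
  · filter_upwards [fn_conjH1 (u + v), fn_conjH1 u, fn_conjH1 v, fn_add_ae u v,
      fn_add_ae (conjH1 u) (conjH1 v)] with x h1 h2 h3 h4 h5
    rw [h1, h5, h4, Pi.add_apply, Pi.add_apply, h2, h3, map_add]
  · filter_upwards [grad_conjH1 (u + v), grad_conjH1 u, grad_conjH1 v, grad_add_ae u v,
      grad_add_ae (conjH1 u) (conjH1 v)] with x h1 h2 h3 h4 h5
    rw [h1, h5, h4, Pi.add_apply, Pi.add_apply, h2, h3]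
    ext j
    simp [conjVec_apply]

theorem conjH1_smul (c : ℂ) (u : H1 Ω) : conjH1 (c • u) = starRingEnd ℂ c • conjH1 u := by
  refine H1_ext ?_ ?_
  · filter_upwards [fn_conjH1 (c • u), fn_conjH1 u, fn_smul_ae c u,
      fn_smul_ae (starRingEnd ℂ c) (conjH1 u)] with x h1 h2 h3 h4
    rw [h1, h4, h3, Pi.smul_apply, Pi.smul_apply, h2, smul_eq_mul, smul_eq_mul, map_mul]
  · filter_upwards [grad_conjH1 (c • u), grad_conjH1 u, grad_smul_ae c u,
      grad_smul_ae (starRingEnd ℂ c) (conjH1 u)] with x h1 h2 h3 h4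
    rw [h1, h4, h3, Pi.smul_apply, Pi.smul_apply, h2]
    ext j
    simp [conjVec_apply]

theorem conjH1_ofTest (φ : 𝓓(Ω, ℂ)) : conjH1 (ofTest Ω φ) = ofTest Ω (conjTest φ) := by
  refine H1_ext ?_ ?_
  · filter_upwards [fn_conjH1 (ofTest Ω φ), fn_ofTest φ, fn_ofTest (conjTest φ)] with x h1 h2 h3
    rw [h1, h2, h3, conjTest_apply]
  · filter_upwards [grad_conjH1 (ofTest Ω φ), grad_ofTest φ, grad_ofTest (conjTest φ)]
      with x h1 h2 h3
    rw [h1, h2, h3]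
    ext j
    exact (partialDeriv_conjTest φ j x).symm

theorem conjTest_conjTest (φ : 𝓓(Ω, ℂ)) : conjTest (conjTest φ) = φ := by
  ext x
  simp [conjTest_apply]

theorem gradForm_conjH1 (u : H1 Ω) : gradForm u (conjH1 u) = (‖grad u‖ ^ 2 : ℝ) := by
  rw [← integral_sq_grad, ← integral_complex_ofReal]
  refine integral_congr_ae ?_
  filter_upwards [grad_conjH1 u] with x hx
  rw [hx, dot_conjVec_self]

/-- The Gårding inequality. -/
theorem exists_garding {A : EuclideanSpace ℝ (Fin n) → EuclideanSpace ℂ (Fin n)}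
    {q : EuclideanSpace ℝ (Fin n) → ℂ} (hA : MemLp A ⊤ (vol Ω)) (hq : MemLp q ⊤ (vol Ω)) :
    ∃ K : ℝ, 0 ≤ K ∧ ∀ u : H1 Ω, 2⁻¹ * ‖grad u‖ ^ 2 - K * ‖fn u‖ ^ 2
      ≤ (magneticForm Ω A q u (conjH1 u)).re := by
  obtain ⟨K, hK, hb⟩ := exists_norm_lowerForm_le hA (memLp_top_dot_add hA hq)
  -- With `s`, `t` the `L²` norms of `u` and `∇u`, the lower order terms are at most `K (2 s t +
  -- s²)`, and `2 K s t ≤ 2 K² s² + ½ t²`.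
  refine ⟨2 * K ^ 2 + K, by positivity, fun u => ?_⟩
  rw [magneticForm_eq hA hq, gradForm_conjH1, Complex.add_re, Complex.ofReal_re]
  have h1 := hb u (conjH1 u)
  have h2 := mul_le_mul_of_nonneg_left (integral_lowerMajorant_le_of_norms u (conjH1 u)) hK
  rw [norm_fn_conjH1, norm_grad_conjH1] at h2
  have h3 := (abs_le.1 ((Complex.abs_re_le_norm _).trans (h1.trans h2))).1
  nlinarith [sq_nonneg (2 * K * ‖fn u‖ - ‖grad u‖)]

end MagneticSchrodinger

namespace MagneticSchrodinger

variable {n : ℕ} {Ω : Opens (EuclideanSpace ℝ (Fin n))}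

/-! ### The Poincaré inequality up to finitely many frequencies -/

open scoped FourierTransform LineDeriv in
theorem integral_norm_sq_fourier_test (φ : 𝓓(Ω, ℂ)) :
    Integrable (fun ξ => ‖𝓕 (φ : EuclideanSpace ℝ (Fin n) → ℂ) ξ‖ ^ 2) ∧
    ∫ ξ, ‖𝓕 (φ : EuclideanSpace ℝ (Fin n) → ℂ) ξ‖ ^ 2 = ∫ x, ‖φ x‖ ^ 2 := by
  let f := φ.hasCompactSupport.toSchwartzMap φ.contDiff
  have h := f.integral_norm_sq_fourier
  have hi := ((𝓕 f).memLp 2 volume).integrable_norm_pow (by norm_num)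
  rw [SchwartzMap.fourier_coe] at h hi
  exact ⟨hi, h⟩

open scoped FourierTransform LineDeriv in
theorem integral_norm_sq_fourier_partialDeriv (φ : 𝓓(Ω, ℂ)) (j : Fin n) :
    Integrable (fun ξ => 4 * Real.pi ^ 2 * (ξ j ^ 2 *
      ‖𝓕 (φ : EuclideanSpace ℝ (Fin n) → ℂ) ξ‖ ^ 2)) ∧
    ∫ ξ, 4 * Real.pi ^ 2 * (ξ j ^ 2 * ‖𝓕 (φ : EuclideanSpace ℝ (Fin n) → ℂ) ξ‖ ^ 2)
      = ∫ x, ‖partialDeriv j φ x‖ ^ 2 := by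
  let f := φ.hasCompactSupport.toSchwartzMap φ.contDiff
  let v : EuclideanSpace ℝ (Fin n) := EuclideanSpace.single j 1
  have h := (∂_{v} f).integral_norm_sq_fourier
  have hi := ((𝓕 (∂_{v} f)).memLp 2 volume).integrable_norm_pow (by norm_num)
  have hg : (inner ℝ · v).HasTemperateGrowth := ((innerSL ℝ).flip v).hasTemperateGrowth
  have e : ∀ ξ, ‖𝓕 (∂_{v} f) ξ‖ ^ 2
      = 4 * Real.pi ^ 2 * (ξ j ^ 2 * ‖𝓕 (φ : EuclideanSpace ℝ (Fin n) → ℂ) ξ‖ ^ 2) := by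
    intro ξ
    have hf : (𝓕 f) ξ = 𝓕 (φ : EuclideanSpace ℝ (Fin n) → ℂ) ξ := by
      rw [SchwartzMap.fourier_coe]; rfl
    rw [SchwartzMap.fourier_lineDerivOp_eq, _root_.smul_apply,
      SchwartzMap.smulLeftCLM_apply_apply hg, hf, norm_smul, norm_smul]
    have hin : inner ℝ ξ v = ξ j := by simp [v, EuclideanSpace.inner_single_right]
    rw [hin]
    simp only [norm_mul, Complex.norm_ofNat, Complex.norm_real, Complex.norm_I, mul_one, mul_pow,
      Real.norm_eq_abs, sq_abs]
    ring
  simp only [e] at h hi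
  refine ⟨hi, h.trans ?_⟩
  rfl

theorem norm_fourierChar_sub_le (a b : ℝ) :
    ‖(Real.fourierChar a : ℂ) - Real.fourierChar b‖ ≤ 2 * Real.pi * |a - b| := by
  have e : (Real.fourierChar a : ℂ) - Real.fourierChar b
      = Real.fourierChar b * (Complex.exp (Complex.I * ((2 * Real.pi * (a - b) : ℝ) : ℂ)) - 1) := by
    rw [Real.fourierChar_apply, Real.fourierChar_apply, mul_sub, mul_one, ← Complex.exp_add]
    congr 2
    push_cast
    ring
  rw [e, norm_mul, Circle.norm_coe, one_mul]
  refine Real.norm_exp_I_mul_ofReal_sub_one_le.trans_eq ?_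
  rw [norm_mul, norm_mul, Real.norm_eq_abs, Real.norm_eq_abs, Real.norm_eq_abs,
    abs_of_nonneg Real.pi_pos.le]
  norm_num

theorem integral_test_eq {F : Type*} [NormedAddCommGroup F] [NormedSpace ℝ F] (φ : 𝓓(Ω, ℂ))
    {f : EuclideanSpace ℝ (Fin n) → F} (hf : ∀ x ∉ tsupport φ, f x = 0) :
    ∫ x, f x = ∫ x in Ω, f x :=
  (setIntegral_eq_integral_of_forall_compl_eq_zero fun x hx =>
    hf x fun h => hx (φ.tsupport_subset h)).symm

theorem integral_sq_test (φ : 𝓓(Ω, ℂ)) : ∫ x, ‖φ x‖ ^ 2 = ‖fn (ofTest Ω φ)‖ ^ 2 := by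
  rw [integral_test_eq φ fun x hx => by rw [image_eq_zero_of_notMem_tsupport hx]; simp,
    ← integral_sq_fn]
  refine integral_congr_ae ?_
  filter_upwards [fn_ofTest φ] with x hx
  rw [hx]

theorem partialDeriv_eq_zero_of_notMem {φ : EuclideanSpace ℝ (Fin n) → ℂ} (j : Fin n)
    {x : EuclideanSpace ℝ (Fin n)} (hx : x ∉ tsupport φ) : partialDeriv j φ x = 0 := by
  rw [partialDeriv, fderiv_of_notMem_tsupport ℝ hx]
  rfl

theorem sum_integral_sq_partialDeriv (φ : 𝓓(Ω, ℂ)) :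
    ∑ j, ∫ x, ‖partialDeriv j φ x‖ ^ 2 = ‖grad (ofTest Ω φ)‖ ^ 2 := by
  rw [← integral_finsetSum, integral_test_eq φ, ← integral_sq_grad]
  · refine integral_congr_ae ?_
    filter_upwards [grad_ofTest φ] with x hx
    rw [hx, EuclideanSpace.norm_sq_eq]
    rfl
  · intro x hx
    simp [partialDeriv_eq_zero_of_notMem _ hx]
  · intro j _
    exact (((continuous_partialDeriv φ j).memLp_of_hasCompactSupport
      (hasCompactSupport_partialDeriv φ j)).integrable_norm_pow (p := 2) (by norm_num))

open scoped FourierTransform in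
/-- The Fourier transform at a fixed frequency is a bounded functional on `H¹(Ω)`. -/
theorem exists_fourier_functional (hbdd : Bornology.IsBounded (Ω : Set (EuclideanSpace ℝ (Fin n))))
    (ξ : EuclideanSpace ℝ (Fin n)) : ∃ L : H1 Ω →L[ℂ] ℂ, ∀ φ : 𝓓(Ω, ℂ),
      L (ofTest Ω φ) = 𝓕 (φ : EuclideanSpace ℝ (Fin n) → ℂ) ξ := by
  have : IsFiniteMeasure (vol Ω) := ⟨by simpa using hbdd.measure_lt_top⟩
  have hc : Continuous fun x : EuclideanSpace ℝ (Fin n) =>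
      (Real.fourierChar (-inner ℝ x ξ) : ℂ) := by
    have : Continuous fun x : EuclideanSpace ℝ (Fin n) => -inner ℝ x ξ := by fun_prop
    exact continuous_subtype_val.comp (Real.continuous_fourierChar.comp this)
  have hm : MemLp (fun x => (Real.fourierChar (-inner ℝ x ξ) : ℂ)) 2 (vol Ω) :=
    MemLp.of_bound hc.aestronglyMeasurable 1 (ae_of_all _ fun x => (Circle.norm_coe _).le)
  obtain ⟨L, hL⟩ := exists_integral_mul_clm hm
  refine ⟨L.comp (fnL Ω), fun φ => ?_⟩
  rw [ContinuousLinearMap.comp_apply, hL, Real.fourier_eq, integral_test_eq φ]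
  · refine integral_congr_ae ?_
    filter_upwards [fn_ofTest φ] with x hx
    rw [fnL_apply, hx, Circle.smul_def, smul_eq_mul, mul_comm]
  · intro x hx
    rw [image_eq_zero_of_notMem_tsupport hx, smul_zero]

open scoped FourierTransform in
/-- The Fourier transform of functions supported in a bounded set is Lipschitz, with a constant
controlled by the `L²` norm. -/
theorem exists_norm_fourier_sub_le
    (hbdd : Bornology.IsBounded (Ω : Set (EuclideanSpace ℝ (Fin n)))) :
    ∃ C : ℝ, 0 < C ∧ ∀ (φ : 𝓓(Ω, ℂ)) (ξ η : EuclideanSpace ℝ (Fin n)),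
      ‖𝓕 (φ : EuclideanSpace ℝ (Fin n) → ℂ) ξ - 𝓕 (φ : EuclideanSpace ℝ (Fin n) → ℂ) η‖
        ≤ C * ‖ξ - η‖ * ‖fn (ofTest Ω φ)‖ := by
  have : IsFiniteMeasure (vol Ω) := ⟨by simpa using hbdd.measure_lt_top⟩
  obtain ⟨D, hD0, hD⟩ := hbdd.exists_pos_norm_le
  set b : ℝ := Real.sqrt (∫ _ in (Ω : Set (EuclideanSpace ℝ (Fin n))), ‖(1 : ℝ)‖ ^ 2) with hb
  refine ⟨2 * Real.pi * D * (b + 1), by positivity, fun φ ξ η => ?_⟩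
  have hint : ∀ ξ : EuclideanSpace ℝ (Fin n),
      Integrable fun x => Real.fourierChar (-inner ℝ x ξ) • φ x := fun ξ => by
    have h := (Real.fourierIntegral_convergent_iff (μ := volume) (f := φ) ξ).2
      (φ.continuous.integrable_of_hasCompactSupport φ.hasCompactSupport)
    exact h
  rw [Real.fourier_eq, Real.fourier_eq, ← integral_sub (hint ξ) (hint η), integral_test_eq φ]
  swap
  · intro x hx
    simp [image_eq_zero_of_notMem_tsupport hx]
  have hφ : MemLp φ 2 (vol Ω) := memLp_test φ
  have hone : MemLp (fun _ : EuclideanSpace ℝ (Fin n) => (1 : ℝ)) 2 (vol Ω) := memLp_const 1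
  have hsq : ∫ x in Ω, ‖φ x‖ ^ 2 = ‖fn (ofTest Ω φ)‖ ^ 2 := by
    rw [← integral_sq_test, integral_test_eq φ fun x hx => by
      rw [image_eq_zero_of_notMem_tsupport hx]; simp]
  have hcs := integral_norm_mul_norm_le hone hφ (Real.sqrt_nonneg _) (norm_nonneg (fn (ofTest Ω φ)))
    (Real.sq_sqrt (integral_nonneg fun _ => by positivity)).ge hsq.le
  rw [← hb] at hcs
  have hle : ‖∫ x in Ω, (Real.fourierChar (-inner ℝ x ξ) • φ x
      - Real.fourierChar (-inner ℝ x η) • φ x)‖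
      ≤ ∫ x in Ω, 2 * Real.pi * D * ‖ξ - η‖ * (‖(1 : ℝ)‖ * ‖φ x‖) := by
    refine norm_integral_le_of_norm_le ((hone.norm.integrable_mul hφ.norm).const_mul _) ?_
    filter_upwards [ae_restrict_mem Ω.isOpen.measurableSet] with x hx
    rw [Circle.smul_def, Circle.smul_def, smul_eq_mul, smul_eq_mul, ← sub_mul, norm_mul, norm_one,
      one_mul]
    refine mul_le_mul_of_nonneg_right ?_ (norm_nonneg _)
    refine (norm_fourierChar_sub_le _ _).trans ?_
    have e : |-inner ℝ x ξ - -inner ℝ x η| ≤ D * ‖ξ - η‖ := by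
      rw [neg_sub_neg, ← inner_sub_right, norm_sub_rev ξ η]
      exact (abs_real_inner_le_norm _ _).trans
        (mul_le_mul_of_nonneg_right (hD x hx) (norm_nonneg _))
    have := mul_le_mul_of_nonneg_left e (by positivity : 0 ≤ 2 * Real.pi)
    linarith
  refine hle.trans ?_
  rw [integral_const_mul]
  have h1 : (∫ x in Ω, ‖(1 : ℝ)‖ * ‖φ x‖) ≤ (b + 1) * ‖fn (ofTest Ω φ)‖ :=
    hcs.trans (mul_le_mul_of_nonneg_right (by linarith) (norm_nonneg _))
  calc _ ≤ 2 * Real.pi * D * ‖ξ - η‖ * ((b + 1) * ‖fn (ofTest Ω φ)‖) := by gcongr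
    _ = _ := by ring

open scoped FourierTransform in
/-- The high frequencies of a test function are controlled by its gradient. -/
theorem norm_sq_test_le_low_frequency (φ : 𝓓(Ω, ℂ)) {R : ℝ} (hR : 0 < R) :
    ‖fn (ofTest Ω φ)‖ ^ 2 ≤
      (∫ ξ in Metric.closedBall 0 R, ‖𝓕 (φ : EuclideanSpace ℝ (Fin n) → ℂ) ξ‖ ^ 2)
        + (4 * Real.pi ^ 2 * R ^ 2)⁻¹ * ‖grad (ofTest Ω φ)‖ ^ 2 := by
  obtain ⟨hi, he⟩ := integral_norm_sq_fourier_test φ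
  have hij := fun j => (integral_norm_sq_fourier_partialDeriv φ j).1
  have hej := fun j => (integral_norm_sq_fourier_partialDeriv φ j).2
  have hsum : ∫ ξ, ∑ j, 4 * Real.pi ^ 2 * (ξ j ^ 2 *
      ‖𝓕 (φ : EuclideanSpace ℝ (Fin n) → ℂ) ξ‖ ^ 2) = ‖grad (ofTest Ω φ)‖ ^ 2 := by
    rw [integral_finsetSum _ fun j _ => hij j, ← sum_integral_sq_partialDeriv]
    exact Finset.sum_congr rfl fun j _ => hej j
  rw [← integral_sq_test, ← he, ← hsum, ← integral_const_mul,
    ← integral_indicator Metric.isClosed_closedBall.measurableSet, ← integral_add]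
  · refine integral_mono hi ?_ fun ξ => ?_
    · exact (hi.indicator Metric.isClosed_closedBall.measurableSet).add
        ((integrable_finsetSum _ fun j _ => hij j).const_mul _)
    · simp only [← Finset.mul_sum, ← Finset.sum_mul]
      have hx : ∑ j, ξ j ^ 2 = ‖ξ‖ ^ 2 := by
        rw [EuclideanSpace.norm_sq_eq]
        simp
      rw [hx]
      set a := ‖𝓕 (φ : EuclideanSpace ℝ (Fin n) → ℂ) ξ‖ ^ 2 with ha
      have ha0 : 0 ≤ a := by positivity
      have e : (4 * Real.pi ^ 2 * R ^ 2)⁻¹ * (4 * Real.pi ^ 2 * (‖ξ‖ ^ 2 * a))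
          = ‖ξ‖ ^ 2 / R ^ 2 * a := by
        have := Real.pi_pos
        field_simp
      rw [e]
      by_cases hξ : ξ ∈ Metric.closedBall (0 : EuclideanSpace ℝ (Fin n)) R
      · rw [Set.indicator_of_mem hξ]
        have : 0 ≤ ‖ξ‖ ^ 2 / R ^ 2 * a := by positivity
        linarith
      · rw [Set.indicator_of_notMem hξ, zero_add]
        rw [mem_closedBall_zero_iff, not_le] at hξ
        have h1 : 1 ≤ ‖ξ‖ ^ 2 / R ^ 2 := by
          rw [one_le_div (by positivity)]
          gcongr
        nlinarith
  · exact hi.indicator Metric.isClosed_closedBall.measurableSet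
  · exact (integrable_finsetSum _ fun j _ => hij j).const_mul _

/-- On `H¹₀(Ω)`, the `L²` norm is controlled by finitely many functionals and a small multiple
of the norm of the gradient. -/
theorem exists_finset_functionals
    (hbdd : Bornology.IsBounded (Ω : Set (EuclideanSpace ℝ (Fin n)))) {δ : ℝ} (hδ : 0 < δ) :
    ∃ (s : Finset (H1 Ω →L[ℂ] ℂ)) (C : ℝ), ∀ u ∈ H10 Ω,
      ‖fn u‖ ^ 2 ≤ δ * ‖grad u‖ ^ 2 + C * ∑ L ∈ s, ‖L u‖ ^ 2 := by
  classical
  obtain ⟨K, hK, hLip⟩ := exists_norm_fourier_sub_le hbdd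
  -- The factor `2` pays for moving half of the squared `L²` norm to the left-hand side at the end.
  obtain ⟨R, hR0, hR⟩ : ∃ R : ℝ, 0 < R ∧ 2 * (4 * Real.pi ^ 2 * R ^ 2)⁻¹ ≤ δ := by
    refine ⟨(2 * Real.pi * Real.sqrt (δ / 2))⁻¹, by positivity, ?_⟩
    have h := Real.sq_sqrt (by positivity : 0 ≤ δ / 2)
    have := Real.pi_pos
    rw [inv_pow, mul_pow, mul_pow, h]
    apply le_of_eq
    field_simp
    ring
  set v : ℝ := (volume (Metric.closedBall (0 : EuclideanSpace ℝ (Fin n)) R)).toReal with hv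
  have hv0 : 0 ≤ v := ENNReal.toReal_nonneg
  -- The mesh is so fine that replacing frequencies by net points costs, integrated over the ball of
  -- volume `v`, at most half of the squared `L²` norm. Using `v + 1` avoids the need for a lower
  -- bound on `v`.
  set η : ℝ := (2 * K * (v + 1))⁻¹ with hη
  have hη0 : 0 < η := by positivity
  -- Low frequencies form a compact ball, so finitely many values of the Fourier transform control
  -- them up to the Lipschitz error. This takes the place of Rellich compactness.
  obtain ⟨t, -, htf, htc⟩ := (isCompact_closedBall (0 : EuclideanSpace ℝ (Fin n)) R).finite_cover_balls
    hη0
  choose L hL using exists_fourier_functional hbdd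
  refine ⟨htf.toFinset.image L, 4 * v, fun u hu => ?_⟩
  refine H10_induction (P := fun u => ‖fn u‖ ^ 2 ≤ δ * ‖grad u‖ ^ 2
    + 4 * v * ∑ L ∈ htf.toFinset.image L, ‖L u‖ ^ 2) ?_ (fun φ => ?_) hu
  · have h1 : Continuous fun u : H1 Ω => ‖fn u‖ := (fnL Ω).continuous.norm
    have h2 : Continuous fun u : H1 Ω => ‖grad u‖ := (gradL Ω).continuous.norm
    have h3 : Continuous fun u : H1 Ω => ∑ L ∈ htf.toFinset.image L, ‖L u‖ ^ 2 :=
      continuous_finsetSum _ fun L _ => L.continuous.norm.pow 2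
    exact isClosed_le (h1.pow 2) (((h2.pow 2).const_mul δ).add (h3.const_mul (4 * v)))
  · set a := ‖fn (ofTest Ω φ)‖ with ha
    set S := ∑ L ∈ htf.toFinset.image L, ‖L (ofTest Ω φ)‖ ^ 2 with hS
    have hlow := norm_sq_test_le_low_frequency φ hR0
    have hpt : ∀ ξ ∈ Metric.closedBall (0 : EuclideanSpace ℝ (Fin n)) R,
        ‖FourierTransform.fourier (φ : EuclideanSpace ℝ (Fin n) → ℂ) ξ‖ ^ 2
          ≤ 2 * S + 2 * (K * η * a) ^ 2 := by
      intro ξ hξ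
      obtain ⟨ζ, hζ, hd⟩ := Set.mem_iUnion₂.1 (htc hξ)
      have h1 := hLip φ ξ ζ
      rw [Metric.mem_ball, dist_eq_norm] at hd
      have h2 : K * ‖ξ - ζ‖ * a ≤ K * η * a := by gcongr
      have h3 : ‖FourierTransform.fourier (φ : EuclideanSpace ℝ (Fin n) → ℂ) ζ‖ ^ 2 ≤ S := by
        rw [← hL]
        exact Finset.single_le_sum (f := fun L : H1 Ω →L[ℂ] ℂ => ‖L (ofTest Ω φ)‖ ^ 2)
          (fun _ _ => by positivity)
          (Finset.mem_image_of_mem L (htf.mem_toFinset.2 hζ))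
      have h4 := norm_le_norm_add_norm_sub'
        (FourierTransform.fourier (φ : EuclideanSpace ℝ (Fin n) → ℂ) ξ)
        (FourierTransform.fourier (φ : EuclideanSpace ℝ (Fin n) → ℂ) ζ)
      have h5 := norm_nonneg (FourierTransform.fourier (φ : EuclideanSpace ℝ (Fin n) → ℂ) ξ)
      have h6 : ‖FourierTransform.fourier (φ : EuclideanSpace ℝ (Fin n) → ℂ) ξ‖
          ≤ ‖FourierTransform.fourier (φ : EuclideanSpace ℝ (Fin n) → ℂ) ζ‖ + K * η * a := by
        linarith
      calc _ ≤ (‖FourierTransform.fourier (φ : EuclideanSpace ℝ (Fin n) → ℂ) ζ‖ + K * η * a) ^ 2 := by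
            gcongr
        _ ≤ 2 * ‖FourierTransform.fourier (φ : EuclideanSpace ℝ (Fin n) → ℂ) ζ‖ ^ 2
            + 2 * (K * η * a) ^ 2 := by
            nlinarith [sq_nonneg (‖FourierTransform.fourier
              (φ : EuclideanSpace ℝ (Fin n) → ℂ) ζ‖ - K * η * a)]
        _ ≤ _ := by linarith
    have hball : (∫ ξ in Metric.closedBall 0 R,
        ‖FourierTransform.fourier (φ : EuclideanSpace ℝ (Fin n) → ℂ) ξ‖ ^ 2)
        ≤ (2 * S + 2 * (K * η * a) ^ 2) * v := by
      refine (setIntegral_mono_on (integral_norm_sq_fourier_test φ).1.integrableOn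
        (integrableOn_const (measure_closedBall_lt_top.ne))
        Metric.isClosed_closedBall.measurableSet hpt).trans_eq ?_
      rw [setIntegral_const, smul_eq_mul, mul_comm]
      rfl
    have hKη : 2 * (K * η * a) ^ 2 * v ≤ 2⁻¹ * a ^ 2 := by
      have e : K * η = (2 * (v + 1))⁻¹ := by
        rw [hη]
        field_simp
      have h1 : 2 * (2 * (v + 1))⁻¹ ^ 2 * v ≤ 2⁻¹ := by
        rw [inv_pow, mul_assoc, inv_mul_eq_div, mul_div_assoc', div_le_iff₀ (by positivity)]
        nlinarith
      rw [e, mul_pow]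
      calc _ = 2 * (2 * (v + 1))⁻¹ ^ 2 * v * a ^ 2 := by ring
        _ ≤ _ := by gcongr
    have hfin : a ^ 2 ≤ 2 * (4 * Real.pi ^ 2 * R ^ 2)⁻¹ * ‖grad (ofTest Ω φ)‖ ^ 2 + 4 * v * S := by
      nlinarith
    refine hfin.trans ?_
    gcongr

end MagneticSchrodinger

namespace MagneticSchrodinger

variable {n : ℕ} {Ω : Opens (EuclideanSpace ℝ (Fin n))}

/-! ### Correcting approximate solutions -/

theorem continuous_conjH1 : Continuous (conjH1 : H1 Ω → H1 Ω) := by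
  let f : H1 Ω →+ H1 Ω := AddMonoidHom.mk' conjH1 conjH1_add
  exact (AddMonoidHomClass.isometry_of_norm f norm_conjH1).continuous

variable {A : EuclideanSpace ℝ (Fin n) → EuclideanSpace ℂ (Fin n)}
  {q : EuclideanSpace ℝ (Fin n) → ℂ}

/-- An approximate solution in a given subspace `Y` of `H¹(Ω)` can be corrected to a solution by a
small element of `H¹₀(Ω)` and a small element of a fixed finite-dimensional subspace of `Y`. -/
theorem exists_solution_correction
    (hbdd : Bornology.IsBounded (Ω : Set (EuclideanSpace ℝ (Fin n))))
    (hA : MemLp A ⊤ (vol Ω)) (hq : MemLp q ⊤ (vol Ω)) (Y : Submodule ℂ (H1 Ω)) :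
    ∃ E : Submodule ℂ (H1 Ω), E ≤ Y ∧ FiniteDimensional ℂ E ∧ ∃ C : ℝ, 0 ≤ C ∧
      ∀ u ∈ Y, ∀ m : ℝ, 0 ≤ m →
        (∀ φ : 𝓓(Ω, ℂ), ‖magneticForm Ω A q u (ofTest Ω φ)‖ ≤ m * ‖ofTest Ω φ‖) →
        ∃ w ∈ H10 Ω, ∃ e ∈ E, IsSolution Ω A q (u - (w + e)) ∧ ‖w‖ ≤ C * m ∧ ‖e‖ ≤ C * m := by
  obtain ⟨K, hK, hgard⟩ := exists_garding hA hq
  obtain ⟨B, hB⟩ := exists_magneticForm_clm hA hq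
  -- On the common kernel of the functionals this `δ` makes the negative Gårding term at most `¼
  -- ‖∇w‖²`. There also `‖fn w‖ ≤ ‖grad w‖`, so coercivity holds with constant `¼ · ½ = 8⁻¹`.
  set δ : ℝ := (4 * (K + 1))⁻¹ with hδdef
  have hδ : 0 < δ := by positivity
  have hKδ : K * δ ≤ 4⁻¹ := by
    rw [hδdef, ← div_eq_mul_inv, div_le_iff₀ (by positivity)]
    linarith
  have hδ1 : δ ≤ 1 := by
    rw [hδdef]
    exact inv_le_one_of_one_le₀ (by linarith)
  obtain ⟨s, M, hpoin⟩ := exists_finset_functionals hbdd hδ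
  have hco : ∀ w : H10 Ω, (∀ L ∈ s, L ((H10 Ω).subtypeL w) = 0) →
      8⁻¹ * ‖w‖ ^ 2 ≤ (B (w : H1 Ω) (conjH1 (w : H1 Ω))).re := by
    intro w hw
    have h1 := hgard w
    have h2 := hpoin w w.2
    rw [Finset.sum_eq_zero fun L hL => by rw [show L (w : H1 Ω) = 0 from hw L hL]; simp,
      mul_zero, add_zero] at h2
    have h3 := norm_sq_eq (w : H1 Ω)
    have h4 : ‖w‖ = ‖(w : H1 Ω)‖ := rfl
    rw [hB, h4, h3]
    have h5 := sq_nonneg ‖grad (w : H1 Ω)‖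
    have h6 := mul_le_mul_of_nonneg_left h2 hK
    nlinarith
  obtain ⟨E, hEY, hE, C, hC0, hC⟩ := exists_finiteDimensional_solve_form (H := H10 Ω) (X := H1 Ω) B
    (H10 Ω).subtypeL conjH1 conjH1_add conjH1_smul norm_conjH1 s (by norm_num) hco Y
  refine ⟨E, hEY, hE, C, hC0, fun u hu m hm hb => ?_⟩
  -- The bound passes from test functions to `H¹₀(Ω)` by density; conjugation preserves test
  -- functions and the norm.
  have hb' : ∀ φ : H10 Ω, ‖B u (conjH1 ((H10 Ω).subtypeL φ))‖ ≤ m * ‖φ‖ := fun φ =>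
    H10_induction (P := fun φ => ‖B u (conjH1 φ)‖ ≤ m * ‖φ‖)
      (isClosed_le ((B u).continuous.comp continuous_conjH1).norm (continuous_norm.const_mul m))
      (fun ψ => by
        rw [conjH1_ofTest, hB]
        refine (hb _).trans_eq ?_
        rw [← conjH1_ofTest, norm_conjH1]) φ.2
  obtain ⟨w, e, he, h1, h2, h3⟩ := hC u hu m hm hb'
  refine ⟨w, w.2, e, he, fun φ => ?_, h2, h3⟩
  -- The variational equation is tested against conjugates, so `conjTest φ` produces the equation at
  -- `φ`.
  have h := h1 ⟨ofTest Ω (conjTest φ), ofTest_mem_H10 _⟩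
  simp only [Submodule.subtypeL_apply, conjH1_ofTest, conjTest_conjTest] at h
  rw [← hB, map_sub, _root_.sub_apply, h, sub_self]

end MagneticSchrodinger

namespace MagneticSchrodinger

variable {n : ℕ} {Ω : Opens (EuclideanSpace ℝ (Fin n))}

/-! ### Functions that are smooth up to the boundary -/

theorem continuousOn_partialDeriv {O : Set (EuclideanSpace ℝ (Fin n))} (hO : IsOpen O)
    {f : EuclideanSpace ℝ (Fin n) → ℂ} (hf : ContDiffOn ℝ 1 f O) (j : Fin n) :
    ContinuousOn (partialDeriv j f) O :=
  (hf.continuousOn_fderiv_of_isOpen hO le_rfl).clm_apply continuousOn_const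

theorem integrable_mul_of_hasCompactSupport {O : Set (EuclideanSpace ℝ (Fin n))}
    {f ψ : EuclideanSpace ℝ (Fin n) → ℂ} (hf : ContinuousOn f O) (hψ : Continuous ψ)
    (hc : HasCompactSupport ψ) (hs : tsupport ψ ⊆ O) : Integrable fun x => f x * ψ x := by
  have h : IntegrableOn (fun x => f x * ψ x) (tsupport ψ) :=
    ((hf.mono hs).mul hψ.continuousOn).integrableOn_compact hc
  refine (integrableOn_iff_integrable_of_support_subset fun x hx => ?_).1 h
  exact subset_tsupport _ fun h0 => hx (by simp [h0])

/-- Integration by parts against a compactly supported function. -/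
theorem integral_mul_partialDeriv {O : Set (EuclideanSpace ℝ (Fin n))} (hO : IsOpen O)
    {f ψ : EuclideanSpace ℝ (Fin n) → ℂ} (hf : ContDiffOn ℝ 1 f O) (hψ : ContDiff ℝ 1 ψ)
    (hc : HasCompactSupport ψ) (hs : tsupport ψ ⊆ O) (j : Fin n) :
    ∫ x, f x * partialDeriv j ψ x = - ∫ x, partialDeriv j f x * ψ x := by
  have hcd : Continuous (partialDeriv j ψ) :=
    (hψ.continuous_fderiv (by simp)).clm_apply continuous_const
  refine integral_mul_fderiv_eq_neg_fderiv_mul_of_integrable ?_ ?_ ?_ ?_ ?_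
  · exact integrable_mul_of_hasCompactSupport (continuousOn_partialDeriv hO hf j) hψ.continuous hc hs
  · refine integrable_mul_of_hasCompactSupport hf.continuousOn hcd (hc.fderiv_apply ℝ _) ?_
    exact (tsupport_fderiv_apply_subset ℝ _).trans hs
  · exact integrable_mul_of_hasCompactSupport hf.continuousOn hψ.continuous hc hs
  · exact fun x hx => (hf.contDiffAt (hO.mem_nhds (hs hx))).differentiableAt (by simp)
  · exact fun x _ => hψ.differentiable (by simp) x

theorem setIntegral_mul_partialDeriv {O : Set (EuclideanSpace ℝ (Fin n))} (hO : IsOpen O)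
    {f : EuclideanSpace ℝ (Fin n) → ℂ} (hf : ContDiffOn ℝ 1 f O)
    (hs : (Ω : Set (EuclideanSpace ℝ (Fin n))) ⊆ O) (φ : 𝓓(Ω, ℂ)) (j : Fin n) :
    ∫ x in Ω, f x * partialDeriv j φ x = - ∫ x in Ω, partialDeriv j f x * φ x := by
  rw [← integral_test_eq φ fun x hx => by rw [partialDeriv_eq_zero_of_notMem _ hx, mul_zero],
    ← integral_test_eq φ fun x hx => by rw [image_eq_zero_of_notMem_tsupport hx, mul_zero]]
  exact integral_mul_partialDeriv hO hf (φ.contDiff.of_le (by simp)) φ.hasCompactSupport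
    (φ.tsupport_subset.trans hs) j

theorem memLp_of_continuousOn_closure {F : Type*} [NormedAddCommGroup F] [SecondCountableTopology F]
    (hbdd : Bornology.IsBounded (Ω : Set (EuclideanSpace ℝ (Fin n))))
    {f : EuclideanSpace ℝ (Fin n) → F}
    (hf : ContinuousOn f (closure (Ω : Set (EuclideanSpace ℝ (Fin n))))) (p : ℝ≥0∞) :
    MemLp f p (vol Ω) := by
  have : IsFiniteMeasure (vol Ω) := ⟨by simpa using hbdd.measure_lt_top⟩
  obtain ⟨C, hC⟩ := hbdd.isCompact_closure.exists_bound_of_continuousOn hf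
  refine MemLp.of_bound ((hf.mono subset_closure).aestronglyMeasurable Ω.isOpen.measurableSet) C ?_
  filter_upwards [ae_restrict_mem Ω.isOpen.measurableSet] with x hx
  exact hC x (subset_closure hx)

/-- A function that is `C¹` in a neighbourhood of the closure of a bounded `Ω` is in `H¹(Ω)`. -/
theorem exists_H1_of_contDiffOn (hbdd : Bornology.IsBounded (Ω : Set (EuclideanSpace ℝ (Fin n))))
    {O : Set (EuclideanSpace ℝ (Fin n))} (hO : IsOpen O)
    (hs : closure (Ω : Set (EuclideanSpace ℝ (Fin n))) ⊆ O)
    {f : EuclideanSpace ℝ (Fin n) → ℂ} (hf : ContDiffOn ℝ 1 f O) :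
    ∃ u : H1 Ω, fn u =ᵐ[vol Ω] f ∧ grad u =ᵐ[vol Ω] gradient f := by
  have h1 : MemLp f 2 (vol Ω) := memLp_of_continuousOn_closure hbdd (hf.continuousOn.mono hs) 2
  have h2 : MemLp (gradient f) 2 (vol Ω) := MemLp.of_eval_piLp fun j =>
    memLp_of_continuousOn_closure hbdd ((continuousOn_partialDeriv hO hf j).mono hs) 2
  refine ⟨⟨WithLp.toLp 2 (h1.toLp f, h2.toLp (gradient f)), fun φ j => ?_⟩, h1.coeFn_toLp,
    h2.coeFn_toLp⟩
  have e1 : ∫ x in Ω, (h1.toLp f) x * partialDeriv j φ x = ∫ x in Ω, f x * partialDeriv j φ x := by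
    refine integral_congr_ae ?_
    filter_upwards [h1.coeFn_toLp] with x hx
    rw [hx]
  have e2 : ∫ x in Ω, (h2.toLp (gradient f)) x j * φ x = ∫ x in Ω, partialDeriv j f x * φ x := by
    refine integral_congr_ae ?_
    filter_upwards [h2.coeFn_toLp] with x hx
    rw [hx]
    rfl
  exact e1.trans ((setIntegral_mul_partialDeriv hO hf (subset_closure.trans hs) φ j).trans
    (congrArg Neg.neg e2.symm))

/-- A classical harmonic function is a weak one. -/
theorem gradForm_ofTest_eq_zero {O : Set (EuclideanSpace ℝ (Fin n))} (hO : IsOpen O)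
    (hs : (Ω : Set (EuclideanSpace ℝ (Fin n))) ⊆ O)
    {f : EuclideanSpace ℝ (Fin n) → ℂ} (hf : ∀ j, ContDiffOn ℝ 1 (partialDeriv j f) O)
    (hlap : ∀ x ∈ O, ∑ j, partialDeriv j (partialDeriv j f) x = 0)
    {u : H1 Ω} (hu : grad u =ᵐ[vol Ω] gradient f) (φ : 𝓓(Ω, ℂ)) :
    gradForm u (ofTest Ω φ) = 0 := by
  have e : gradForm u (ofTest Ω φ) = ∫ x in Ω, ∑ j, partialDeriv j f x * partialDeriv j φ x := by
    refine integral_congr_ae ?_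
    filter_upwards [hu, grad_ofTest φ] with x h1 h2
    rw [h1, h2]
    rfl
  have hi1 : ∀ j, Integrable (fun x => partialDeriv j f x * partialDeriv j φ x) (vol Ω) := fun j =>
    (integrable_mul_of_hasCompactSupport (hf j).continuousOn (continuous_partialDeriv φ j)
      (hasCompactSupport_partialDeriv φ j)
      (((tsupport_fderiv_apply_subset ℝ _).trans φ.tsupport_subset).trans hs)).restrict
  have hi2 : ∀ j, Integrable (fun x => partialDeriv j (partialDeriv j f) x * φ x) (vol Ω) :=
    fun j => (integrable_mul_of_hasCompactSupport (continuousOn_partialDeriv hO (hf j) j)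
      φ.continuous φ.hasCompactSupport (φ.tsupport_subset.trans hs)).restrict
  rw [e, integral_finsetSum _ fun j _ => hi1 j]
  simp only [fun j => setIntegral_mul_partialDeriv hO (hf j) hs φ j]
  rw [Finset.sum_neg_distrib, ← integral_finsetSum _ fun j _ => hi2 j, neg_eq_zero]
  refine setIntegral_eq_zero_of_forall_eq_zero fun x hx => ?_
  rw [← Finset.sum_mul, hlap x (hs hx), zero_mul]

/-! ### Functions with a power singularity -/

/-- The complex-valued function `P(x) |x - y|^{2m}`. -/
noncomputable def sing (P : EuclideanSpace ℝ (Fin n) → ℝ) (y : EuclideanSpace ℝ (Fin n)) (m : ℝ)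
    (x : EuclideanSpace ℝ (Fin n)) : ℂ :=
  ((P x * (‖x - y‖ ^ 2) ^ m : ℝ) : ℂ)

variable {P : EuclideanSpace ℝ (Fin n) → ℝ} {y : EuclideanSpace ℝ (Fin n)} {m : ℝ}

theorem norm_sub_sq_ne_zero {x y : EuclideanSpace ℝ (Fin n)} (hx : x ≠ y) : ‖x - y‖ ^ 2 ≠ 0 :=
  pow_ne_zero 2 (norm_ne_zero_iff.2 (sub_ne_zero.2 hx))

theorem contDiffOn_sing (hP : ContDiff ℝ 1 P) : ContDiffOn ℝ 1 (sing P y m) {y}ᶜ := by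
  intro x hx
  have h1 : ContDiffAt ℝ 1 (fun x : EuclideanSpace ℝ (Fin n) => ‖x - y‖ ^ 2) x :=
    (contDiff_id.sub contDiff_const).norm_sq ℝ |>.contDiffAt
  have h2 := hP.contDiffAt.mul (h1.rpow_const_of_ne (p := m) (norm_sub_sq_ne_zero hx))
  exact (Complex.ofRealCLM.contDiff.contDiffAt.comp x h2).contDiffWithinAt

theorem fderiv_sing (hP : Differentiable ℝ P) {x : EuclideanSpace ℝ (Fin n)} (hx : x ≠ y)
    (v : EuclideanSpace ℝ (Fin n)) :
    fderiv ℝ (sing P y m) x v = ((fderiv ℝ P x v * (‖x - y‖ ^ 2) ^ m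
      + 2 * m * P x * inner ℝ (x - y) v * (‖x - y‖ ^ 2) ^ (m - 1) : ℝ) : ℂ) := by
  have h1 : HasFDerivAt (fun x : EuclideanSpace ℝ (Fin n) => ‖x - y‖ ^ 2)
      (2 • (innerSL ℝ (x - y)).comp (ContinuousLinearMap.id ℝ _)) x :=
    ((hasFDerivAt_id x).sub_const y).norm_sq
  have h2 := h1.rpow_const (p := m) (Or.inl (norm_sub_sq_ne_zero hx))
  have h3 := (hP x).hasFDerivAt.mul h2
  have h4 : HasFDerivAt (sing P y m) _ x :=
    Complex.ofRealCLM.hasFDerivAt.comp x h3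
  rw [h4.fderiv]
  simp [inner_sub_left]
  ring

theorem partialDeriv_sing (hP : Differentiable ℝ P) {x : EuclideanSpace ℝ (Fin n)} (hx : x ≠ y)
    (j : Fin n) :
    partialDeriv j (sing P y m) x
      = sing (fun x => fderiv ℝ P x (EuclideanSpace.single j 1)) y m x
        + sing (fun x => 2 * m * P x * (x - y) j) y (m - 1) x := by
  rw [partialDeriv, fderiv_sing hP hx, sing, sing, ← Complex.ofReal_add]
  congr 2
  simp [EuclideanSpace.inner_single_right]

theorem partialDeriv_congr {O : Set (EuclideanSpace ℝ (Fin n))} (hO : IsOpen O)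
    {f g : EuclideanSpace ℝ (Fin n) → ℂ} (h : Set.EqOn f g O) (j : Fin n) :
    Set.EqOn (partialDeriv j f) (partialDeriv j g) O := by
  intro x hx
  rw [partialDeriv, partialDeriv, (h.eventuallyEq_of_mem (hO.mem_nhds hx)).fderiv_eq]

theorem partialDeriv_add {f g : EuclideanSpace ℝ (Fin n) → ℂ} {x : EuclideanSpace ℝ (Fin n)}
    (hf : DifferentiableAt ℝ f x) (hg : DifferentiableAt ℝ g x) (j : Fin n) :
    partialDeriv j (fun x => f x + g x) x = partialDeriv j f x + partialDeriv j g x := by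
  rw [partialDeriv, fderiv_fun_add hf hg]
  rfl

/-- The affine function `α + ⟨x - y, β⟩`. -/
noncomputable def affineFn (α : ℝ) (β y x : EuclideanSpace ℝ (Fin n)) : ℝ := α + inner ℝ (x - y) β

theorem contDiff_affineFn (α : ℝ) (β y : EuclideanSpace ℝ (Fin n)) :
    ContDiff ℝ 1 (affineFn α β y) :=
  contDiff_const.add ((contDiff_id.sub contDiff_const).inner ℝ contDiff_const)

theorem fderiv_affineFn (α : ℝ) (β y x v : EuclideanSpace ℝ (Fin n)) :
    fderiv ℝ (affineFn α β y) x v = inner ℝ v β := by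
  have h : HasFDerivAt (affineFn α β y) (innerSL ℝ β) x := by
    have := ((innerSL ℝ β).hasFDerivAt.comp x ((hasFDerivAt_id x).sub_const y)).const_add α
    refine this.congr_of_eventuallyEq (Filter.Eventually.of_forall fun z => ?_)
    simp [affineFn, real_inner_comm]
  rw [h.fderiv, innerSL_apply_apply, real_inner_comm]

theorem sub_apply_eq_affineFn (y x : EuclideanSpace ℝ (Fin n)) (j : Fin n) :
    (x - y) j = affineFn 0 (EuclideanSpace.single j 1) y x := by
  simp [affineFn, EuclideanSpace.inner_single_right]

theorem contDiff_sub_apply (y : EuclideanSpace ℝ (Fin n)) (j : Fin n) :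
    ContDiff ℝ 1 fun x : EuclideanSpace ℝ (Fin n) => (x - y) j := by
  simp only [sub_apply_eq_affineFn]
  exact contDiff_affineFn _ _ _

theorem partialDeriv_sing_affineFn (α : ℝ) (β : EuclideanSpace ℝ (Fin n))
    {x : EuclideanSpace ℝ (Fin n)} (hx : x ≠ y) (j : Fin n) :
    partialDeriv j (sing (affineFn α β y) y m) x
      = sing (fun _ => β j) y m x
        + sing (fun x => 2 * m * affineFn α β y x * (x - y) j) y (m - 1) x := by
  rw [partialDeriv_sing ((contDiff_affineFn α β y).differentiable (by simp)) hx]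
  simp only [fderiv_affineFn, EuclideanSpace.inner_single_left, map_one, one_mul]

theorem contDiff_affineFn_mul (α : ℝ) (β y : EuclideanSpace ℝ (Fin n)) (c : ℝ) (j : Fin n) :
    ContDiff ℝ 1 fun x : EuclideanSpace ℝ (Fin n) => c * affineFn α β y x * (x - y) j :=
  (contDiff_const.mul (contDiff_affineFn α β y)).mul (contDiff_sub_apply y j)

theorem contDiffOn_partialDeriv_sing_affineFn (α : ℝ) (β : EuclideanSpace ℝ (Fin n)) (j : Fin n) :
    ContDiffOn ℝ 1 (partialDeriv j (sing (affineFn α β y) y m)) {y}ᶜ :=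
  ((contDiffOn_sing contDiff_const).add (contDiffOn_sing (contDiff_affineFn_mul α β y _ j))).congr
    fun _ hx => partialDeriv_sing_affineFn α β hx j

theorem sum_mul_sub_apply (β x y : EuclideanSpace ℝ (Fin n)) :
    ∑ j, β j * (x - y) j = inner ℝ (x - y) β := by
  rw [PiLp.inner_apply]
  exact Finset.sum_congr rfl fun j _ => by simp

theorem sum_sub_apply_sq (x y : EuclideanSpace ℝ (Fin n)) :
    ∑ j, (x - y) j ^ 2 = ‖x - y‖ ^ 2 := by
  rw [EuclideanSpace.norm_sq_eq]
  simp

theorem sq_mul_rpow_sub_one {x y : EuclideanSpace ℝ (Fin n)} (hx : x ≠ y) (m : ℝ) :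
    ‖x - y‖ ^ 2 * (‖x - y‖ ^ 2) ^ (m - 1) = (‖x - y‖ ^ 2) ^ m := by
  rw [Real.rpow_sub_one (norm_sub_sq_ne_zero hx), mul_div_cancel₀ _ (norm_sub_sq_ne_zero hx)]

/-- For affine `P = α + ⟨x - y, β⟩` the Laplacian of `P |x - y|^{2m}` is `2m |x - y|^{2m-2} (2⟨x -
y, β⟩ + (n + 2(m - 1)) P)`, and `hm` makes the bracket vanish. One computation thus serves both
singular functions. -/
theorem laplacian_sing_affineFn (α : ℝ) (β : EuclideanSpace ℝ (Fin n))
    {x : EuclideanSpace ℝ (Fin n)} (hx : x ≠ y)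
    (hm : 2 * inner ℝ (x - y) β + (n + 2 * (m - 1)) * affineFn α β y x = 0) :
    ∑ j, partialDeriv j (partialDeriv j (sing (affineFn α β y) y m)) x = 0 := by
  have hO : IsOpen ({y}ᶜ : Set (EuclideanSpace ℝ (Fin n))) := isOpen_compl_singleton
  have hnh : ({y}ᶜ : Set (EuclideanSpace ℝ (Fin n))) ∈ nhds x := hO.mem_nhds hx
  have hterm : ∀ j, partialDeriv j (partialDeriv j (sing (affineFn α β y) y m)) x
      = ((2 * m * β j * (x - y) j * (‖x - y‖ ^ 2) ^ (m - 1)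
        + 2 * m * (β j * (x - y) j + affineFn α β y x) * (‖x - y‖ ^ 2) ^ (m - 1)
        + 4 * m * (m - 1) * affineFn α β y x * (x - y) j ^ 2 * (‖x - y‖ ^ 2) ^ (m - 1 - 1) : ℝ)
          : ℂ) := by
    intro j
    have hA := contDiff_affineFn α β y
    have hP := contDiff_affineFn_mul α β y (2 * m) j
    rw [partialDeriv_congr hO (fun z hz => partialDeriv_sing_affineFn α β hz j) j hx,
      partialDeriv_add (((contDiffOn_sing contDiff_const).contDiffAt hnh).differentiableAt (by simp))
        (((contDiffOn_sing hP).contDiffAt hnh).differentiableAt (by simp)),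
      partialDeriv_sing (differentiable_const _) hx,
      partialDeriv_sing (hP.differentiable (by simp)) hx]
    have hd : fderiv ℝ (fun x => 2 * m * affineFn α β y x * (x - y) j) x
        (EuclideanSpace.single j 1) = 2 * m * (β j * (x - y) j + affineFn α β y x) := by
      have h1 : DifferentiableAt ℝ (fun x => 2 * m * affineFn α β y x) x :=
        (contDiff_const.mul hA).differentiable (by simp) x
      have h2 : DifferentiableAt ℝ (fun x : EuclideanSpace ℝ (Fin n) => (x - y) j) x :=
        (contDiff_sub_apply y j).differentiable (by simp) x
      rw [fderiv_fun_mul h1 h2, fderiv_const_mul (hA.differentiable (by simp) x)]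
      have h3 : fderiv ℝ (fun x : EuclideanSpace ℝ (Fin n) => (x - y) j) x
          (EuclideanSpace.single j 1) = 1 := by
        simp only [sub_apply_eq_affineFn]
        rw [show (fun x => affineFn 0 (EuclideanSpace.single j 1) y x)
          = affineFn 0 (EuclideanSpace.single j 1) y from rfl, fderiv_affineFn]
        simp
      simp only [_root_.add_apply, _root_.smul_apply, smul_eq_mul, h3, fderiv_affineFn,
        EuclideanSpace.inner_single_left, map_one, one_mul]
      ring
    simp only [sing, hd]
    rw [← Complex.ofReal_add, ← Complex.ofReal_add, ← Complex.ofReal_add]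
    congr 1
    simp
    ring
  simp only [hterm]
  rw [← Complex.ofReal_sum, Complex.ofReal_eq_zero, Finset.sum_add_distrib, Finset.sum_add_distrib]
  have s1 : ∑ j, 2 * m * β j * (x - y) j * (‖x - y‖ ^ 2) ^ (m - 1)
      = 2 * m * inner ℝ (x - y) β * (‖x - y‖ ^ 2) ^ (m - 1) := by
    rw [← sum_mul_sub_apply, Finset.mul_sum, Finset.sum_mul]
    exact Finset.sum_congr rfl fun j _ => by ring
  have s2 : ∑ j, 2 * m * (β j * (x - y) j + affineFn α β y x) * (‖x - y‖ ^ 2) ^ (m - 1)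
      = 2 * m * (inner ℝ (x - y) β + n * affineFn α β y x) * (‖x - y‖ ^ 2) ^ (m - 1) := by
    rw [← Finset.sum_mul, ← Finset.mul_sum, Finset.sum_add_distrib, sum_mul_sub_apply]
    simp
  have s3 : ∑ j, 4 * m * (m - 1) * affineFn α β y x * (x - y) j ^ 2
      * (‖x - y‖ ^ 2) ^ (m - 1 - 1)
      = 4 * m * (m - 1) * affineFn α β y x * (‖x - y‖ ^ 2) ^ (m - 1) := by
    rw [← sq_mul_rpow_sub_one hx (m - 1), ← sum_sub_apply_sq x y, ← Finset.sum_mul,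
      ← Finset.mul_sum]
    ring
  rw [s1, s2, s3]
  linear_combination (2 * m * (‖x - y‖ ^ 2) ^ (m - 1)) * hm

/-- The gradient of `(α + ⟨x - y, β⟩) |x - y|^{2m}`. -/
noncomputable def singGrad (α : ℝ) (β y : EuclideanSpace ℝ (Fin n)) (m : ℝ)
    (x : EuclideanSpace ℝ (Fin n)) : EuclideanSpace ℝ (Fin n) :=
  (‖x - y‖ ^ 2) ^ m • β + (2 * m * affineFn α β y x * (‖x - y‖ ^ 2) ^ (m - 1)) • (x - y)

theorem gradient_sing_affineFn (α : ℝ) (β : EuclideanSpace ℝ (Fin n))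
    {x : EuclideanSpace ℝ (Fin n)} (hx : x ≠ y) (j : Fin n) :
    gradient (sing (affineFn α β y) y m) x j = (singGrad α β y m x j : ℂ) := by
  change partialDeriv j (sing (affineFn α β y) y m) x = _
  rw [partialDeriv_sing_affineFn α β hx, sing, sing, ← Complex.ofReal_add]
  congr 1
  simp only [singGrad, PiLp.add_apply, PiLp.smul_apply, smul_eq_mul]
  ring

theorem norm_gradient_sing_affineFn (α : ℝ) (β : EuclideanSpace ℝ (Fin n))
    {x : EuclideanSpace ℝ (Fin n)} (hx : x ≠ y) :
    ‖gradient (sing (affineFn α β y) y m) x‖ = ‖singGrad α β y m x‖ := by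
  rw [EuclideanSpace.norm_eq, EuclideanSpace.norm_eq]
  simp [gradient_sing_affineFn α β hx]

end MagneticSchrodinger

namespace MagneticSchrodinger

variable {n : ℕ} {Ω : Opens (EuclideanSpace ℝ (Fin n))} {y : EuclideanSpace ℝ (Fin n)}

/-! ### Hardy's inequality -/

/-- The Hardy weight is, up to the factor `n - 2`, the divergence of the field `(x - y) |x - y|⁻²`;
a single integration by parts against `|φ|²` then yields Hardy's inequality. -/
theorem divergence_hardy_field {x : EuclideanSpace ℝ (Fin n)} (hx : x ≠ y) :
    ∑ j, partialDeriv j (sing (affineFn 0 (EuclideanSpace.single j 1) y) y (-1)) x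
      = (((n - 2) * (‖x - y‖ ^ 2)⁻¹ : ℝ) : ℂ) := by
  have h0 := norm_sub_sq_ne_zero hx
  have e : ∀ j, partialDeriv j (sing (affineFn 0 (EuclideanSpace.single j 1) y) y (-1)) x
      = (((‖x - y‖ ^ 2)⁻¹ - 2 * (x - y) j ^ 2 * (‖x - y‖ ^ 2) ^ (-1 - 1 : ℝ) : ℝ) : ℂ) := by
    intro j
    rw [partialDeriv_sing_affineFn _ _ hx, sing, sing, ← Complex.ofReal_add,
      ← sub_apply_eq_affineFn, Real.rpow_neg_one]
    congr 1
    simp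
    ring
  simp only [e]
  rw [← Complex.ofReal_sum]
  congr 1
  rw [Finset.sum_sub_distrib, ← Finset.sum_mul, ← Finset.mul_sum, sum_sub_apply_sq, mul_assoc,
    sq_mul_rpow_sub_one hx, Real.rpow_neg_one]
  simp
  ring

/-- Hardy's inequality for test functions. -/
theorem hardy_test (hn : 3 ≤ n) (hy : y ∉ (Ω : Set (EuclideanSpace ℝ (Fin n)))) (φ : 𝓓(Ω, ℂ)) :
    ∫ x in Ω, (‖x - y‖⁻¹ * ‖φ x‖) ^ 2 ≤ 4 * ‖grad (ofTest Ω φ)‖ ^ 2 := by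
  have hO : IsOpen ({y}ᶜ : Set (EuclideanSpace ℝ (Fin n))) := isOpen_compl_singleton
  have hΩO : (Ω : Set (EuclideanSpace ℝ (Fin n))) ⊆ {y}ᶜ := fun x hx h => hy (h ▸ hx)
  -- This is `|φ|²`, written as a product so that smoothness and the product rule are immediate.
  let ψ : EuclideanSpace ℝ (Fin n) → ℂ := fun x => φ x * conjTest φ x
  have hφd : Differentiable ℝ φ := φ.contDiff.differentiable (by simp)
  have hψ : ContDiff ℝ 1 ψ :=
    (φ.contDiff.of_le (by simp)).mul ((conjTest φ).contDiff.of_le (by simp))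
  have hψc : HasCompactSupport ψ := φ.hasCompactSupport.mul_right
  have hψt : tsupport ψ ⊆ tsupport φ := closure_mono fun x hx h0 => hx (by simp [ψ, h0])
  have hψs : tsupport ψ ⊆ {y}ᶜ := (hψt.trans φ.tsupport_subset).trans hΩO
  let f : Fin n → EuclideanSpace ℝ (Fin n) → ℂ :=
    fun j => sing (affineFn 0 (EuclideanSpace.single j 1) y) y (-1)
  have hf : ∀ j, ContDiffOn ℝ 1 (f j) {y}ᶜ := fun j => contDiffOn_sing (contDiff_affineFn _ _ _)
  have hψd : ∀ j, Continuous (partialDeriv j ψ) := fun j =>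
    (hψ.continuous_fderiv (by simp)).clm_apply continuous_const
  have hi1 : ∀ j, Integrable fun x => f j x * partialDeriv j ψ x := fun j =>
    integrable_mul_of_hasCompactSupport (hf j).continuousOn (hψd j) (hψc.fderiv_apply ℝ _)
      ((tsupport_fderiv_apply_subset ℝ _).trans hψs)
  have hi2 : ∀ j, Integrable fun x => partialDeriv j (f j) x * ψ x := fun j =>
    integrable_mul_of_hasCompactSupport (continuousOn_partialDeriv hO (hf j) j) hψ.continuous hψc hψs
  have key : ∫ x, ∑ j, f j x * partialDeriv j ψ x = - ∫ x, ∑ j, partialDeriv j (f j) x * ψ x := by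
    rw [integral_finsetSum _ fun j _ => hi1 j, integral_finsetSum _ fun j _ => hi2 j,
      ← Finset.sum_neg_distrib]
    exact Finset.sum_congr rfl fun j _ => integral_mul_partialDeriv hO (hf j) hψ hψc hψs j
  have hψval : ∀ x, ψ x = ((‖φ x‖ ^ 2 : ℝ) : ℂ) := fun x => by
    simp only [ψ, conjTest_apply]
    rw [Complex.mul_conj, Complex.normSq_eq_norm_sq]
  have hR : ∫ x, ∑ j, partialDeriv j (f j) x * ψ x
      = (((n - 2) * ∫ x in Ω, (‖x - y‖⁻¹ * ‖φ x‖) ^ 2 : ℝ) : ℂ) := by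
    rw [← integral_const_mul, ← integral_complex_ofReal, integral_test_eq φ]
    · refine setIntegral_congr_fun Ω.isOpen.measurableSet fun x hx => ?_
      simp only [← Finset.sum_mul, f]
      rw [divergence_hardy_field (hΩO hx), hψval, ← Complex.ofReal_mul]
      congr 1
      rw [mul_pow, inv_pow]
      ring
    · intro x hx
      simp [hψval, image_eq_zero_of_notMem_tsupport hx]
  have hpd : ∀ j x, partialDeriv j ψ x
      = φ x * starRingEnd ℂ (partialDeriv j φ x) + partialDeriv j φ x * starRingEnd ℂ (φ x) := by
    intro j x
    have h := ((hφd x).hasFDerivAt.mul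
      (((conjTest φ).contDiff.differentiable (by simp) x).hasFDerivAt)).fderiv
    have e : partialDeriv j ψ x = φ x * partialDeriv j (conjTest φ) x
        + conjTest φ x * partialDeriv j φ x := by
      change fderiv ℝ (⇑φ * ⇑(conjTest φ)) x _ = _
      rw [h]
      rfl
    rw [e, partialDeriv_conjTest, conjTest_apply]
    ring
  have hpt : ∀ x ∈ (Ω : Set (EuclideanSpace ℝ (Fin n))), ‖∑ j, f j x * partialDeriv j ψ x‖
      ≤ 2 * (‖‖x - y‖⁻¹ * ‖φ x‖‖ * ‖gradient φ x‖) := by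
    intro x hx
    have hx' : x ≠ y := hΩO hx
    have hxn : 0 < ‖x - y‖ := norm_pos_iff.2 (sub_ne_zero.2 hx')
    -- The field has length `|x - y|⁻¹`, so the integrand is at most `2 |x - y|⁻¹ |φ| |∇φ|`.
    -- Cauchy–Schwarz then reproduces the left-hand side of the inequality under a square root.
    let F : EuclideanSpace ℂ (Fin n) := WithLp.toLp 2 fun j => f j x
    have hF : ‖F‖ = ‖x - y‖⁻¹ := by
      have h1 : ‖F‖ ^ 2 = ‖x - y‖⁻¹ ^ 2 := by
        rw [EuclideanSpace.norm_sq_eq]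
        have : ∀ j, ‖F j‖ ^ 2 = (x - y) j ^ 2 * ((‖x - y‖ ^ 2)⁻¹) ^ 2 := fun j => by
          change ‖f j x‖ ^ 2 = _
          simp only [f, sing, ← sub_apply_eq_affineFn, Real.rpow_neg_one, Complex.norm_real,
            Real.norm_eq_abs, sq_abs, mul_pow]
        simp only [this]
        rw [← Finset.sum_mul, sum_sub_apply_sq]
        field_simp
      exact (sq_eq_sq₀ (norm_nonneg _) (by positivity)).1 h1
    have hsum : ∑ j, f j x * partialDeriv j ψ x
        = φ x * dot F (conjVec (gradient φ x)) + starRingEnd ℂ (φ x) * dot F (gradient φ x) := by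
      simp only [dot, Finset.mul_sum, ← Finset.sum_add_distrib]
      refine Finset.sum_congr rfl fun j _ => ?_
      rw [hpd, conjVec_apply]
      change f j x * _ = φ x * (f j x * starRingEnd ℂ (partialDeriv j φ x))
        + starRingEnd ℂ (φ x) * (f j x * partialDeriv j φ x)
      ring
    rw [hsum]
    refine (norm_add_le _ _).trans ?_
    rw [norm_mul, norm_mul, Complex.norm_conj]
    have h1 := norm_dot_le F (conjVec (gradient φ x))
    have h2 := norm_dot_le F (gradient φ x)
    rw [norm_conjVec, hF] at h1
    rw [hF] at h2
    rw [Real.norm_of_nonneg (by positivity : 0 ≤ ‖x - y‖⁻¹ * ‖φ x‖)]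
    have h3 := mul_le_mul_of_nonneg_left h1 (norm_nonneg (φ x))
    have h4 := mul_le_mul_of_nonneg_left h2 (norm_nonneg (φ x))
    linarith
  set S := ∫ x in Ω, (‖x - y‖⁻¹ * ‖φ x‖) ^ 2 with hS
  have hS0 : 0 ≤ S := integral_nonneg fun _ => by positivity
  have hmem : MemLp (fun x => ‖x - y‖⁻¹ * ‖φ x‖) 2 (vol Ω) := by
    have hcont : Continuous fun x => ‖x - y‖⁻¹ * ‖φ x‖ := by
      rw [continuous_iff_continuousAt]
      intro x
      by_cases hx : x ∈ tsupport φ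
      · have hx' : x ≠ y := hΩO (φ.tsupport_subset hx)
        have : ‖x - y‖ ≠ 0 := norm_ne_zero_iff.2 (sub_ne_zero.2 hx')
        exact ((continuous_id.sub continuous_const).norm.continuousAt.inv₀ this).mul
          φ.continuous.norm.continuousAt
      · have hz : (fun x => ‖x - y‖⁻¹ * ‖φ x‖) =ᶠ[nhds x] fun _ => 0 := by
          filter_upwards [notMem_tsupport_iff_eventuallyEq.1 hx] with z hz
          simp [hz]
        exact continuousAt_const.congr hz.symm
    exact (hcont.memLp_of_hasCompactSupport φ.hasCompactSupport.norm.mul_left).restrict _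
  have hG : ∫ x in Ω, ‖gradient φ x‖ ^ 2 = ‖grad (ofTest Ω φ)‖ ^ 2 := by
    rw [← integral_sq_grad]
    refine integral_congr_ae ?_
    filter_upwards [grad_ofTest φ] with x hx
    rw [hx]
  have hcs := integral_norm_mul_norm_le hmem (memLp_gradient φ) (Real.sqrt_nonneg S)
    (norm_nonneg (grad (ofTest Ω φ))) (by
      rw [Real.sq_sqrt hS0]
      simp only [Real.norm_eq_abs, sq_abs]
      exact le_rfl) hG.le
  have hmain : (n - 2) * S ≤ 2 * (Real.sqrt S * ‖grad (ofTest Ω φ)‖) := by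
    have h1 : ‖∫ x, ∑ j, f j x * partialDeriv j ψ x‖ = (n - 2) * S := by
      rw [key, hR, norm_neg, Complex.norm_real, Real.norm_of_nonneg]
      have : (3 : ℝ) ≤ n := by exact_mod_cast hn
      exact mul_nonneg (by linarith) hS0
    rw [← h1, integral_test_eq φ]
    · refine (norm_integral_le_of_norm_le
        ((hmem.norm.integrable_mul (memLp_gradient φ).norm).const_mul 2) ?_).trans ?_
      · filter_upwards [ae_restrict_mem Ω.isOpen.measurableSet] with x hx
        exact hpt x hx
      · rw [integral_const_mul]
        exact mul_le_mul_of_nonneg_left hcs (by norm_num)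
    · intro x hx
      have : ∀ j, partialDeriv j ψ x = 0 := fun j =>
        partialDeriv_eq_zero_of_notMem j fun h => hx (hψt h)
      simp [this]
  have h3 : (3 : ℝ) ≤ n := by exact_mod_cast hn
  have hs := Real.sqrt_nonneg S
  have hss := Real.sq_sqrt hS0
  -- Only `n - 2 ≥ 1` is used; the sharp constant `4 / (n - 2)²` is not needed.
  have h5 : S ≤ 2 * (Real.sqrt S * ‖grad (ofTest Ω φ)‖) := by nlinarith
  nlinarith [sq_nonneg (Real.sqrt S - 2 * ‖grad (ofTest Ω φ)‖)]

/-- Multiplication by a bounded function, as an operator on `L²`. -/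
theorem exists_mul_clm {α : Type*} [MeasurableSpace α] {μ : Measure α} {k : α → ℂ}
    (hk : MemLp k ⊤ μ) : ∃ M : Lp ℂ 2 μ →L[ℂ] Lp ℂ 2 μ, ∀ f, M f =ᵐ[μ] fun x => k x * f x := by
  obtain ⟨K, hK, hb⟩ := exists_ae_bound hk
  have hle : ∀ f : Lp ℂ 2 μ, ∀ᵐ x ∂μ, ‖k x * f x‖ ≤ K * ‖f x‖ := fun f => by
    filter_upwards [hb] with x hx
    rw [norm_mul]
    exact mul_le_mul_of_nonneg_right hx (norm_nonneg _)
  have hm : ∀ f : Lp ℂ 2 μ, MemLp (fun x => k x * f x) 2 μ := fun f =>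
    (Lp.memLp f).of_le_mul (hk.1.mul (Lp.memLp f).1) (hle f)
  refine ⟨LinearMap.mkContinuous
    { toFun := fun f => (hm f).toLp _
      map_add' := fun f g => by
        rw [← MemLp.toLp_add]
        refine MemLp.toLp_congr _ _ ?_
        filter_upwards [Lp.coeFn_add f g] with x hx
        rw [hx, Pi.add_apply, mul_add]
        rfl
      map_smul' := fun c f => by
        rw [RingHom.id_apply, ← MemLp.toLp_const_smul]
        refine MemLp.toLp_congr _ _ ?_
        filter_upwards [Lp.coeFn_smul c f] with x hx
        rw [hx, Pi.smul_apply, smul_eq_mul, mul_left_comm]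
        rfl } K fun f => ?_, fun f => (hm f).coeFn_toLp⟩
  refine Lp.norm_le_mul_norm_of_ae_le_mul ?_
  filter_upwards [(hm f).coeFn_toLp, hle f] with x hx hx'
  change ‖((hm f).toLp _) x‖ ≤ _
  rw [hx]
  exact hx'

/-- The weights `|x - y|⁻¹` are bounded if `y` has a positive distance to `Ω`. -/
theorem memLp_top_inv_norm_sub {d : ℝ} (hd : 0 < d)
    (hy : ∀ x ∈ (Ω : Set (EuclideanSpace ℝ (Fin n))), d ≤ ‖x - y‖) :
    MemLp (fun x => ((‖x - y‖⁻¹ : ℝ) : ℂ)) ⊤ (vol Ω) := by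
  have hm : Measurable fun x : EuclideanSpace ℝ (Fin n) => ((‖x - y‖⁻¹ : ℝ) : ℂ) := by fun_prop
  refine memLp_top_of_bound hm.aestronglyMeasurable d⁻¹ ?_
  filter_upwards [ae_restrict_mem Ω.isOpen.measurableSet] with x hx
  rw [Complex.norm_real, Real.norm_of_nonneg (by positivity)]
  gcongr
  exact hy x hx

theorem memLp_inv_norm_sub_mul {d : ℝ} (hd : 0 < d)
    (hy : ∀ x ∈ (Ω : Set (EuclideanSpace ℝ (Fin n))), d ≤ ‖x - y‖) (u : H1 Ω) :
    MemLp (fun x => ‖x - y‖⁻¹ * ‖fn u x‖) 2 (vol Ω) := by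
  have hm : Measurable fun x : EuclideanSpace ℝ (Fin n) => ‖x - y‖⁻¹ := by fun_prop
  refine (memLp_fn u).of_le_mul (c := d⁻¹) (hm.aestronglyMeasurable.mul (memLp_fn u).1.norm) ?_
  filter_upwards [ae_restrict_mem Ω.isOpen.measurableSet] with x hx
  rw [norm_mul, norm_norm, Real.norm_of_nonneg (by positivity)]
  gcongr
  exact hy x hx

/-- Hardy's inequality on `H¹₀(Ω)`. -/
theorem hardy_H10 (hn : 3 ≤ n) {d : ℝ} (hd : 0 < d)
    (hy : ∀ x ∈ (Ω : Set (EuclideanSpace ℝ (Fin n))), d ≤ ‖x - y‖) {u : H1 Ω} (hu : u ∈ H10 Ω) :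
    ∫ x in Ω, (‖x - y‖⁻¹ * ‖fn u x‖) ^ 2 ≤ 4 * ‖grad u‖ ^ 2 := by
  have hyΩ : y ∉ (Ω : Set (EuclideanSpace ℝ (Fin n))) := fun h => by
    have := hy y h
    simp at this
    linarith
  -- Because the pole has positive distance from `Ω`, the weighted norm is continuous on `H¹(Ω)` and
  -- the inequality survives the closure. The constant `4` does not involve `d`.
  obtain ⟨M, hM⟩ := exists_mul_clm (memLp_top_inv_norm_sub hd hy)
  have e : ∀ u : H1 Ω, ∫ x in Ω, (‖x - y‖⁻¹ * ‖fn u x‖) ^ 2 = ‖M (fnL Ω u)‖ ^ 2 := fun u => by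
    rw [sq_norm_Lp_two]
    refine integral_congr_ae ?_
    filter_upwards [hM (fnL Ω u)] with x hx
    rw [hx, norm_mul, Complex.norm_real, Real.norm_of_nonneg (by positivity)]
    rfl
  rw [e]
  refine H10_induction (P := fun u => ‖M (fnL Ω u)‖ ^ 2 ≤ 4 * ‖grad u‖ ^ 2) ?_ (fun φ => ?_) hu
  · have h1 : Continuous fun u : H1 Ω => ‖M (fnL Ω u)‖ :=
      (M.continuous.comp (fnL Ω).continuous).norm
    have h2 : Continuous fun u : H1 Ω => ‖grad u‖ := (gradL Ω).continuous.norm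
    exact isClosed_le (h1.pow 2) ((h2.pow 2).const_mul 4)
  · rw [← e]
    refine le_trans (le_of_eq ?_) (hardy_test hn hyΩ φ)
    refine integral_congr_ae ?_
    filter_upwards [fn_ofTest φ] with x hx
    rw [hx]

end MagneticSchrodinger

namespace MagneticSchrodinger

variable {n : ℕ} {Ω : Opens (EuclideanSpace ℝ (Fin n))} {y : EuclideanSpace ℝ (Fin n)}

/-! ### Solutions with a prescribed singular part -/

theorem memLp_norm_sub_mul {D : ℝ}
    (hy : ∀ x ∈ (Ω : Set (EuclideanSpace ℝ (Fin n))), ‖x - y‖ ≤ D) (u : H1 Ω) :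
    MemLp (fun x => ‖x - y‖ * ‖grad u x‖) 2 (vol Ω) := by
  have hm : Measurable fun x : EuclideanSpace ℝ (Fin n) => ‖x - y‖ := by fun_prop
  refine (memLp_grad u).of_le_mul (c := D) (hm.aestronglyMeasurable.mul (memLp_grad u).1.norm) ?_
  filter_upwards [ae_restrict_mem Ω.isOpen.measurableSet] with x hx
  rw [norm_mul, norm_norm, norm_norm]
  exact mul_le_mul_of_nonneg_right (hy x hx) (norm_nonneg _)

/-- The lower order terms are controlled by weighted norms. -/
theorem integral_lowerMajorant_le_weighted {d D : ℝ} (hd : 0 < d)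
    (hyd : ∀ x ∈ (Ω : Set (EuclideanSpace ℝ (Fin n))), d ≤ ‖x - y‖)
    (hyD : ∀ x ∈ (Ω : Set (EuclideanSpace ℝ (Fin n))), ‖x - y‖ ≤ D)
    {u g : H1 Ω} {a b : ℝ} (ha : 0 ≤ a) (hb : 0 ≤ b)
    (hu : ‖fn u‖ ≤ a) (hu' : ∫ x in Ω, (‖x - y‖ * ‖grad u x‖) ^ 2 ≤ a ^ 2)
    (hg : ‖g‖ ≤ b) (hg' : ∫ x in Ω, (‖x - y‖⁻¹ * ‖fn g x‖) ^ 2 ≤ b ^ 2) :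
    ∫ x in Ω, lowerMajorant u g x ≤ 3 * a * b := by
  have hus : ∫ x in Ω, ‖fn u x‖ ^ 2 ≤ a ^ 2 := by
    rw [integral_sq_fn]
    gcongr
  have hgf : ∫ x in Ω, ‖fn g x‖ ^ 2 ≤ b ^ 2 := by
    rw [integral_sq_fn]
    have := (norm_fn_le g).trans hg
    gcongr
  have hgg : ∫ x in Ω, ‖grad g x‖ ^ 2 ≤ b ^ 2 := by
    rw [integral_sq_grad]
    have := (norm_grad_le g).trans hg
    gcongr
  have h1 := integral_norm_mul_norm_le (memLp_fn u) (memLp_grad g) ha hb hus hgg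
  have h3 := integral_norm_mul_norm_le (memLp_fn u) (memLp_fn g) ha hb hus hgf
  -- The gradient of `u` is too singular to be measured unweighted. It receives the factor `|x -
  -- y|`, and `g` receives the inverse factor.
  have h2 := integral_norm_mul_norm_le (memLp_norm_sub_mul hyD u) (memLp_inv_norm_sub_mul hd hyd g)
    ha hb (by simpa only [Real.norm_eq_abs, sq_abs] using hu')
    (by simpa only [Real.norm_eq_abs, sq_abs] using hg')
  have e2 : ∫ x in Ω, ‖‖x - y‖ * ‖grad u x‖‖ * ‖‖x - y‖⁻¹ * ‖fn g x‖‖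
      = ∫ x in Ω, ‖fn g x‖ * ‖grad u x‖ := by
    refine setIntegral_congr_fun Ω.isOpen.measurableSet fun x hx => ?_
    have : 0 < ‖x - y‖ := hd.trans_le (hyd x hx)
    simp only [norm_mul, norm_norm, norm_inv]
    field_simp
  rw [e2] at h2
  unfold lowerMajorant
  rw [integral_add, integral_add]
  · linarith
  · exact (memLp_fn u).norm.integrable_mul (memLp_grad g).norm
  · exact (memLp_fn g).norm.integrable_mul (memLp_grad u).norm
  · exact ((memLp_fn u).norm.integrable_mul (memLp_grad g).norm).add
      ((memLp_fn g).norm.integrable_mul (memLp_grad u).norm)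
  · exact (memLp_fn u).norm.integrable_mul (memLp_fn g).norm

/-- The bounded functions in `H¹(Ω)`. -/
def boundedH1 (Ω : Opens (EuclideanSpace ℝ (Fin n))) : Submodule ℂ (H1 Ω) where
  carrier := {u | MemLp (fn u) ⊤ (vol Ω)}
  zero_mem' := by
    refine MemLp.ae_eq (Lp.coeFn_zero ℂ 2 (vol Ω)).symm ?_
    exact MemLp.zero
  add_mem' := fun {u v} hu hv => MemLp.ae_eq (fn_add_ae u v).symm (hu.add hv)
  smul_mem' := fun c u hu => MemLp.ae_eq (fn_smul_ae c u).symm (hu.const_smul c)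

theorem exists_bound_of_linearMap {X W : Type*} [NormedAddCommGroup X] [NormedSpace ℂ X]
    [NormedAddCommGroup W] [NormedSpace ℂ W] {E : Submodule ℂ X} [FiniteDimensional ℂ E]
    (Λ : E →ₗ[ℂ] W) : ∃ K : ℝ, 0 ≤ K ∧ ∀ e : E, ‖Λ e‖ ≤ K * ‖(e : X)‖ :=
  ⟨‖LinearMap.toContinuousLinearMap Λ‖, ContinuousLinearMap.opNorm_nonneg _,
    (LinearMap.toContinuousLinearMap Λ).le_opNorm⟩

theorem ae_norm_le_norm_Lp_top {α : Type*} [MeasurableSpace α] {μ : Measure α} (f : Lp ℂ ⊤ μ) :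
    ∀ᵐ x ∂μ, ‖f x‖ ≤ ‖f‖ := by
  filter_upwards [ae_le_eLpNormEssSup (f := f) (μ := μ)] with x hx
  rw [← eLpNorm_exponent_top] at hx
  simpa [Lp.norm_def] using ENNReal.toReal_mono (Lp.memLp f).2.ne hx

/-- The inclusion of `E` into `L^∞` is linear on a finite-dimensional space, hence bounded.
Pointwise control is needed because elements of `E` need not vanish on the boundary, so Hardy's
inequality is not available for them. -/
theorem exists_bound_of_finiteDimensional {E : Submodule ℂ (H1 Ω)} [FiniteDimensional ℂ E]
    (hE : E ≤ boundedH1 Ω) :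
    ∃ K : ℝ, 0 ≤ K ∧ ∀ e ∈ E, ∀ᵐ x ∂vol Ω, ‖fn e x‖ ≤ K * ‖e‖ := by
  have hm : ∀ e : E, MemLp (fn (e : H1 Ω)) ⊤ (vol Ω) := fun e => hE e.2
  have hadd : ∀ u v : E, (hm (u + v)).toLp _ = (hm u).toLp _ + (hm v).toLp _ := fun u v => by
    rw [← MemLp.toLp_add (hm u) (hm v)]
    exact MemLp.toLp_congr _ _ (fn_add_ae (u : H1 Ω) v)
  have hsmul : ∀ (c : ℂ) (u : E), (hm (c • u)).toLp _ = c • (hm u).toLp _ := fun c u => by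
    rw [← MemLp.toLp_const_smul c (hm u)]
    exact MemLp.toLp_congr _ _ (fn_smul_ae c (u : H1 Ω))
  let Λ : E →ₗ[ℂ] Lp ℂ ⊤ (vol Ω) :=
    { toFun := fun e => (hm e).toLp _
      map_add' := hadd
      map_smul' := hsmul }
  obtain ⟨K, hK, hΛ⟩ := exists_bound_of_linearMap (X := H1 Ω) (E := E) Λ
  refine ⟨K, hK, fun e he => ?_⟩
  have h1 : ‖Λ ⟨e, he⟩‖ ≤ K * ‖e‖ := hΛ ⟨e, he⟩
  filter_upwards [ae_norm_le_norm_Lp_top (Λ ⟨e, he⟩), (hm ⟨e, he⟩).coeFn_toLp] with x hx hx'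
  rw [← hx']
  exact hx.trans h1

/-- The two parts of the correction are treated separately: Hardy's inequality for `w`, and for `e`
the pointwise bound times the integral of `|x - y|⁻²`. The factor `-1` is the sign with which the
correction enters the solution. -/
theorem integral_inv_norm_sub_mul_add_sq_le (hn : 3 ≤ n)
    (hbdd : Bornology.IsBounded (Ω : Set (EuclideanSpace ℝ (Fin n)))) {d I : ℝ} (hd : 0 < d)
    (hyd : ∀ x ∈ (Ω : Set (EuclideanSpace ℝ (Fin n))), d ≤ ‖x - y‖)
    (hyI : ∫ x in Ω, ‖x - y‖⁻¹ ^ 2 ≤ I) {w e : H1 Ω} (hw : w ∈ H10 Ω) {k : ℝ}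
    (he : ∀ᵐ x ∂vol Ω, ‖fn e x‖ ≤ k) :
    ∫ x in Ω, (‖x - y‖⁻¹ * ‖fn ((-1 : ℂ) • (w + e)) x‖) ^ 2
      ≤ 8 * ‖grad w‖ ^ 2 + 2 * k ^ 2 * I := by
  have hfin : IsFiniteMeasure (vol Ω) := ⟨by simpa using hbdd.measure_lt_top⟩
  have hW := memLp_inv_norm_sub_mul hd hyd w
  have hw2 := hardy_H10 hn hd hyd hw
  have hm : Measurable fun x : EuclideanSpace ℝ (Fin n) => ‖x - y‖⁻¹ := by fun_prop
  have hinv : MemLp (fun x : EuclideanSpace ℝ (Fin n) => ‖x - y‖⁻¹) 2 (vol Ω) := by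
    refine MemLp.of_bound hm.aestronglyMeasurable d⁻¹ ?_
    filter_upwards [ae_restrict_mem Ω.isOpen.measurableSet] with x hx
    rw [Real.norm_of_nonneg (by positivity)]
    gcongr
    exact hyd x hx
  have hWi : Integrable (fun x => (‖x - y‖⁻¹ * ‖fn w x‖) ^ 2) (vol Ω) := hW.integrable_sq
  have hinvi : Integrable (fun x : EuclideanSpace ℝ (Fin n) => ‖x - y‖⁻¹ ^ 2) (vol Ω) :=
    hinv.integrable_sq
  have hle : ∫ x in Ω, (‖x - y‖⁻¹ * ‖fn ((-1 : ℂ) • (w + e)) x‖) ^ 2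
      ≤ ∫ x in Ω, (2 * (‖x - y‖⁻¹ * ‖fn w x‖) ^ 2 + 2 * k ^ 2 * ‖x - y‖⁻¹ ^ 2) := by
    refine integral_mono_of_nonneg (ae_of_all _ fun _ => sq_nonneg _)
      ((hWi.const_mul _).add (hinvi.const_mul _)) ?_
    filter_upwards [fn_smul_ae (-1) (w + e), fn_add_ae w e, he] with x h1 h2 h3
    have h4 : ‖fn ((-1 : ℂ) • (w + e)) x‖ ≤ ‖fn w x‖ + k := by
      rw [h1, Pi.smul_apply, norm_smul, norm_neg, norm_one, one_mul, h2, Pi.add_apply]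
      exact (norm_add_le _ _).trans (by gcongr)
    have h5 : (‖x - y‖⁻¹ * ‖fn ((-1 : ℂ) • (w + e)) x‖) ^ 2
        ≤ (‖x - y‖⁻¹ * (‖fn w x‖ + k)) ^ 2 := by gcongr
    refine h5.trans ?_
    nlinarith [sq_nonneg (‖x - y‖⁻¹ * ‖fn w x‖ - ‖x - y‖⁻¹ * k)]
  refine hle.trans ?_
  rw [integral_add (hWi.const_mul _) (hinvi.const_mul _), integral_const_mul, integral_const_mul]
  have b3 := mul_le_mul_of_nonneg_left hyI (by positivity : 0 ≤ 2 * k ^ 2)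
  linarith

/-- Merges the two contributions into a single square; `I + 1` appears because `I ≤ (I + 1)²`, so no
square root of `I` is needed. -/
theorem weighted_constant_le {K I c g e : ℝ} (hK : 0 ≤ K) (hI : 0 ≤ I)
    (hg : g ≤ c ^ 2) (he : e ≤ (K * c) ^ 2) :
    8 * g + 2 * e * I ≤ ((4 + 2 * K * (I + 1)) * c) ^ 2 := by
  have b3 : e * I ≤ (K * c) ^ 2 * (I + 1) ^ 2 :=
    mul_le_mul he (by nlinarith) hI (by positivity)
  have b6 : 0 ≤ K * (I + 1) * c ^ 2 := by positivity
  have b8 : 0 ≤ (K * c) ^ 2 * (I + 1) ^ 2 := by positivity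
  have b4 : ((4 + 2 * K * (I + 1)) * c) ^ 2
      = 16 * c ^ 2 + 16 * (K * (I + 1) * c ^ 2) + 4 * ((K * c) ^ 2 * (I + 1) ^ 2) := by
    ring
  rw [b4]
  nlinarith [sq_nonneg c]

/-- Weakly harmonic functions can be corrected to solutions of the magnetic Schrödinger equation,
uniformly with respect to the weights `|x - y|`. -/
theorem exists_solution_of_harmonic (hn : 3 ≤ n)
    (hbdd : Bornology.IsBounded (Ω : Set (EuclideanSpace ℝ (Fin n))))
    {A : EuclideanSpace ℝ (Fin n) → EuclideanSpace ℂ (Fin n)} {q : EuclideanSpace ℝ (Fin n) → ℂ}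
    (hA : MemLp A ⊤ (vol Ω)) (hq : MemLp q ⊤ (vol Ω)) (D I : ℝ) (hI : 0 ≤ I) :
    ∃ C : ℝ, 0 ≤ C ∧ ∀ (y : EuclideanSpace ℝ (Fin n)) (d : ℝ), 0 < d →
      (∀ x ∈ (Ω : Set (EuclideanSpace ℝ (Fin n))), d ≤ ‖x - y‖) →
      (∀ x ∈ (Ω : Set (EuclideanSpace ℝ (Fin n))), ‖x - y‖ ≤ D) →
      (∫ x in Ω, ‖x - y‖⁻¹ ^ 2 ≤ I) →
      ∀ u ∈ boundedH1 Ω, (∀ φ, gradForm u (ofTest Ω φ) = 0) → ∀ a : ℝ, 0 ≤ a → ‖fn u‖ ≤ a →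
        (∫ x in Ω, (‖x - y‖ * ‖grad u x‖) ^ 2 ≤ a ^ 2) →
        ∃ z : H1 Ω, IsSolution Ω A q (u + z) ∧ ‖z‖ ≤ C * a ∧
          ∫ x in Ω, (‖x - y‖⁻¹ * ‖fn z x‖) ^ 2 ≤ (C * a) ^ 2 := by
  obtain ⟨E, hEY, hE, C, hC, hsol⟩ := exists_solution_correction hbdd hA hq (boundedH1 Ω)
  obtain ⟨K, hK, hKE⟩ := exists_bound_of_finiteDimensional hEY
  obtain ⟨k, hk, hlow⟩ := exists_norm_lowerForm_le hA (memLp_top_dot_add hA hq)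
  refine ⟨C * (6 * k) * (4 + 2 * K * (I + 1)), by positivity,
    fun y d hd hyd hyD hyI u hu hharm a ha hua hua' => ?_⟩
  -- Harmonicity leaves only the lower order terms in the defect of `u`. By Hardy, `2 ‖φ‖` is an
  -- admissible weighted bound for the test function, so the defect has size `k · 3a · 2 = 6ka`.
  obtain ⟨w, hw, e, he, hs, hwn, hen⟩ := hsol u hu (6 * k * a) (by positivity) fun φ => by
    rw [magneticForm_eq hA hq, hharm φ, zero_add]
    refine (hlow u (ofTest Ω φ)).trans ?_
    have hh := hardy_H10 hn hd hyd (ofTest_mem_H10 φ)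
    have hg := norm_grad_le (ofTest Ω φ)
    have h := integral_lowerMajorant_le_weighted hd hyd hyD (u := u) (g := ofTest Ω φ) ha
      (by positivity : 0 ≤ 2 * ‖ofTest Ω φ‖) hua hua'
      (by linarith [norm_nonneg (ofTest Ω φ)]) (hh.trans (by
        rw [mul_pow]
        norm_num
        exact pow_le_pow_left₀ (norm_nonneg _) hg 2))
    calc k * ∫ x in Ω, lowerMajorant u (ofTest Ω φ) x ≤ k * (3 * a * (2 * ‖ofTest Ω φ‖)) := by
          gcongr
      _ = _ := by ring
  set c := C * (6 * k * a) with hc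
  have hc0 : 0 ≤ c := by positivity
  have hca : C * (6 * k) * (4 + 2 * K * (I + 1)) * a = (4 + 2 * K * (I + 1)) * c := by
    rw [hc]
    ring
  have hneg : u - (w + e) = u + (-1 : ℂ) • (w + e) := by
    rw [neg_one_smul, sub_eq_add_neg]
  refine ⟨(-1 : ℂ) • (w + e), hneg ▸ hs, ?_, ?_⟩
  · rw [hca, norm_smul, norm_neg, norm_one, one_mul]
    refine (norm_add_le _ _).trans ?_
    have : 0 ≤ K * (I + 1) * c := by positivity
    nlinarith
  · refine (integral_inv_norm_sub_mul_add_sq_le hn hbdd hd hyd hyI hw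
      (hKE e he)).trans ?_
    rw [hca]
    refine weighted_constant_le hK hI ?_ ?_
    · exact pow_le_pow_left₀ (norm_nonneg _) ((norm_grad_le w).trans hwn) 2
    · exact pow_le_pow_left₀ (by positivity) (mul_le_mul_of_nonneg_left hen hK) 2

end MagneticSchrodinger

namespace MagneticSchrodinger

variable {n : ℕ} {Ω : Opens (EuclideanSpace ℝ (Fin n))}

/-! ### The integral identity -/

theorem IsSolution.magneticForm_eq_zero
    {A : EuclideanSpace ℝ (Fin n) → EuclideanSpace ℂ (Fin n)} {q : EuclideanSpace ℝ (Fin n) → ℂ}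
    (hA : MemLp A ⊤ (vol Ω)) (hq : MemLp q ⊤ (vol Ω)) {u : H1 Ω} (hu : IsSolution Ω A q u)
    {g : H1 Ω} (hg : g ∈ H10 Ω) : magneticForm Ω A q u g = 0 := by
  obtain ⟨B, hB⟩ := exists_magneticForm_clm hA hq
  rw [← hB]
  refine H10_induction (P := fun g => B u g = 0) ?_ (fun φ => ?_) hg
  · exact isClosed_eq (B u).continuous continuous_const
  · rw [hB]
    exact hu φ

/-- The form vanishes on `H¹₀(Ω)` in its second argument and therefore descends to the trace space.
Consequently every solution contributes to the Cauchy data. -/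
theorem IsSolution.exists_isNormalTrace
    {A : EuclideanSpace ℝ (Fin n) → EuclideanSpace ℂ (Fin n)} {q : EuclideanSpace ℝ (Fin n) → ℂ}
    (hA : MemLp A ⊤ (vol Ω)) (hq : MemLp q ⊤ (vol Ω)) {u : H1 Ω} (hu : IsSolution Ω A q u) :
    ∃ ℓ : DualTraceSpace Ω, IsNormalTrace Ω A q u ℓ := by
  obtain ⟨B, hB⟩ := exists_magneticForm_clm hA hq
  have hker : H10 Ω ≤ LinearMap.ker (B u : H1 Ω →ₗ[ℂ] ℂ) := fun g hg => by
    rw [LinearMap.mem_ker]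
    change B u g = 0
    rw [hB]
    exact hu.magneticForm_eq_zero hA hq hg
  refine ⟨⟨(H10 Ω).liftQ (B u : H1 Ω →ₗ[ℂ] ℂ) hker, ?_⟩, fun g => ?_⟩
  · exact (B u).continuous.quotient_lift _
  · rw [← hB]
    rfl

/-- Equality of the Cauchy data gives an orthogonality relation between solutions of the first
equation and of the transpose of the second. -/
theorem magneticForm_eq_of_cauchyData_eq
    {A₁ A₂ : EuclideanSpace ℝ (Fin n) → EuclideanSpace ℂ (Fin n)}
    {q₁ q₂ : EuclideanSpace ℝ (Fin n) → ℂ}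
    (hA₁ : MemLp A₁ ⊤ (vol Ω)) (hq₁ : MemLp q₁ ⊤ (vol Ω))
    (hA₂ : MemLp A₂ ⊤ (vol Ω)) (hq₂ : MemLp q₂ ⊤ (vol Ω))
    (hC : cauchyData Ω A₁ q₁ = cauchyData Ω A₂ q₂) {u v : H1 Ω}
    (hu : IsSolution Ω A₁ q₁ u) (hv : IsSolution Ω (-A₂) q₂ v) :
    magneticForm Ω A₁ q₁ u v = magneticForm Ω A₂ q₂ u v := by
  obtain ⟨ℓ, hℓ⟩ := hu.exists_isNormalTrace hA₁ hq₁
  have hmem : (trace Ω u, ℓ) ∈ cauchyData Ω A₁ q₁ := ⟨u, hu, rfl, hℓ⟩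
  rw [hC] at hmem
  -- `u'` has the same Cauchy data as `u`, but for the second form. As `v` solves the transposed
  -- equation, it does not see `u - u' ∈ H¹₀(Ω)`, and `u'` may be exchanged for `u`.
  obtain ⟨u', -, htr, hℓ'⟩ := hmem
  have hdiff : u - u' ∈ H10 Ω := by
    rw [← Submodule.Quotient.eq]
    exact htr
  obtain ⟨B, hB⟩ := exists_magneticForm_clm hA₂ hq₂
  have h0 : magneticForm Ω A₂ q₂ (u - u') v = 0 := by
    rw [magneticForm_comm]
    exact hv.magneticForm_eq_zero hA₂.neg hq₂ hdiff
  rw [← hB, map_sub, _root_.sub_apply, hB, hB, sub_eq_zero] at h0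
  rw [h0, ← hℓ v, ← hℓ' v]

/-- The difference of two magnetic forms only has lower order terms. -/
theorem magneticForm_sub_magneticForm
    {A₁ A₂ : EuclideanSpace ℝ (Fin n) → EuclideanSpace ℂ (Fin n)}
    {q₁ q₂ : EuclideanSpace ℝ (Fin n) → ℂ}
    (hA₁ : MemLp A₁ ⊤ (vol Ω)) (hq₁ : MemLp q₁ ⊤ (vol Ω))
    (hA₂ : MemLp A₂ ⊤ (vol Ω)) (hq₂ : MemLp q₂ ⊤ (vol Ω)) (u v : H1 Ω) :
    magneticForm Ω A₁ q₁ u v - magneticForm Ω A₂ q₂ u v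
      = lowerForm (A₁ - A₂) (fun x => (dot (A₁ x) (A₁ x) + q₁ x) - (dot (A₂ x) (A₂ x) + q₂ x))
        u v := by
  rw [magneticForm_eq hA₁ hq₁, magneticForm_eq hA₂ hq₂, add_sub_add_left_eq_sub]
  unfold lowerForm
  rw [← integral_sub (integrable_lowerIntegrand hA₁ (memLp_top_dot_add hA₁ hq₁) u v)
    (integrable_lowerIntegrand hA₂ (memLp_top_dot_add hA₂ hq₂) u v)]
  refine integral_congr_ae (ae_of_all _ fun x => ?_)
  simp only [lowerIntegrand, Pi.sub_apply, dot_sub_left]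
  ring

end MagneticSchrodinger

namespace MagneticSchrodinger

variable {n : ℕ}

/-! ### Geometry near a boundary point -/

open Filter Topology

/-- `ν` is the inner unit normal of `Ω` at `x₀`, in the sense that `Ω` is tangent to a half space. -/
def IsInnerNormal (Ω : Set (EuclideanSpace ℝ (Fin n))) (x₀ ν : EuclideanSpace ℝ (Fin n)) : Prop :=
  ‖ν‖ = 1 ∧ ∀ η : ℝ, 0 < η → ∀ᶠ x in 𝓝 x₀,
    (x ∈ Ω → -(η * ‖x - x₀‖) ≤ inner ℝ (x - x₀) ν) ∧
    (x ∉ Ω → inner ℝ (x - x₀) ν ≤ η * ‖x - x₀‖)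

/-- Near `x₀` the defining function is its linear part up to `o(|x - x₀|)`, and its sign decides
membership in `Ω`. The normal is the normalised gradient of the very function whose differential
kills `τ`, which gives orthogonality. -/
theorem exists_isInnerNormal {Ω : Set (EuclideanSpace ℝ (Fin n))}
    {x₀ τ : EuclideanSpace ℝ (Fin n)} (hx₀ : x₀ ∈ frontier Ω) (hτ : IsTangentVector Ω x₀ τ) :
    ∃ ν, IsInnerNormal Ω x₀ ν ∧ inner ℝ ν τ = 0 := by
  obtain ⟨ρ, ⟨U, hU, hxU, hρ, hΩ, hfr, hne⟩, hρτ⟩ := hτ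
  set N : EuclideanSpace ℝ (Fin n) := (InnerProductSpace.toDual ℝ _).symm (fderiv ℝ ρ x₀) with hN
  have hNin : ∀ v, inner ℝ N v = fderiv ℝ ρ x₀ v := fun v =>
    InnerProductSpace.toDual_symm_apply
  have hN0 : 0 < ‖N‖ := by
    rw [hN, LinearIsometryEquiv.norm_map]
    exact norm_pos_iff.2 hne
  have hρ0 : ρ x₀ = 0 := (hfr x₀ hxU).1 hx₀
  have hd : HasFDerivAt ρ (fderiv ℝ ρ x₀) x₀ :=
    ((hρ.contDiffAt (hU.mem_nhds hxU)).differentiableAt (by simp)).hasFDerivAt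
  refine ⟨‖N‖⁻¹ • N, ⟨by rw [norm_smul, norm_inv, norm_norm, inv_mul_cancel₀ hN0.ne'], ?_⟩, ?_⟩
  · intro η hη
    filter_upwards [hd.isLittleO.bound (c := η * ‖N‖) (by positivity), hU.mem_nhds hxU] with x hx hxU
    rw [hρ0, sub_zero, ← hNin, Real.norm_eq_abs, abs_le] at hx
    have e : inner ℝ (x - x₀) (‖N‖⁻¹ • N) = ‖N‖⁻¹ * inner ℝ N (x - x₀) := by
      rw [inner_smul_right, real_inner_comm]
    rw [e]
    refine ⟨fun h => ?_, fun h => ?_⟩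
    · have := (hΩ x hxU).1 h
      rw [le_inv_mul_iff₀ hN0]
      linarith [hx.2]
    · have : ρ x ≤ 0 := by
        by_contra hlt
        exact h ((hΩ x hxU).2 (not_le.1 hlt))
      rw [inv_mul_le_iff₀ hN0]
      linarith [hx.1]
  · rw [inner_smul_left, hNin, hρτ, mul_zero]

/-- The distance of points of `Ω` to a point slightly outside of `Ω`. -/
theorem IsInnerNormal.exists_le_norm_sub {Ω : Set (EuclideanSpace ℝ (Fin n))}
    {x₀ ν : EuclideanSpace ℝ (Fin n)} (h : IsInnerNormal Ω x₀ ν) :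
    ∃ ε₀ : ℝ, 0 < ε₀ ∧ ∀ ε : ℝ, 0 < ε → ε < ε₀ → ∀ x ∈ Ω,
      (‖x - x₀‖ + ε) / 2 ≤ ‖x - x₀ + ε • ν‖ := by
  -- Write `s = ‖x - x₀‖`. Inside the ball, slope `1/2` bounds the squared distance below by `s² -
  -- εs + ε² = (s + ε)²/4 + ¾ (s - ε)²`. Outside it, `s ≥ r > 3ε` gives `s - ε ≥ (s + ε)/2`; hence
  -- `r / 3`.
  obtain ⟨r, hr, hball⟩ := Metric.eventually_nhds_iff_ball.1 (h.2 (1 / 2) (by norm_num))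
  refine ⟨r / 3, by positivity, fun ε hε hεr x hx => ?_⟩
  have hεν : ‖ε • ν‖ = ε := by rw [norm_smul, h.1, mul_one, Real.norm_of_nonneg hε.le]
  by_cases hxr : x ∈ Metric.ball x₀ r
  · have h1 := (hball x hxr).1 hx
    refine le_of_sq_le_sq ?_ (norm_nonneg _)
    rw [norm_add_sq_real, hεν, inner_smul_right]
    nlinarith [sq_nonneg (‖x - x₀‖ - ε), norm_nonneg (x - x₀)]
  · rw [Metric.mem_ball, dist_eq_norm, not_lt] at hxr
    have h2 : ‖x - x₀‖ - ‖ε • ν‖ ≤ ‖x - x₀ + ε • ν‖ := by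
      have := norm_sub_le (x - x₀ + ε • ν) (ε • ν)
      rw [add_sub_cancel_right] at this
      linarith
    rw [hεν] at h2
    linarith

theorem IsInnerNormal.eventually_mem {Ω : Set (EuclideanSpace ℝ (Fin n))}
    {x₀ ν : EuclideanSpace ℝ (Fin n)} (h : IsInnerNormal Ω x₀ ν) {z : EuclideanSpace ℝ (Fin n)}
    (hz : 0 < inner ℝ z ν) : ∀ᶠ ε : ℝ in 𝓝[>] 0, x₀ + ε • z ∈ Ω := by
  -- The slope is such that the cone error `η ‖z‖` stays below the height `⟨z, ν⟩`; both scale by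
  -- the same `ε`.
  have hη : 0 < inner ℝ z ν / (2 * (‖z‖ + 1)) := by positivity
  have ht : Tendsto (fun ε : ℝ => x₀ + ε • z) (𝓝[>] 0) (𝓝 x₀) := by
    have : Continuous fun ε : ℝ => x₀ + ε • z := by fun_prop
    simpa using (this.tendsto 0).mono_left nhdsWithin_le_nhds
  filter_upwards [ht.eventually (h.2 _ hη), self_mem_nhdsWithin] with ε h1 h2
  have hε : 0 < ε := h2
  by_contra hc
  have h3 := h1.2 hc
  rw [add_sub_cancel_left, inner_smul_left, norm_smul, Real.norm_of_nonneg hε.le] at h3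
  have h4 : inner ℝ z ν / (2 * (‖z‖ + 1)) * ‖z‖ < inner ℝ z ν := by
    rw [div_mul_eq_mul_div, div_lt_iff₀ (by positivity)]
    nlinarith [norm_nonneg z]
  simp only [conj_trivial] at h3
  nlinarith

theorem IsInnerNormal.eventually_notMem {Ω : Set (EuclideanSpace ℝ (Fin n))}
    {x₀ ν : EuclideanSpace ℝ (Fin n)} (h : IsInnerNormal Ω x₀ ν) {z : EuclideanSpace ℝ (Fin n)}
    (hz : inner ℝ z ν < 0) : ∀ᶠ ε : ℝ in 𝓝[>] 0, x₀ + ε • z ∉ Ω := by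
  have hη : 0 < -inner ℝ z ν / (2 * (‖z‖ + 1)) := div_pos (by linarith) (by positivity)
  have ht : Tendsto (fun ε : ℝ => x₀ + ε • z) (𝓝[>] 0) (𝓝 x₀) := by
    have : Continuous fun ε : ℝ => x₀ + ε • z := by fun_prop
    simpa using (this.tendsto 0).mono_left nhdsWithin_le_nhds
  filter_upwards [ht.eventually (h.2 _ hη), self_mem_nhdsWithin] with ε h1 h2
  have hε : 0 < ε := h2
  intro hc
  have h3 := h1.1 hc
  rw [add_sub_cancel_left, inner_smul_left, norm_smul, Real.norm_of_nonneg hε.le] at h3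
  have h4 : -inner ℝ z ν / (2 * (‖z‖ + 1)) * ‖z‖ < -inner ℝ z ν := by
    rw [div_mul_eq_mul_div, div_lt_iff₀ (by positivity)]
    nlinarith [norm_nonneg z]
  simp only [conj_trivial] at h3
  nlinarith

/-! ### Blow-up at a boundary point -/

/-- The size `|ζ|^{2 - 2n}` of the products of the singular functions and their derivatives. -/
noncomputable def baseKernel (ζ : EuclideanSpace ℝ (Fin n)) : ℝ := ‖ζ‖ ^ 2 * ((‖ζ‖ ^ 2) ^ n)⁻¹

theorem baseKernel_nonneg (ζ : EuclideanSpace ℝ (Fin n)) : 0 ≤ baseKernel ζ := by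
  unfold baseKernel
  positivity

theorem measurable_baseKernel : Measurable (baseKernel : EuclideanSpace ℝ (Fin n) → ℝ) := by
  unfold baseKernel
  fun_prop

theorem baseKernel_smul {ε : ℝ} (hε : 0 < ε) (ζ : EuclideanSpace ℝ (Fin n)) :
    baseKernel (ε • ζ) = ε ^ 2 * ((ε ^ 2) ^ n)⁻¹ * baseKernel ζ := by
  unfold baseKernel
  rw [norm_smul, Real.norm_of_nonneg hε.le, mul_pow, mul_pow, mul_inv]
  ring

/-- The integrable majorant of the kernels. -/
noncomputable def majorant (n : ℕ) (z : EuclideanSpace ℝ (Fin n)) : ℝ :=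
  2 ^ (2 * n - 2) * (1 + ‖z‖) ^ (-((2 * n - 2 : ℕ) : ℝ))

theorem integrable_majorant (hn : 3 ≤ n) : Integrable (majorant n) := by
  refine (integrable_one_add_norm ?_).const_mul _
  rw [finrank_euclideanSpace, Fintype.card_fin]
  exact_mod_cast (by omega : n < 2 * n - 2)

/-- Where the distance to the pole is comparable to `‖z‖ + 1`, the singularity is never met and only
the decay of order `2n - 2` remains. This exceeds `n`, so the majorant is integrable. -/
theorem baseKernel_le_majorant (hn : 3 ≤ n) {ν z : EuclideanSpace ℝ (Fin n)}
    (h : (‖z‖ + 1) / 2 ≤ ‖z + ν‖) : baseKernel (z + ν) ≤ majorant n z := by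
  have hz := norm_nonneg z
  have hp : 0 < ‖z + ν‖ := lt_of_lt_of_le (by positivity) h
  have e : baseKernel (z + ν) = (‖z + ν‖ ^ (2 * n - 2))⁻¹ := by
    unfold baseKernel
    have h2 : (‖z + ν‖ ^ 2) ^ n = ‖z + ν‖ ^ 2 * ‖z + ν‖ ^ (2 * n - 2) := by
      rw [← pow_mul, ← pow_add]
      congr 1
      omega
    rw [h2]
    field_simp
  rw [e, majorant, Real.rpow_neg (by positivity), Real.rpow_natCast, ← div_eq_mul_inv,
    inv_eq_one_div, div_le_div_iff₀ (by positivity) (by positivity), one_mul, ← mul_pow]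
  refine pow_le_pow_left₀ (by positivity) ?_ _
  linarith

theorem integral_comp_add_smul {F : Type*} [NormedAddCommGroup F] [NormedSpace ℝ F]
    (f : EuclideanSpace ℝ (Fin n) → F) (x₀ : EuclideanSpace ℝ (Fin n)) {ε : ℝ} (hε : 0 < ε) :
    ∫ x, f x = ε ^ n • ∫ z, f (x₀ + ε • z) := by
  have h1 := Measure.integral_comp_smul (volume : Measure (EuclideanSpace ℝ (Fin n)))
    (fun x => f (x₀ + x)) ε
  rw [finrank_euclideanSpace, Fintype.card_fin, integral_add_left_eq_self f x₀,
    abs_of_pos (by positivity)] at h1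
  rw [h1, smul_smul, mul_inv_cancel₀ (by positivity), one_smul]

/-- The limit of rescaled integrals over `Ω` is an integral over a half space. -/
theorem tendsto_blowup (hn : 3 ≤ n) {Ω : Set (EuclideanSpace ℝ (Fin n))}
    {x₀ ν : EuclideanSpace ℝ (Fin n)} (hν : IsInnerNormal Ω x₀ ν)
    {g : EuclideanSpace ℝ (Fin n) → ℂ} (hgm : Measurable (Ω.indicator g)) {G : ℝ}
    (hG : ∀ x ∈ Ω, ‖g x‖ ≤ G) {g₀ : ℂ} (hg₀ : Tendsto g (𝓝[Ω] x₀) (𝓝 g₀))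
    {k : EuclideanSpace ℝ (Fin n) → ℝ} (hkm : Measurable k) {K : ℝ}
    (hK : ∀ ζ, |k ζ| ≤ K * baseKernel ζ) :
    Tendsto (fun ε : ℝ => ∫ z, Ω.indicator g (x₀ + ε • z) * (k (z + ν) : ℂ)) (𝓝[>] 0)
      (𝓝 (g₀ * ∫ z in {z | 0 < inner ℝ z ν}, (k (z + ν) : ℂ))) := by
  have hmeas : MeasurableSet {z : EuclideanSpace ℝ (Fin n) | 0 < inner ℝ z ν} :=
    (isOpen_lt continuous_const (by fun_prop)).measurableSet
  rw [← integral_const_mul, ← integral_indicator hmeas]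
  obtain ⟨ε₀, hε₀, hlow⟩ := hν.exists_le_norm_sub
  have hkm' : Measurable fun z : EuclideanSpace ℝ (Fin n) => (k (z + ν) : ℂ) :=
    Complex.measurable_ofReal.comp (hkm.comp (measurable_add_const ν))
  -- The majorant is uniform in `ε`: divided by `ε`, the distance estimate reads `(‖z‖ + 1)/2 ≤ ‖z +
  -- ν‖` wherever the indicator is nonzero.
  refine tendsto_integral_filter_of_dominated_convergence (fun z => |G| * (|K| * majorant n z))
    ?_ ?_ (((integrable_majorant hn).const_mul _).const_mul _) ?_
  · refine Eventually.of_forall fun ε => Measurable.aestronglyMeasurable ?_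
    exact (hgm.comp (by fun_prop : Measurable fun z : EuclideanSpace ℝ (Fin n) => x₀ + ε • z)).mul
      hkm'
  · filter_upwards [Ioo_mem_nhdsGT hε₀] with ε hε
    refine ae_of_all _ fun z => ?_
    have hmaj : 0 ≤ majorant n z := by
      unfold majorant
      positivity
    by_cases hz : x₀ + ε • z ∈ Ω
    · rw [Set.indicator_of_mem hz, norm_mul, Complex.norm_real, Real.norm_eq_abs]
      have h1 := hlow ε hε.1 hε.2 _ hz
      rw [add_sub_cancel_left, ← smul_add, norm_smul, norm_smul, Real.norm_of_nonneg hε.1.le] at h1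
      have h2 : (‖z‖ + 1) / 2 ≤ ‖z + ν‖ := by
        have : ε * ((‖z‖ + 1) / 2) ≤ ε * ‖z + ν‖ := by linarith
        exact le_of_mul_le_mul_left this hε.1
      have h3 := baseKernel_le_majorant hn h2
      refine mul_le_mul ((hG _ hz).trans (le_abs_self G)) ?_ (abs_nonneg _) (abs_nonneg _)
      refine (hK _).trans ?_
      exact mul_le_mul (le_abs_self K) h3 (baseKernel_nonneg _) (abs_nonneg _)
    · rw [Set.indicator_of_notMem hz, zero_mul, norm_zero]
      positivity
  -- On the limiting hyperplane the indicator need not converge, but it is a null set. Off it, `x₀ +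
  -- εz` is eventually inside or eventually outside `Ω`.
  · have hnull : ∀ᵐ z : EuclideanSpace ℝ (Fin n), inner ℝ z ν ≠ 0 := by
      have hne : (LinearMap.ker (innerSL ℝ ν : EuclideanSpace ℝ (Fin n) →ₗ[ℝ] ℝ)) ≠ ⊤ := by
        intro htop
        have : ν ∈ LinearMap.ker (innerSL ℝ ν : EuclideanSpace ℝ (Fin n) →ₗ[ℝ] ℝ) :=
          htop ▸ Submodule.mem_top
        rw [LinearMap.mem_ker] at this
        change inner ℝ ν ν = 0 at this
        rw [real_inner_self_eq_norm_sq, hν.1] at this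
        norm_num at this
      have h := Measure.addHaar_submodule (volume : Measure (EuclideanSpace ℝ (Fin n))) _ hne
      refine measure_mono_null (fun z hz => ?_) h
      simp only [Set.mem_compl_iff, Set.mem_ofPred_eq, not_not] at hz
      change inner ℝ ν z = 0
      rw [real_inner_comm]
      exact hz
    filter_upwards [hnull] with z hz
    rcases lt_or_gt_of_ne hz with hneg | hpos
    · rw [Set.indicator_of_notMem (by simpa using hneg.le)]
      refine tendsto_const_nhds.congr' ?_
      filter_upwards [hν.eventually_notMem hneg] with ε hε
      rw [Set.indicator_of_notMem hε, zero_mul]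
    · rw [Set.indicator_of_mem (by simpa using hpos)]
      refine Tendsto.mul_const _ ?_
      have ht : Tendsto (fun ε : ℝ => x₀ + ε • z) (𝓝[>] 0) (𝓝[Ω] x₀) := by
        refine tendsto_nhdsWithin_iff.2 ⟨?_, hν.eventually_mem hpos⟩
        have : Continuous fun ε : ℝ => x₀ + ε • z := by fun_prop
        simpa using (this.tendsto 0).mono_left nhdsWithin_le_nhds
      refine (hg₀.comp ht).congr' ?_
      filter_upwards [hν.eventually_mem hpos] with ε hε
      rw [Set.indicator_of_mem hε]
      rfl

end MagneticSchrodinger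

namespace MagneticSchrodinger

variable {n : ℕ}

/-! ### The limit kernel -/

/-- The kernel `U ∂_a V - V ∂_a U` for `U = |ζ|^{2-n}` and `V = ⟨ζ, τ⟩ |ζ|^{-n}`. -/
noncomputable def kern (τ a ζ : EuclideanSpace ℝ (Fin n)) : ℝ :=
  (inner ℝ a τ * ‖ζ‖ ^ 2 - 2 * inner ℝ ζ τ * inner ℝ ζ a) * ((‖ζ‖ ^ 2) ^ n)⁻¹

theorem measurable_kern (τ a : EuclideanSpace ℝ (Fin n)) : Measurable (kern τ a) := by
  unfold kern
  fun_prop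

theorem kern_smul {ε : ℝ} (hε : 0 < ε) (τ a ζ : EuclideanSpace ℝ (Fin n)) :
    kern τ a (ε • ζ) = ε ^ 2 * ((ε ^ 2) ^ n)⁻¹ * kern τ a ζ := by
  unfold kern
  rw [norm_smul, Real.norm_of_nonneg hε.le, mul_pow, mul_pow, mul_inv, real_inner_smul_left,
    real_inner_smul_left]
  ring

theorem abs_kern_le (τ a ζ : EuclideanSpace ℝ (Fin n)) :
    |kern τ a ζ| ≤ 3 * ‖a‖ * ‖τ‖ * baseKernel ζ := by
  unfold kern baseKernel
  rw [abs_mul, abs_of_nonneg (by positivity : 0 ≤ ((‖ζ‖ ^ 2) ^ n)⁻¹), ← mul_assoc]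
  refine mul_le_mul_of_nonneg_right ?_ (by positivity)
  have h1 := abs_real_inner_le_norm a τ
  have h2 := abs_real_inner_le_norm ζ τ
  have h3 := abs_real_inner_le_norm ζ a
  have h4 : |inner ℝ ζ τ * inner ℝ ζ a| ≤ ‖ζ‖ * ‖τ‖ * (‖ζ‖ * ‖a‖) := by
    rw [abs_mul]
    gcongr
  have h5 : |inner ℝ a τ * ‖ζ‖ ^ 2| ≤ ‖a‖ * ‖τ‖ * ‖ζ‖ ^ 2 := by
    rw [abs_mul, abs_of_nonneg (sq_nonneg ‖ζ‖)]
    gcongr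
  refine (abs_sub _ _).trans ?_
  rw [mul_assoc 2, abs_mul 2, abs_two]
  linarith

/-- The half space with inner normal `ν`. -/
def halfSpace (ν : EuclideanSpace ℝ (Fin n)) : Set (EuclideanSpace ℝ (Fin n)) :=
  {z | 0 < inner ℝ z ν}

theorem isOpen_halfSpace (ν : EuclideanSpace ℝ (Fin n)) : IsOpen (halfSpace ν) :=
  isOpen_lt continuous_const (by fun_prop)

/-! ### Kernel integrals over the half space and their symmetries -/

variable {ν τ : EuclideanSpace ℝ (Fin n)}

theorem le_norm_add_of_mem_halfSpace (hν : ‖ν‖ = 1) {z : EuclideanSpace ℝ (Fin n)}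
    (hz : z ∈ halfSpace ν) : (‖z‖ + 1) / 2 ≤ ‖z + ν‖ := by
  have hz' : 0 < inner ℝ z ν := hz
  refine le_of_sq_le_sq ?_ (norm_nonneg _)
  rw [norm_add_sq_real, hν]
  nlinarith [sq_nonneg (‖z‖ - 1)]

theorem integrableOn_halfSpace (hn : 3 ≤ n) (hν : ‖ν‖ = 1) {k : EuclideanSpace ℝ (Fin n) → ℝ}
    (hkm : Measurable k) {K : ℝ} (hK : ∀ ζ, |k ζ| ≤ K * baseKernel ζ) :
    IntegrableOn (fun z => k (z + ν)) (halfSpace ν) := by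
  refine ((integrable_majorant hn).const_mul |K|).integrableOn.mono'
    (hkm.comp (measurable_add_const ν)).aestronglyMeasurable ?_
  filter_upwards [ae_restrict_mem (isOpen_halfSpace ν).measurableSet] with z hz
  refine (hK _).trans ?_
  exact mul_le_mul (le_abs_self K)
    (baseKernel_le_majorant hn (le_norm_add_of_mem_halfSpace hν hz)) (baseKernel_nonneg _)
    (abs_nonneg _)

/-- Isometries that fix `ν` preserve integrals over the half space. -/
theorem integral_halfSpace_comp (R : EuclideanSpace ℝ (Fin n) ≃ₗᵢ[ℝ] EuclideanSpace ℝ (Fin n))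
    (hR : R ν = ν) (f : EuclideanSpace ℝ (Fin n) → ℝ) :
    ∫ z in halfSpace ν, f (R (z + ν)) = ∫ z in halfSpace ν, f (z + ν) := by
  have hpre : R ⁻¹' halfSpace ν = halfSpace ν := by
    ext z
    change 0 < inner ℝ (R z) ν ↔ 0 < inner ℝ z ν
    conv_lhs => rw [← hR, LinearIsometryEquiv.inner_map_map]
  have h := R.measurePreserving.setIntegral_preimage_emb
    R.toHomeomorph.measurableEmbedding (fun z => f (z + ν)) (halfSpace ν)
  rw [hpre] at h
  rw [← h]
  simp only [map_add, hR]

theorem reflection_eq_self_of_inner_eq_zero {τ a : EuclideanSpace ℝ (Fin n)}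
    (h : inner ℝ τ a = 0) : (ℝ ∙ τ)ᗮ.reflection a = a :=
  Submodule.reflection_mem_subspace_eq_self (Submodule.mem_orthogonal_singleton_iff_inner_right.2 h)

/-- The reflection sending `τ` to `-τ` fixes `ν` and `a`; it preserves the half space and reverses
the sign of the kernel. -/
theorem integral_kern_eq_zero {a : EuclideanSpace ℝ (Fin n)} (hντ : inner ℝ ν τ = 0)
    (ha : inner ℝ a τ = 0) : ∫ z in halfSpace ν, kern τ a (z + ν) = 0 := by
  let R := (ℝ ∙ τ)ᗮ.reflection
  have hRν : R ν = ν := reflection_eq_self_of_inner_eq_zero (by rwa [real_inner_comm])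
  have hRa : R a = a := reflection_eq_self_of_inner_eq_zero (by rwa [real_inner_comm])
  have hRτ : R τ = -τ := Submodule.reflection_orthogonalComplement_singleton_eq_neg τ
  have hodd : ∀ ζ, kern τ a (R ζ) = -kern τ a ζ := by
    intro ζ
    have h1 : inner ℝ (R ζ) τ = -inner ℝ ζ τ := by
      have : inner ℝ (R ζ) (R τ) = inner ℝ ζ τ := LinearIsometryEquiv.inner_map_map _ _ _
      rw [hRτ, inner_neg_right] at this
      linarith
    have h2 : inner ℝ (R ζ) a = inner ℝ ζ a := by
      conv_lhs => rw [← hRa, LinearIsometryEquiv.inner_map_map]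
    unfold kern
    rw [h1, h2, LinearIsometryEquiv.norm_map, ha]
    ring
  have h := integral_halfSpace_comp R hRν (kern τ a)
  simp only [hodd, integral_neg] at h
  linarith

theorem exists_third_unit_vector (hn : 3 ≤ n) (ν τ : EuclideanSpace ℝ (Fin n)) :
    ∃ σ : EuclideanSpace ℝ (Fin n), ‖σ‖ = 1 ∧ inner ℝ σ ν = 0 ∧ inner ℝ σ τ = 0 := by
  classical
  let S : Submodule ℝ (EuclideanSpace ℝ (Fin n)) := Submodule.span ℝ ({ν, τ} : Set _)
  have hfin : Module.finrank ℝ S ≤ 2 := by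
    refine (finrank_span_le_card _).trans ?_
    rw [Set.toFinset_card]
    refine (Fintype.card_le_of_surjective (fun b : Bool => (if b then ⟨ν, by simp⟩ else ⟨τ, by simp⟩ :
      ({ν, τ} : Set (EuclideanSpace ℝ (Fin n))))) ?_).trans (by simp)
    rintro ⟨x, rfl | rfl⟩
    · exact ⟨true, rfl⟩
    · exact ⟨false, rfl⟩
  have hne : Sᗮ ≠ ⊥ := by
    intro hbot
    have h1 := S.finrank_add_finrank_orthogonal
    rw [hbot, finrank_bot, finrank_euclideanSpace, Fintype.card_fin] at h1
    omega
  obtain ⟨σ, hσ, hσ0⟩ := Submodule.exists_mem_ne_zero_of_ne_bot hne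
  have hσ' := (Submodule.mem_orthogonal' _ _).1 hσ
  refine ⟨‖σ‖⁻¹ • σ, ?_, ?_, ?_⟩
  · rw [norm_smul, norm_inv, norm_norm, inv_mul_cancel₀ (norm_ne_zero_iff.2 hσ0)]
  · rw [real_inner_smul_left, hσ' ν (Submodule.subset_span (by simp)), mul_zero]
  · rw [real_inner_smul_left, hσ' τ (Submodule.subset_span (by simp)), mul_zero]

theorem bessel_three {ν τ σ : EuclideanSpace ℝ (Fin n)} (hν : ‖ν‖ = 1) (hτ : ‖τ‖ = 1)
    (hσ : ‖σ‖ = 1) (hντ : inner ℝ ν τ = 0) (hσν : inner ℝ σ ν = 0) (hστ : inner ℝ σ τ = 0)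
    (ζ : EuclideanSpace ℝ (Fin n)) :
    inner ℝ ζ τ ^ 2 + inner ℝ ζ σ ^ 2 + inner ℝ ζ ν ^ 2 ≤ ‖ζ‖ ^ 2 := by
  have ho : Orthonormal ℝ ![τ, σ, ν] := by
    have hτν : inner ℝ τ ν = 0 := by rwa [real_inner_comm]
    have hνσ : inner ℝ ν σ = 0 := by rwa [real_inner_comm]
    have hτσ : inner ℝ τ σ = 0 := by rwa [real_inner_comm]
    rw [orthonormal_iff_ite]
    intro i j
    fin_cases i <;> fin_cases j <;>
      simp [hν, hτ, hσ, hντ, hσν, hστ, hτν, hνσ, hτσ]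
  have h := ho.sum_inner_products_le (x := ζ) (s := Finset.univ)
  simp only [Fin.sum_univ_three, Matrix.cons_val_zero, Matrix.cons_val_one, Matrix.cons_val,
    Real.norm_eq_abs, sq_abs] at h
  rw [real_inner_comm ζ τ, real_inner_comm ζ σ, real_inner_comm ζ ν] at h
  exact h

/-- The numerator `‖ζ‖² - 2⟨ζ, τ⟩²` has no definite sign. The reflection exchanging `τ` with a unit
vector `σ` orthogonal to `ν` and `τ` allows one copy of `⟨ζ, τ⟩²` to be replaced by `⟨ζ, σ⟩²` under
the integral. Bessel's inequality bounds the new numerator below by `⟨ζ, ν⟩² > 1`. The existence of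
`σ` uses `n ≥ 3`. -/
theorem integral_kern_self_pos (hn : 3 ≤ n) (hν : ‖ν‖ = 1) (hτ : ‖τ‖ = 1)
    (hντ : inner ℝ ν τ = 0) : 0 < ∫ z in halfSpace ν, kern τ τ (z + ν) := by
  obtain ⟨σ, hσ, hσν, hστ⟩ := exists_third_unit_vector hn ν τ
  have hsq : ∀ a : EuclideanSpace ℝ (Fin n), ‖a‖ = 1 →
      IntegrableOn (fun z => inner ℝ (z + ν) a ^ 2 * ((‖z + ν‖ ^ 2) ^ n)⁻¹) (halfSpace ν) := by
    intro a ha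
    refine integrableOn_halfSpace (k := fun ζ => inner ℝ ζ a ^ 2 * ((‖ζ‖ ^ 2) ^ n)⁻¹) (K := 1) hn hν
      (by fun_prop) fun ζ => ?_
    rw [abs_of_nonneg (by positivity), one_mul, baseKernel]
    refine mul_le_mul_of_nonneg_right ?_ (by positivity)
    have := abs_real_inner_le_norm ζ a
    rw [ha, mul_one] at this
    rw [← sq_abs]
    gcongr
  let R := (ℝ ∙ (τ - σ))ᗮ.reflection
  have hRτ : R τ = σ := Submodule.reflection_sub (by rw [hτ, hσ])
  have hRν : R ν = ν := by
    refine reflection_eq_self_of_inner_eq_zero ?_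
    rw [inner_sub_left, real_inner_comm, hντ, hσν, sub_zero]
  have hswap : ∫ z in halfSpace ν, inner ℝ (z + ν) τ ^ 2 * ((‖z + ν‖ ^ 2) ^ n)⁻¹
      = ∫ z in halfSpace ν, inner ℝ (z + ν) σ ^ 2 * ((‖z + ν‖ ^ 2) ^ n)⁻¹ := by
    rw [← integral_halfSpace_comp R hRν fun ζ => inner ℝ ζ σ ^ 2 * ((‖ζ‖ ^ 2) ^ n)⁻¹]
    refine integral_congr_ae (ae_of_all _ fun z => ?_)
    have h1 : inner ℝ (R (z + ν)) σ = inner ℝ (z + ν) τ := by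
      rw [← hRτ, LinearIsometryEquiv.inner_map_map]
    simp only [h1, LinearIsometryEquiv.norm_map]
  have hk := integrableOn_halfSpace hn hν (measurable_kern τ τ) (abs_kern_le τ τ)
  have hd : IntegrableOn (fun z => inner ℝ (z + ν) τ ^ 2 * ((‖z + ν‖ ^ 2) ^ n)⁻¹
      - inner ℝ (z + ν) σ ^ 2 * ((‖z + ν‖ ^ 2) ^ n)⁻¹) (halfSpace ν) := (hsq τ hτ).sub (hsq σ hσ)
  -- The added difference has integral zero by `hswap`, and it makes the integrand positive.
  have e : ∫ z in halfSpace ν, kern τ τ (z + ν)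
      = ∫ z in halfSpace ν, (kern τ τ (z + ν)
        + (inner ℝ (z + ν) τ ^ 2 * ((‖z + ν‖ ^ 2) ^ n)⁻¹
          - inner ℝ (z + ν) σ ^ 2 * ((‖z + ν‖ ^ 2) ^ n)⁻¹)) := by
    rw [integral_add hk hd, integral_sub (hsq τ hτ) (hsq σ hσ), hswap,
      sub_self, add_zero]
  have hpos : ∀ z ∈ halfSpace ν, 0 < kern τ τ (z + ν)
      + (inner ℝ (z + ν) τ ^ 2 * ((‖z + ν‖ ^ 2) ^ n)⁻¹
        - inner ℝ (z + ν) σ ^ 2 * ((‖z + ν‖ ^ 2) ^ n)⁻¹) := by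
    intro z hz
    have hz' : 0 < inner ℝ z ν := hz
    have hb := bessel_three hν hτ hσ hντ hσν hστ (z + ν)
    have hzν : 1 < inner ℝ (z + ν) ν := by
      rw [inner_add_left, real_inner_self_eq_norm_sq, hν]
      linarith
    have hp : 0 < ‖z + ν‖ := lt_of_lt_of_le (by positivity) (le_norm_add_of_mem_halfSpace hν hz)
    have hm : 0 < ((‖z + ν‖ ^ 2) ^ n)⁻¹ := by positivity
    have : kern τ τ (z + ν) + (inner ℝ (z + ν) τ ^ 2 * ((‖z + ν‖ ^ 2) ^ n)⁻¹
        - inner ℝ (z + ν) σ ^ 2 * ((‖z + ν‖ ^ 2) ^ n)⁻¹)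
        = (‖z + ν‖ ^ 2 - inner ℝ (z + ν) τ ^ 2 - inner ℝ (z + ν) σ ^ 2)
          * ((‖z + ν‖ ^ 2) ^ n)⁻¹ := by
      unfold kern
      rw [real_inner_self_eq_norm_sq, hτ]
      ring
    rw [this]
    refine mul_pos ?_ hm
    nlinarith
  have hms := (isOpen_halfSpace ν).measurableSet
  rw [e, setIntegral_pos_iff_support_of_nonneg_ae]
  · have hsub : halfSpace ν ⊆ Function.support (fun z => kern τ τ (z + ν)
        + (inner ℝ (z + ν) τ ^ 2 * ((‖z + ν‖ ^ 2) ^ n)⁻¹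
          - inner ℝ (z + ν) σ ^ 2 * ((‖z + ν‖ ^ 2) ^ n)⁻¹)) ∩ halfSpace ν :=
      fun z hz => ⟨(hpos z hz).ne', hz⟩
    refine lt_of_lt_of_le ((isOpen_halfSpace ν).measure_pos volume ⟨ν, ?_⟩) (measure_mono hsub)
    change 0 < inner ℝ ν ν
    rw [real_inner_self_eq_norm_sq, hν]
    norm_num
  · filter_upwards [ae_restrict_mem hms] with z hz
    exact (hpos z hz).le
  · exact hk.add hd

/-- The integral of the kernel over the half space only sees the component along `τ`. -/
theorem integral_kern_eq (hn : 3 ≤ n) (hν : ‖ν‖ = 1) (hτ : ‖τ‖ = 1) (hντ : inner ℝ ν τ = 0)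
    (a : EuclideanSpace ℝ (Fin n)) :
    ∫ z in halfSpace ν, kern τ a (z + ν)
      = inner ℝ a τ * ∫ z in halfSpace ν, kern τ τ (z + ν) := by
  have hi := fun a => integrableOn_halfSpace hn hν (measurable_kern τ a) (abs_kern_le τ a)
  -- The kernel is linear in `a`, and the part orthogonal to `τ` integrates to zero.
  set b := a - inner ℝ a τ • τ with hb
  have hbτ : inner ℝ b τ = 0 := by
    rw [hb, inner_sub_left, real_inner_smul_left, real_inner_self_eq_norm_sq, hτ]
    ring
  have e : ∀ ζ, kern τ a ζ = kern τ b ζ + inner ℝ a τ * kern τ τ ζ := by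
    intro ζ
    unfold kern
    rw [hbτ, hb, inner_sub_right, real_inner_smul_right, real_inner_self_eq_norm_sq, hτ]
    ring
  simp only [e]
  rw [integral_add (hi b) ((hi τ).const_mul _), integral_const_mul, integral_kern_eq_zero hντ hbτ,
    zero_add]

/-- The function `|x|^{-2}` is locally integrable in dimension at least three. -/
theorem integrable_indicator_inv_norm_sq (hn : 3 ≤ n) (R : ℝ) :
    Integrable fun x : EuclideanSpace ℝ (Fin n) =>
      (Set.Iic R).indicator (fun r : ℝ => r⁻¹ ^ 2) ‖x‖ := by
  have : Nonempty (Fin n) := ⟨⟨0, by omega⟩⟩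
  rw [integrable_fun_norm_addHaar (volume : Measure (EuclideanSpace ℝ (Fin n)))
    (f := (Set.Iic R).indicator (fun r : ℝ => r⁻¹ ^ 2)), finrank_euclideanSpace, Fintype.card_fin]
  -- In polar coordinates the density is `r^{n-1} r^{-2} = r^{n-3}`; for `n ≥ 3` the natural
  -- subtraction is not truncated.
  have hc : IntegrableOn (fun r : ℝ => r ^ (n - 3)) (Set.Ioc 0 R) :=
    ((by fun_prop : Continuous fun r : ℝ => r ^ (n - 3)).integrableOn_Icc (a := 0) (b := R)).mono_set
      Set.Ioc_subset_Icc_self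
  refine (((integrable_indicator_iff measurableSet_Ioc).2 hc).integrableOn
    (s := Set.Ioi 0)).congr_fun (fun r hr => ?_) measurableSet_Ioi
  have hr0 : 0 < r := hr
  by_cases hrR : r ≤ R
  · rw [Set.indicator_of_mem (show r ∈ Set.Ioc 0 R from ⟨hr0, hrR⟩), Set.indicator_of_mem (by exact hrR),
      smul_eq_mul]
    have : r ^ (n - 1) = r ^ (n - 3) * r ^ 2 := by
      rw [← pow_add]
      congr 1
      omega
    rw [this]
    field_simp
  · rw [Set.indicator_of_notMem (fun h => hrR h.2), Set.indicator_of_notMem (by exact hrR),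
      smul_zero]

end MagneticSchrodinger

namespace MagneticSchrodinger

variable {n : ℕ} {Ω : Opens (EuclideanSpace ℝ (Fin n))} {y : EuclideanSpace ℝ (Fin n)}

/-! ### Consequences of equal Cauchy data for harmonic functions -/

theorem lowerMajorant_comm (u g : H1 Ω) (x : EuclideanSpace ℝ (Fin n)) :
    lowerMajorant u g x = lowerMajorant g u x := by
  unfold lowerMajorant
  ring

/-- The zero order term is bounded by a product of unweighted `L²` norms, so it can be counted among
the errors. What is left is the first order form, which isolates `A₁ - A₂`. -/
theorem exists_norm_lowerForm_zero_le {A : EuclideanSpace ℝ (Fin n) → EuclideanSpace ℂ (Fin n)}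
    {Q : EuclideanSpace ℝ (Fin n) → ℂ} (hA : MemLp A ⊤ (vol Ω)) (hQ : MemLp Q ⊤ (vol Ω)) :
    ∃ K : ℝ, 0 ≤ K ∧ ∀ u g : H1 Ω,
      ‖lowerForm A 0 u g‖ ≤ ‖lowerForm A Q u g‖ + K * (‖fn u‖ * ‖fn g‖) := by
  obtain ⟨K, hK, hKQ⟩ := exists_ae_bound hQ
  refine ⟨K, hK, fun u g => ?_⟩
  have hi0 := integrable_lowerIntegrand hA MemLp.zero u g (Q := 0)
  have hi := integrable_lowerIntegrand hA hQ u g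
  have e : lowerForm A Q u g - lowerForm A 0 u g = ∫ x in Ω, Q x * fn u x * fn g x := by
    unfold lowerForm
    rw [← integral_sub hi hi0]
    refine integral_congr_ae (ae_of_all _ fun x => ?_)
    simp only [lowerIntegrand, Pi.zero_apply]
    ring
  have hb : ‖∫ x in Ω, Q x * fn u x * fn g x‖ ≤ K * (‖fn u‖ * ‖fn g‖) := by
    have h1 : ‖∫ x in Ω, Q x * fn u x * fn g x‖ ≤ ∫ x in Ω, K * (‖fn u x‖ * ‖fn g x‖) := by
      refine norm_integral_le_of_norm_le
        (((memLp_fn u).norm.integrable_mul (memLp_fn g).norm).const_mul K) ?_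
      filter_upwards [hKQ] with x hx
      rw [norm_mul, norm_mul, mul_assoc]
      gcongr
    refine h1.trans ?_
    rw [integral_const_mul]
    exact mul_le_mul_of_nonneg_left (integral_norm_mul_norm_le (memLp_fn u) (memLp_fn g)
      (norm_nonneg _) (norm_nonneg _) (integral_sq_fn u).le (integral_sq_fn g).le) hK
  have e' : lowerForm A 0 u g = lowerForm A Q u g - ∫ x in Ω, Q x * fn u x * fn g x := by
    rw [← e]
    ring
  rw [e']
  exact (norm_sub_le _ _).trans (by gcongr)

/-- If the Cauchy data coincide, then the first order form of `A₁ - A₂` is small on harmonic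
functions, measured in weighted norms. -/
theorem exists_norm_lowerForm_harmonic_le (hn : 3 ≤ n)
    (hbdd : Bornology.IsBounded (Ω : Set (EuclideanSpace ℝ (Fin n))))
    {A₁ A₂ : EuclideanSpace ℝ (Fin n) → EuclideanSpace ℂ (Fin n)}
    {q₁ q₂ : EuclideanSpace ℝ (Fin n) → ℂ}
    (hA₁ : MemLp A₁ ⊤ (vol Ω)) (hq₁ : MemLp q₁ ⊤ (vol Ω))
    (hA₂ : MemLp A₂ ⊤ (vol Ω)) (hq₂ : MemLp q₂ ⊤ (vol Ω))
    (hC : cauchyData Ω A₁ q₁ = cauchyData Ω A₂ q₂) (D I : ℝ) (hI : 0 ≤ I) :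
    ∃ K : ℝ, 0 ≤ K ∧ ∀ (y : EuclideanSpace ℝ (Fin n)) (d : ℝ), 0 < d →
      (∀ x ∈ (Ω : Set (EuclideanSpace ℝ (Fin n))), d ≤ ‖x - y‖) →
      (∀ x ∈ (Ω : Set (EuclideanSpace ℝ (Fin n))), ‖x - y‖ ≤ D) →
      (∫ x in Ω, ‖x - y‖⁻¹ ^ 2 ≤ I) →
      ∀ u ∈ boundedH1 Ω, (∀ φ, gradForm u (ofTest Ω φ) = 0) → ∀ a : ℝ, 0 ≤ a → ‖fn u‖ ≤ a →
        (∫ x in Ω, (‖x - y‖ * ‖grad u x‖) ^ 2 ≤ a ^ 2) →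
      ∀ v ∈ boundedH1 Ω, (∀ φ, gradForm v (ofTest Ω φ) = 0) → ∀ b : ℝ, 0 ≤ b → ‖fn v‖ ≤ b →
        (∫ x in Ω, (‖x - y‖ * ‖grad v x‖) ^ 2 ≤ b ^ 2) →
        ‖lowerForm (A₁ - A₂) 0 u v‖ ≤ K * (a * b) := by
  obtain ⟨C₁, hC₁, hsol₁⟩ := exists_solution_of_harmonic hn hbdd hA₁ hq₁ D I hI
  obtain ⟨C₂, hC₂, hsol₂⟩ := exists_solution_of_harmonic hn hbdd hA₂.neg hq₂ D I hI
  have hW : MemLp (A₁ - A₂) ⊤ (vol Ω) := hA₁.sub hA₂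
  have hQ : MemLp (fun x => (dot (A₁ x) (A₁ x) + q₁ x) - (dot (A₂ x) (A₂ x) + q₂ x)) ⊤ (vol Ω) :=
    (memLp_top_dot_add hA₁ hq₁).sub (memLp_top_dot_add hA₂ hq₂)
  obtain ⟨k, hk, hlow⟩ := exists_norm_lowerForm_le hW hQ
  obtain ⟨K₀, hK₀, hzero⟩ := exists_norm_lowerForm_zero_le hW hQ
  refine ⟨k * (3 * C₂ + 3 * C₁ + 3 * C₁ * C₂) + K₀, by positivity,
    fun y d hd hyd hyD hyI u hu hharmu a ha hua hua' v hv hharmv b hb hvb hvb' => ?_⟩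
  obtain ⟨z, hz, hzn, hzw⟩ := hsol₁ y d hd hyd hyD hyI u hu hharmu a ha hua hua'
  obtain ⟨w, hw, hwn, hww⟩ := hsol₂ y d hd hyd hyD hyI v hv hharmv b hb hvb hvb'
  set Q := fun x => (dot (A₁ x) (A₁ x) + q₁ x) - (dot (A₂ x) (A₂ x) + q₂ x) with hQdef
  have h0 : lowerForm (A₁ - A₂) Q (u + z) (v + w) = 0 := by
    rw [← magneticForm_sub_magneticForm hA₁ hq₁ hA₂ hq₂,
      magneticForm_eq_of_cauchyData_eq hA₁ hq₁ hA₂ hq₂ hC hz hw, sub_self]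
  rw [lowerForm_add_left hW hQ, lowerForm_add_right hW hQ, lowerForm_add_right hW hQ] at h0
  -- Up to sign, the main term is a sum of terms containing at least one correction. In the mixed
  -- ones the weight `|x - y|` goes to the gradient of the singular function and its inverse to the
  -- correction; the last needs only `H¹` norms.
  have e : lowerForm (A₁ - A₂) Q u v = -(lowerForm (A₁ - A₂) Q u w + lowerForm (A₁ - A₂) Q z v
      + lowerForm (A₁ - A₂) Q z w) := by
    linear_combination h0
  have b1 : ‖lowerForm (A₁ - A₂) Q u w‖ ≤ k * (3 * a * (C₂ * b)) :=
    (hlow u w).trans (mul_le_mul_of_nonneg_left (integral_lowerMajorant_le_weighted hd hyd hyD ha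
      (by positivity) hua hua' hwn hww) hk)
  have b2 : ‖lowerForm (A₁ - A₂) Q z v‖ ≤ k * (3 * b * (C₁ * a)) := by
    refine (hlow z v).trans (mul_le_mul_of_nonneg_left ?_ hk)
    simp only [lowerMajorant_comm z v]
    exact integral_lowerMajorant_le_weighted hd hyd hyD hb (by positivity) hvb hvb' hzn hzw
  have b3 : ‖lowerForm (A₁ - A₂) Q z w‖ ≤ k * (3 * (C₁ * a) * (C₂ * b)) := by
    refine (hlow z w).trans (mul_le_mul_of_nonneg_left ?_ hk)
    refine (integral_lowerMajorant_le z w).trans ?_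
    gcongr
  have b4 : ‖lowerForm (A₁ - A₂) Q u v‖ ≤ k * (3 * a * (C₂ * b)) + k * (3 * b * (C₁ * a))
      + k * (3 * (C₁ * a) * (C₂ * b)) := by
    rw [e, norm_neg]
    exact (norm_add₃_le).trans (by gcongr)
  have b5 : K₀ * (‖fn u‖ * ‖fn v‖) ≤ K₀ * (a * b) := by gcongr
  refine (hzero u v).trans ((add_le_add b4 b5).trans (le_of_eq ?_))
  ring

/-! ### Singular harmonic functions -/

theorem closure_subset_compl_singleton {d : ℝ} (hd : 0 < d)
    (hyd : ∀ x ∈ (Ω : Set (EuclideanSpace ℝ (Fin n))), d ≤ ‖x - y‖) :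
    closure (Ω : Set (EuclideanSpace ℝ (Fin n))) ⊆ {y}ᶜ := by
  have hcl : closure (Ω : Set (EuclideanSpace ℝ (Fin n))) ⊆ {x | d ≤ ‖x - y‖} :=
    closure_minimal hyd (isClosed_le continuous_const (by fun_prop))
  intro x hx hxy
  have h1 : d ≤ ‖x - y‖ := hcl hx
  rw [Set.mem_singleton_iff.1 hxy, sub_self, norm_zero] at h1
  linarith

/-- Boundedness holds because the pole is off the closure. The supremum blows up as the pole
approaches `Ω`, which is harmless: only membership in `boundedH1` is required, and the estimates use
weighted norms. -/
theorem exists_H1_sing (hbdd : Bornology.IsBounded (Ω : Set (EuclideanSpace ℝ (Fin n)))) {d : ℝ}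
    (hd : 0 < d) (hyd : ∀ x ∈ (Ω : Set (EuclideanSpace ℝ (Fin n))), d ≤ ‖x - y‖) (α : ℝ)
    (β : EuclideanSpace ℝ (Fin n)) (m : ℝ)
    (hm : ∀ x, 2 * inner ℝ (x - y) β + (n + 2 * (m - 1)) * affineFn α β y x = 0) :
    ∃ u ∈ boundedH1 Ω, (∀ φ, gradForm u (ofTest Ω φ) = 0) ∧
      fn u =ᵐ[vol Ω] sing (affineFn α β y) y m ∧
      grad u =ᵐ[vol Ω] gradient (sing (affineFn α β y) y m) := by
  have hO : IsOpen ({y}ᶜ : Set (EuclideanSpace ℝ (Fin n))) := isOpen_compl_singleton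
  have hs := closure_subset_compl_singleton hd hyd
  have hf := contDiffOn_sing (m := m) (contDiff_affineFn α β y) (y := y)
  obtain ⟨u, hu, hgu⟩ := exists_H1_of_contDiffOn hbdd hO hs hf
  refine ⟨u, ?_, ?_, hu, hgu⟩
  · exact MemLp.ae_eq hu.symm (memLp_of_continuousOn_closure hbdd (hf.continuousOn.mono hs) ⊤)
  · exact gradForm_ofTest_eq_zero hO (subset_closure.trans hs)
      (contDiffOn_partialDeriv_sing_affineFn α β) (fun x hx => laplacian_sing_affineFn α β hx (hm x))
      hgu

theorem rpow_neg_half_sq {s : ℝ} (hs : 0 < s) : (s ^ (-(n : ℝ) / 2)) ^ 2 = (s ^ n)⁻¹ := by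
  rw [← Real.rpow_natCast, ← Real.rpow_mul hs.le, ← Real.rpow_natCast s n, ← Real.rpow_neg hs.le]
  congr 1
  push_cast
  ring

theorem rpow_one_sub_half {s : ℝ} (hs : 0 < s) :
    s ^ (1 - (n : ℝ) / 2) = s * s ^ (-(n : ℝ) / 2) := by
  rw [sub_eq_add_neg, Real.rpow_add hs, Real.rpow_one, neg_div]

variable {x τ : EuclideanSpace ℝ (Fin n)}

/-- Here `U² = |x - y|^{4-2n}`, better than the kernel by `|x - y|²`. This gain of `U` over `V` is
what makes the product of their weighted norms lower order. -/
theorem norm_sq_sing_one (hx : x ≠ y) :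
    ‖sing (affineFn 1 0 y) y (1 - (n : ℝ) / 2) x‖ ^ 2 = ‖x - y‖ ^ 2 * baseKernel (x - y) := by
  have hs : 0 < ‖x - y‖ ^ 2 := by
    have := norm_pos_iff.2 (sub_ne_zero.2 hx)
    positivity
  rw [sing, Complex.norm_real, Real.norm_eq_abs, sq_abs, affineFn, inner_zero_right, add_zero,
    one_mul, rpow_one_sub_half hs, mul_pow, rpow_neg_half_sq hs, baseKernel]
  ring

theorem norm_sq_gradient_sing_one (hx : x ≠ y) :
    (‖x - y‖ * ‖gradient (sing (affineFn 1 0 y) y (1 - (n : ℝ) / 2)) x‖) ^ 2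
      = ((n : ℝ) - 2) ^ 2 * (‖x - y‖ ^ 2 * baseKernel (x - y)) := by
  have hs : 0 < ‖x - y‖ ^ 2 := by
    have := norm_pos_iff.2 (sub_ne_zero.2 hx)
    positivity
  have he : (1 - (n : ℝ) / 2 - 1) = -(n : ℝ) / 2 := by ring
  rw [norm_gradient_sing_affineFn 1 0 hx, singGrad, smul_zero, zero_add, norm_smul,
    Real.norm_eq_abs, mul_pow, mul_pow, sq_abs, affineFn, inner_zero_right, add_zero, mul_one, he,
    mul_pow, rpow_neg_half_sq hs, baseKernel]
  ring

theorem norm_sq_sing_inner_le (hτ : ‖τ‖ = 1) (hx : x ≠ y) :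
    ‖sing (affineFn 0 τ y) y (-(n : ℝ) / 2) x‖ ^ 2 ≤ baseKernel (x - y) := by
  have hs : 0 < ‖x - y‖ ^ 2 := by
    have := norm_pos_iff.2 (sub_ne_zero.2 hx)
    positivity
  rw [sing, Complex.norm_real, Real.norm_eq_abs, sq_abs, affineFn, zero_add, mul_pow,
    rpow_neg_half_sq hs, baseKernel]
  refine mul_le_mul_of_nonneg_right ?_ (by positivity)
  have := abs_real_inner_le_norm (x - y) τ
  rw [hτ, mul_one] at this
  rw [← sq_abs]
  gcongr

/-- `∇V` is `|x - y|^{-n} τ` plus a radial part of length at most `n |x - y|^{-n}`, whence the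
factor `n + 1`. -/
theorem norm_sq_gradient_sing_inner_le (hτ : ‖τ‖ = 1) (hx : x ≠ y) :
    (‖x - y‖ * ‖gradient (sing (affineFn 0 τ y) y (-(n : ℝ) / 2)) x‖) ^ 2
      ≤ ((n : ℝ) + 1) ^ 2 * baseKernel (x - y) := by
  have hp := norm_pos_iff.2 (sub_ne_zero.2 hx)
  have hs : 0 < ‖x - y‖ ^ 2 := by positivity
  have hin := abs_real_inner_le_norm (x - y) τ
  rw [hτ, mul_one] at hin
  have h1 := sq_mul_rpow_sub_one hx (-(n : ℝ) / 2)
  have hpos : 0 ≤ (‖x - y‖ ^ 2) ^ (-(n : ℝ) / 2 - 1) := by positivity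
  have hpos' : 0 ≤ (‖x - y‖ ^ 2) ^ (-(n : ℝ) / 2) := by positivity
  have hg : ‖singGrad 0 τ y (-(n : ℝ) / 2) x‖
      ≤ ((n : ℝ) + 1) * (‖x - y‖ ^ 2) ^ (-(n : ℝ) / 2) := by
    unfold singGrad
    refine (norm_add_le _ _).trans ?_
    rw [norm_smul, norm_smul, hτ, mul_one, Real.norm_of_nonneg hpos', affineFn, zero_add,
      Real.norm_eq_abs, abs_mul, abs_mul, abs_of_nonneg hpos]
    have h2 : |2 * (-(n : ℝ) / 2)| = n := by
      rw [mul_div_cancel₀ _ two_ne_zero, abs_neg, Nat.abs_cast]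
    rw [h2]
    have h3 : (n : ℝ) * |inner ℝ (x - y) τ| * (‖x - y‖ ^ 2) ^ (-(n : ℝ) / 2 - 1) * ‖x - y‖
        ≤ n * ‖x - y‖ * (‖x - y‖ ^ 2) ^ (-(n : ℝ) / 2 - 1) * ‖x - y‖ := by gcongr
    have h4 : n * ‖x - y‖ * (‖x - y‖ ^ 2) ^ (-(n : ℝ) / 2 - 1) * ‖x - y‖
        = n * (‖x - y‖ ^ 2) ^ (-(n : ℝ) / 2) := by
      rw [← h1]
      ring
    linarith
  rw [norm_gradient_sing_affineFn 0 τ hx]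
  have h5 : (‖x - y‖ * ‖singGrad 0 τ y (-(n : ℝ) / 2) x‖) ^ 2
      ≤ (‖x - y‖ * (((n : ℝ) + 1) * (‖x - y‖ ^ 2) ^ (-(n : ℝ) / 2))) ^ 2 := by gcongr
  refine h5.trans (le_of_eq ?_)
  rw [mul_pow, mul_pow, rpow_neg_half_sq hs, baseKernel]
  ring

/-- The radial coefficients, `-n` from `U ∇V` and `2 - n` from `V ∇U`, differ by `-2`, the
coefficient appearing in `kern`. -/
theorem sing_mul_gradient_sub (hx : x ≠ y) (τ : EuclideanSpace ℝ (Fin n)) (j : Fin n) :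
    (sing (affineFn 1 0 y) y (1 - (n : ℝ) / 2) x
        • gradient (sing (affineFn 0 τ y) y (-(n : ℝ) / 2)) x
      - sing (affineFn 0 τ y) y (-(n : ℝ) / 2) x
        • gradient (sing (affineFn 1 0 y) y (1 - (n : ℝ) / 2)) x) j
      = (kern τ (EuclideanSpace.single j 1) (x - y) : ℂ) := by
  have hs : 0 < ‖x - y‖ ^ 2 := by
    have := norm_pos_iff.2 (sub_ne_zero.2 hx)
    positivity
  have he : (1 - (n : ℝ) / 2 - 1) = -(n : ℝ) / 2 := by ring
  have h1 := sq_mul_rpow_sub_one hx (-(n : ℝ) / 2)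
  have h2 := rpow_neg_half_sq (n := n) hs
  rw [PiLp.sub_apply, PiLp.smul_apply, PiLp.smul_apply, gradient_sing_affineFn 0 τ hx,
    gradient_sing_affineFn 1 0 hx, smul_eq_mul, smul_eq_mul, sing, sing, ← Complex.ofReal_mul,
    ← Complex.ofReal_mul, ← Complex.ofReal_sub]
  congr 1
  simp only [singGrad, affineFn, he, rpow_one_sub_half hs, inner_zero_right, add_zero, zero_add,
    smul_zero, mul_one, one_mul, PiLp.add_apply, PiLp.smul_apply, smul_eq_mul, kern,
    EuclideanSpace.inner_single_left, EuclideanSpace.inner_single_right, map_one, conj_trivial, ← h2]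
  linear_combination (-(n : ℝ) * (‖x - y‖ ^ 2) ^ (-(n : ℝ) / 2) * inner ℝ (x - y) τ * (x - y) j) * h1

end MagneticSchrodinger

namespace MagneticSchrodinger

variable {n : ℕ} {Ω : Opens (EuclideanSpace ℝ (Fin n))} {x₀ ν τ : EuclideanSpace ℝ (Fin n)}

/-! ### Concentration at a boundary point -/

open Filter Topology

/-- Rescaling of integrals against homogeneous kernels. -/
theorem pow_mul_setIntegral_eq (hn : 3 ≤ n) (x₀ ν : EuclideanSpace ℝ (Fin n))
    (g : EuclideanSpace ℝ (Fin n) → ℂ) {k : EuclideanSpace ℝ (Fin n) → ℝ} {ε : ℝ} (hε : 0 < ε)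
    (hk : ∀ ζ, k (ε • ζ) = ε ^ 2 * ((ε ^ 2) ^ n)⁻¹ * k ζ) :
    (ε : ℂ) ^ (n - 2) * ∫ x in Ω, g x * (k (x - x₀ + ε • ν) : ℂ)
      = ∫ z, (Ω : Set (EuclideanSpace ℝ (Fin n))).indicator g (x₀ + ε • z) * (k (z + ν) : ℂ) := by
  rw [← integral_indicator Ω.isOpen.measurableSet, integral_comp_add_smul _ x₀ hε]
  have hpt : ∀ z : EuclideanSpace ℝ (Fin n),
      (Ω : Set (EuclideanSpace ℝ (Fin n))).indicator
        (fun x => g x * (k (x - x₀ + ε • ν) : ℂ)) (x₀ + ε • z)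
      = ((ε ^ 2 * ((ε ^ 2) ^ n)⁻¹ : ℝ) : ℂ)
        * ((Ω : Set (EuclideanSpace ℝ (Fin n))).indicator g (x₀ + ε • z) * (k (z + ν) : ℂ)) := by
    intro z
    have h1 : x₀ + ε • z - x₀ + ε • ν = ε • (z + ν) := by
      rw [smul_add]
      abel
    by_cases hz : x₀ + ε • z ∈ (Ω : Set (EuclideanSpace ℝ (Fin n)))
    · rw [Set.indicator_of_mem hz, Set.indicator_of_mem hz, h1, hk, Complex.ofReal_mul]
      ring
    · rw [Set.indicator_of_notMem hz, Set.indicator_of_notMem hz, zero_mul, mul_zero]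
  simp only [hpt]
  rw [integral_const_mul, Complex.real_smul, ← mul_assoc, ← mul_assoc]
  -- The prefactor `ε^{n-2}`, the Jacobian `ε^n` and the homogeneity `ε^{2-2n}` cancel exactly.
  have hc : (ε : ℂ) ^ (n - 2) * ((ε ^ n : ℝ) : ℂ) * ((ε ^ 2 * ((ε ^ 2) ^ n)⁻¹ : ℝ) : ℂ) = 1 := by
    rw [← Complex.ofReal_pow, ← Complex.ofReal_mul, ← Complex.ofReal_mul]
    have h2 : ε ^ (n - 2) * ε ^ 2 = ε ^ n := by
      rw [← pow_add]
      congr 1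
      omega
    have h3 : ε ^ (n - 2) * ε ^ n * (ε ^ 2 * ((ε ^ 2) ^ n)⁻¹) = 1 := by
      rw [show ε ^ (n - 2) * ε ^ n * (ε ^ 2 * ((ε ^ 2) ^ n)⁻¹)
        = (ε ^ (n - 2) * ε ^ 2) * ε ^ n * ((ε ^ 2) ^ n)⁻¹ by ring, h2, pow_right_comm, sq,
        mul_inv_cancel₀ (by positivity)]
    rw [h3, Complex.ofReal_one]
  rw [hc, one_mul]

theorem tendsto_pow_mul_setIntegral (hn : 3 ≤ n)
    (hν : IsInnerNormal (Ω : Set (EuclideanSpace ℝ (Fin n))) x₀ ν)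
    (hbdd : Bornology.IsBounded (Ω : Set (EuclideanSpace ℝ (Fin n))))
    (hx₀ : x₀ ∈ closure (Ω : Set (EuclideanSpace ℝ (Fin n))))
    {g : EuclideanSpace ℝ (Fin n) → ℂ}
    (hg : ContinuousOn g (closure (Ω : Set (EuclideanSpace ℝ (Fin n)))))
    {k : EuclideanSpace ℝ (Fin n) → ℝ} (hkm : Measurable k) {K : ℝ}
    (hK : ∀ ζ, |k ζ| ≤ K * baseKernel ζ)
    (hk : ∀ ε : ℝ, 0 < ε → ∀ ζ, k (ε • ζ) = ε ^ 2 * ((ε ^ 2) ^ n)⁻¹ * k ζ) :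
    Tendsto (fun ε : ℝ => (ε : ℂ) ^ (n - 2) * ∫ x in Ω, g x * (k (x - x₀ + ε • ν) : ℂ)) (𝓝[>] 0)
      (𝓝 (g x₀ * (∫ z in halfSpace ν, k (z + ν) : ℝ))) := by
  obtain ⟨G, hG⟩ := hbdd.isCompact_closure.exists_bound_of_continuousOn hg
  have hm : Measurable ((Ω : Set (EuclideanSpace ℝ (Fin n))).indicator g) := by
    classical
    rw [← Set.piecewise_eq_indicator]
    exact (hg.mono subset_closure).measurable_piecewise continuousOn_const Ω.isOpen.measurableSet
  have h := tendsto_blowup hn hν hm (fun x hx => hG x (subset_closure hx))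
    ((hg x₀ hx₀).mono subset_closure).tendsto hkm hK
  rw [← integral_complex_ofReal]
  refine h.congr' ?_
  filter_upwards [self_mem_nhdsWithin] with ε hε
  exact (pow_mul_setIntegral_eq hn x₀ ν g hε (hk ε hε)).symm

/-- Applied with `g = 1` to measure `V`, and with `g = ‖x - x₀‖²`, which vanishes at `x₀`, to see
that `U` is of lower order. -/
theorem tendsto_pow_mul_setIntegral_real (hn : 3 ≤ n)
    (hν : IsInnerNormal (Ω : Set (EuclideanSpace ℝ (Fin n))) x₀ ν)
    (hbdd : Bornology.IsBounded (Ω : Set (EuclideanSpace ℝ (Fin n))))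
    (hx₀ : x₀ ∈ closure (Ω : Set (EuclideanSpace ℝ (Fin n))))
    {g : EuclideanSpace ℝ (Fin n) → ℝ} (hg : Continuous g) :
    Tendsto (fun ε : ℝ => ε ^ (n - 2) * ∫ x in Ω, g x * baseKernel (x - x₀ + ε • ν)) (𝓝[>] 0)
      (𝓝 (g x₀ * ∫ z in halfSpace ν, baseKernel (z + ν))) := by
  have h := tendsto_pow_mul_setIntegral hn hν hbdd hx₀ (g := fun x => (g x : ℂ))
    (Complex.continuous_ofReal.comp hg).continuousOn measurable_baseKernel (K := 1)
    (fun ζ => by rw [abs_of_nonneg (baseKernel_nonneg ζ), one_mul])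
    (fun ε hε ζ => baseKernel_smul hε ζ)
  have h' := (Complex.continuous_re.tendsto _).comp h
  rw [← Complex.ofReal_mul, Complex.ofReal_re] at h'
  refine h'.congr fun ε => ?_
  simp only [Function.comp_apply, ← Complex.ofReal_mul, integral_complex_ofReal,
    ← Complex.ofReal_pow, Complex.ofReal_re]

theorem continuousOn_inv_norm_sub_pow (y : EuclideanSpace ℝ (Fin n)) :
    ContinuousOn (fun x : EuclideanSpace ℝ (Fin n) => ((‖x - y‖ ^ 2) ^ n)⁻¹) {y}ᶜ := by
  refine ContinuousOn.inv₀ (by fun_prop) fun x hx => pow_ne_zero _ (pow_ne_zero _ ?_)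
  exact norm_ne_zero_iff.2 (sub_ne_zero.2 hx)

theorem continuousOn_baseKernel_sub (y : EuclideanSpace ℝ (Fin n)) :
    ContinuousOn (fun x => baseKernel (x - y)) {y}ᶜ := by
  unfold baseKernel
  exact ContinuousOn.mul (by fun_prop) (continuousOn_inv_norm_sub_pow y)

theorem continuousOn_kern_sub (τ a y : EuclideanSpace ℝ (Fin n)) :
    ContinuousOn (fun x => kern τ a (x - y)) {y}ᶜ := by
  unfold kern
  exact ContinuousOn.mul (by fun_prop) (continuousOn_inv_norm_sub_pow y)

/-- The integral of `|x - y|^{-2}` over `Ω` is bounded uniformly in `y`. -/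
theorem exists_integral_inv_norm_sub_sq_le (hn : 3 ≤ n)
    (hbdd : Bornology.IsBounded (Ω : Set (EuclideanSpace ℝ (Fin n))))
    (hx₀ : x₀ ∉ (Ω : Set (EuclideanSpace ℝ (Fin n)))) :
    ∃ I : ℝ, 0 ≤ I ∧ ∀ y : EuclideanSpace ℝ (Fin n),
      (∀ x ∈ (Ω : Set (EuclideanSpace ℝ (Fin n))), ‖x - x₀‖ / 2 ≤ ‖x - y‖) →
      ∫ x in Ω, ‖x - y‖⁻¹ ^ 2 ≤ I := by
  obtain ⟨R, hR⟩ := hbdd.subset_closedBall x₀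
  have hi : IntegrableOn (fun x : EuclideanSpace ℝ (Fin n) => ‖x - x₀‖⁻¹ ^ 2)
      (Ω : Set (EuclideanSpace ℝ (Fin n))) := by
    refine ((integrable_indicator_inv_norm_sq hn R).comp_sub_right x₀).integrableOn.congr_fun
      (fun x hx => ?_) Ω.isOpen.measurableSet
    have h1 : ‖x - x₀‖ ≤ R := mem_closedBall_iff_norm.1 (hR hx)
    exact Set.indicator_of_mem (show ‖x - x₀‖ ∈ Set.Iic R from h1) _
  refine ⟨∫ x in Ω, 4 * ‖x - x₀‖⁻¹ ^ 2, integral_nonneg fun x => by positivity, fun y hy => ?_⟩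
  refine integral_mono_of_nonneg (ae_of_all _ fun x => by positivity) (hi.const_mul 4) ?_
  filter_upwards [ae_restrict_mem Ω.isOpen.measurableSet] with x hx
  have h0 : 0 < ‖x - x₀‖ := norm_pos_iff.2 (sub_ne_zero.2 fun h => hx₀ (h ▸ hx))
  have h1 : ‖x - y‖⁻¹ ≤ (‖x - x₀‖ / 2)⁻¹ := inv_anti₀ (by positivity) (hy x hx)
  calc ‖x - y‖⁻¹ ^ 2 ≤ (‖x - x₀‖ / 2)⁻¹ ^ 2 := by gcongr
    _ = 4 * ‖x - x₀‖⁻¹ ^ 2 := by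
      rw [inv_div, div_pow, inv_pow]
      ring

/-- The estimate obtained from equality of the Cauchy data by inserting harmonic functions with
singularities close to `x₀`. -/
theorem exists_norm_integral_kern_le (hn : 3 ≤ n)
    (hbdd : Bornology.IsBounded (Ω : Set (EuclideanSpace ℝ (Fin n))))
    {A₁ A₂ : EuclideanSpace ℝ (Fin n) → EuclideanSpace ℂ (Fin n)}
    {q₁ q₂ : EuclideanSpace ℝ (Fin n) → ℂ}
    (hA₁ : MemLp A₁ ⊤ (vol Ω)) (hq₁ : MemLp q₁ ⊤ (vol Ω))
    (hA₂ : MemLp A₂ ⊤ (vol Ω)) (hq₂ : MemLp q₂ ⊤ (vol Ω))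
    (hC : cauchyData Ω A₁ q₁ = cauchyData Ω A₂ q₂)
    (hx₀ : x₀ ∉ (Ω : Set (EuclideanSpace ℝ (Fin n)))) (hτ : ‖τ‖ = 1) :
    ∃ K : ℝ, 0 ≤ K ∧ ∀ (y : EuclideanSpace ℝ (Fin n)) (d : ℝ), 0 < d → ‖y - x₀‖ ≤ 1 →
      (∀ x ∈ (Ω : Set (EuclideanSpace ℝ (Fin n))), (‖x - x₀‖ + d) / 2 ≤ ‖x - y‖) →
      ∀ a b : ℝ, 0 ≤ a → 0 ≤ b →
        (∫ x in Ω, ‖x - y‖ ^ 2 * baseKernel (x - y)) ≤ a ^ 2 →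
        (∫ x in Ω, baseKernel (x - y)) ≤ b ^ 2 →
        ‖∫ x in Ω, ∑ j, (A₁ x j - A₂ x j) * (kern τ (EuclideanSpace.single j 1) (x - y) : ℂ)‖
          ≤ K * (a * b) := by
  obtain ⟨R, hR⟩ := hbdd.subset_closedBall x₀
  obtain ⟨I, hI, hIy⟩ := exists_integral_inv_norm_sub_sq_le hn hbdd hx₀
  -- `R + 1` bounds `|x - y|` for all poles within distance one of `x₀`. Both this bound and `I` are
  -- fixed before the pole, so `K` is uniform in `ε`.
  obtain ⟨K, hK, hmain⟩ := exists_norm_lowerForm_harmonic_le hn hbdd hA₁ hq₁ hA₂ hq₂ hC (R + 1) I hI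
  refine ⟨K * ((n + 1) * (n + 1)), by positivity, fun y d hd hy hyd a b ha hb hia hib => ?_⟩
  have hd2 : 0 < d / 2 := by positivity
  have hyd1 : ∀ x ∈ (Ω : Set (EuclideanSpace ℝ (Fin n))), d / 2 ≤ ‖x - y‖ := fun x hx => by
    linarith [hyd x hx, norm_nonneg (x - x₀)]
  have hyd2 : ∀ x ∈ (Ω : Set (EuclideanSpace ℝ (Fin n))), ‖x - x₀‖ / 2 ≤ ‖x - y‖ := fun x hx => by
    linarith [hyd x hx]
  have hyD : ∀ x ∈ (Ω : Set (EuclideanSpace ℝ (Fin n))), ‖x - y‖ ≤ R + 1 := fun x hx => by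
    have h1 : ‖x - x₀‖ ≤ R := mem_closedBall_iff_norm.1 (hR hx)
    have h2 := norm_sub_le_norm_sub_add_norm_sub x x₀ y
    rw [norm_sub_rev x₀ y] at h2
    linarith
  have hcl := closure_subset_compl_singleton hd2 hyd1
  have hΩy : ∀ᵐ x ∂vol Ω, x ≠ y := by
    filter_upwards [ae_restrict_mem Ω.isOpen.measurableSet] with x hx
    exact hcl (subset_closure hx)
  have hbase := continuousOn_baseKernel_sub y
  have hib' : Integrable (fun x => baseKernel (x - y)) (vol Ω) :=
    memLp_one_iff_integrable.1 (memLp_of_continuousOn_closure hbdd (hbase.mono hcl) 1)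
  have hia' : Integrable (fun x => ‖x - y‖ ^ 2 * baseKernel (x - y)) (vol Ω) :=
    memLp_one_iff_integrable.1 (memLp_of_continuousOn_closure hbdd
      (ContinuousOn.mul (by fun_prop) (hbase.mono hcl)) 1)
  have hn1 : (1 : ℝ) ≤ (n : ℝ) + 1 := by linarith [(Nat.cast_nonneg n : (0 : ℝ) ≤ n)]
  have hn3 : (3 : ℝ) ≤ n := by exact_mod_cast hn
  -- The exponent `1 - n/2` with numerator `1` gives `U`; below, `-n/2` with numerator `⟨x - y, τ⟩`
  -- gives `V`. These are the values satisfying the harmonicity condition.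
  obtain ⟨u, hu, hharmu, hfu, hgu⟩ := exists_H1_sing hbdd hd2 hyd1 1 0 (1 - (n : ℝ) / 2)
    fun x => by
      rw [inner_zero_right]
      ring
  obtain ⟨v, hv, hharmv, hfv, hgv⟩ := exists_H1_sing hbdd hd2 hyd1 0 τ (-(n : ℝ) / 2)
    fun x => by
      rw [affineFn]
      ring
  -- One factor `(n + 1)²` dominates all the constants `1`, `(n - 2)²` and `(n + 1)²` of the four
  -- pointwise bounds.
  have bound : ∀ {f k : EuclideanSpace ℝ (Fin n) → ℝ} {c : ℝ}, Integrable k (vol Ω) →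
      (∫ x in Ω, k x ≤ c ^ 2) → (∀ x, 0 ≤ f x) → (∀ᵐ x ∂vol Ω, f x ≤ ((n : ℝ) + 1) ^ 2 * k x) →
      ∫ x in Ω, f x ≤ (((n : ℝ) + 1) * c) ^ 2 := by
    intro f k c hk hkc hf hfk
    refine (integral_mono_of_nonneg (ae_of_all _ hf) (hk.const_mul _) hfk).trans ?_
    rw [integral_const_mul, mul_pow]
    gcongr
  have bu : ‖fn u‖ ≤ ((n : ℝ) + 1) * a := by
    refine le_of_sq_le_sq ?_ (by positivity)
    rw [← integral_sq_fn]
    refine bound hia' hia (fun x => by positivity) ?_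
    filter_upwards [hfu, hΩy] with x h1 h2
    rw [h1, norm_sq_sing_one h2]
    refine le_mul_of_one_le_left (mul_nonneg (sq_nonneg _) (baseKernel_nonneg _)) (one_le_pow₀ hn1)
  have bu' : ∫ x in Ω, (‖x - y‖ * ‖grad u x‖) ^ 2 ≤ (((n : ℝ) + 1) * a) ^ 2 := by
    refine bound hia' hia (fun x => by positivity) ?_
    filter_upwards [hgu, hΩy] with x h1 h2
    rw [h1, norm_sq_gradient_sing_one h2]
    refine mul_le_mul_of_nonneg_right ?_ (mul_nonneg (sq_nonneg _) (baseKernel_nonneg _))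
    nlinarith
  have bv : ‖fn v‖ ≤ ((n : ℝ) + 1) * b := by
    refine le_of_sq_le_sq ?_ (by positivity)
    rw [← integral_sq_fn]
    refine bound hib' hib (fun x => by positivity) ?_
    filter_upwards [hfv, hΩy] with x h1 h2
    rw [h1]
    refine (norm_sq_sing_inner_le hτ h2).trans ?_
    exact le_mul_of_one_le_left (baseKernel_nonneg _) (one_le_pow₀ hn1)
  have bv' : ∫ x in Ω, (‖x - y‖ * ‖grad v x‖) ^ 2 ≤ (((n : ℝ) + 1) * b) ^ 2 := by
    refine bound hib' hib (fun x => by positivity) ?_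
    filter_upwards [hgv, hΩy] with x h1 h2
    rw [h1]
    exact norm_sq_gradient_sing_inner_le hτ h2
  have h := hmain y (d / 2) hd2 hyd1 hyD (hIy y hyd2) u hu hharmu _ (by positivity) bu bu'
    v hv hharmv _ (by positivity) bv bv'
  have e : lowerForm (A₁ - A₂) 0 u v = Complex.I * ∫ x in Ω,
      ∑ j, (A₁ x j - A₂ x j) * (kern τ (EuclideanSpace.single j 1) (x - y) : ℂ) := by
    rw [← integral_const_mul]
    refine integral_congr_ae ?_
    filter_upwards [hfu, hgu, hfv, hgv, hΩy] with x h1 h2 h3 h4 h5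
    rw [lowerIntegrand, Pi.zero_apply, zero_mul, zero_mul, add_zero, h1, h2, h3, h4, dot]
    refine congrArg _ (Finset.sum_congr rfl fun j _ => ?_)
    rw [sing_mul_gradient_sub h5, Pi.sub_apply, PiLp.sub_apply]
  rw [e, norm_mul, Complex.norm_I, one_mul] at h
  refine h.trans (le_of_eq ?_)
  ring

end MagneticSchrodinger

/-! ### Passage to the limit and conclusion -/

namespace MagneticSchrodinger

variable {n : ℕ} {Ω : Opens (EuclideanSpace ℝ (Fin n))} {x₀ ν τ : EuclideanSpace ℝ (Fin n)}

open Filter Topology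

/-- The blow-up is applied to each coordinate; `integral_kern_eq` then turns the coefficient of `W
x₀ j` into `τ j` times a common constant. -/
theorem tendsto_pow_mul_integral_kern (hn : 3 ≤ n)
    (hν : IsInnerNormal (Ω : Set (EuclideanSpace ℝ (Fin n))) x₀ ν)
    (hbdd : Bornology.IsBounded (Ω : Set (EuclideanSpace ℝ (Fin n))))
    (hx₀ : x₀ ∈ closure (Ω : Set (EuclideanSpace ℝ (Fin n)))) (hτ : ‖τ‖ = 1)
    (hντ : inner ℝ ν τ = 0) {W : EuclideanSpace ℝ (Fin n) → EuclideanSpace ℂ (Fin n)}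
    (hW : ContinuousOn W (closure (Ω : Set (EuclideanSpace ℝ (Fin n))))) :
    Tendsto (fun ε : ℝ => (ε : ℂ) ^ (n - 2) *
      ∫ x in Ω, ∑ j, W x j * (kern τ (EuclideanSpace.single j 1) (x - (x₀ - ε • ν)) : ℂ)) (𝓝[>] 0)
      (𝓝 ((∑ j, (τ j : ℂ) * W x₀ j) * (∫ z in halfSpace ν, kern τ τ (z + ν) : ℝ))) := by
  have hWj : ∀ j, ContinuousOn (fun x => W x j) (closure (Ω : Set (EuclideanSpace ℝ (Fin n)))) :=
    fun j => (by fun_prop : Continuous fun w : EuclideanSpace ℂ (Fin n) => w j).comp_continuousOn hW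
  have hj := fun j : Fin n => tendsto_pow_mul_setIntegral hn hν hbdd hx₀ (hWj j)
    (measurable_kern τ (EuclideanSpace.single j 1)) (abs_kern_le τ (EuclideanSpace.single j 1))
    (fun ε hε ζ => kern_smul hε τ _ ζ)
  have hsum := tendsto_finsetSum Finset.univ fun j _ => hj j
  have hlim : ∑ j, W x₀ j
      * ((∫ z in halfSpace ν, kern τ (EuclideanSpace.single j 1) (z + ν) : ℝ) : ℂ)
      = (∑ j, (τ j : ℂ) * W x₀ j) * (∫ z in halfSpace ν, kern τ τ (z + ν) : ℝ) := by
    rw [Finset.sum_mul]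
    refine Finset.sum_congr rfl fun j _ => ?_
    rw [integral_kern_eq hn hν.1 hτ hντ, EuclideanSpace.inner_single_left, map_one, one_mul,
      Complex.ofReal_mul]
    ring
  rw [hlim] at hsum
  obtain ⟨ε₀, hε₀, hlow⟩ := hν.exists_le_norm_sub
  refine hsum.congr' ?_
  filter_upwards [Ioo_mem_nhdsGT hε₀] with ε hε
  have hxy : ∀ x, x - (x₀ - ε • ν) = x - x₀ + ε • ν := fun x => by abel
  have hcl := closure_subset_compl_singleton (Ω := Ω) (y := x₀ - ε • ν) (half_pos hε.1)
    fun x hx => by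
      rw [hxy]
      linarith [hlow ε hε.1 hε.2 x hx, norm_nonneg (x - x₀)]
  rw [integral_finsetSum, Finset.mul_sum]
  · simp only [hxy]
  · intro j _
    refine memLp_one_iff_integrable.1 (memLp_of_continuousOn_closure hbdd ((hWj j).mul ?_) 1)
    exact Complex.continuous_ofReal.comp_continuousOn ((continuousOn_kern_sub τ _ _).mono hcl)

/-- Exchanges the weight centred at the moving pole for the fixed weight `‖x - x₀‖²`, to which the
blow-up limit applies, at the price of a term with an explicit `ε²`. -/
theorem integral_norm_sq_mul_baseKernel_le
    (hbdd : Bornology.IsBounded (Ω : Set (EuclideanSpace ℝ (Fin n)))) (hν : ‖ν‖ = 1) {ε : ℝ}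
    (hε : 0 ≤ ε) (hcl : closure (Ω : Set (EuclideanSpace ℝ (Fin n))) ⊆ {x₀ - ε • ν}ᶜ) :
    ∫ x in Ω, ‖x - x₀ + ε • ν‖ ^ 2 * baseKernel (x - x₀ + ε • ν)
      ≤ 2 * (∫ x in Ω, ‖x - x₀‖ ^ 2 * baseKernel (x - x₀ + ε • ν))
        + 2 * ε ^ 2 * ∫ x in Ω, baseKernel (x - x₀ + ε • ν) := by
  have hxy : ∀ x, x - (x₀ - ε • ν) = x - x₀ + ε • ν := fun x => by abel
  have hcont := (continuousOn_baseKernel_sub (x₀ - ε • ν)).mono hcl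
  simp only [hxy] at hcont
  have hi1 : Integrable (fun x => baseKernel (x - x₀ + ε • ν)) (vol Ω) :=
    memLp_one_iff_integrable.1 (memLp_of_continuousOn_closure hbdd hcont 1)
  have hi2 : Integrable (fun x => ‖x - x₀‖ ^ 2 * baseKernel (x - x₀ + ε • ν)) (vol Ω) :=
    memLp_one_iff_integrable.1 (memLp_of_continuousOn_closure hbdd
      (ContinuousOn.mul (by fun_prop) hcont) 1)
  rw [← integral_const_mul, ← integral_const_mul,
    ← integral_add (hi2.const_mul 2) (hi1.const_mul _)]
  refine integral_mono_of_nonneg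
    (ae_of_all _ fun x => mul_nonneg (sq_nonneg _) (baseKernel_nonneg _))
    ((hi2.const_mul 2).add (hi1.const_mul _)) (ae_of_all _ fun x => ?_)
  have h1 : ‖x - x₀ + ε • ν‖ ≤ ‖x - x₀‖ + ε := by
    refine (norm_add_le _ _).trans (le_of_eq ?_)
    rw [norm_smul, hν, mul_one, Real.norm_of_nonneg hε]
  have h2 : ‖x - x₀ + ε • ν‖ ^ 2 ≤ 2 * ‖x - x₀‖ ^ 2 + 2 * ε ^ 2 := by
    nlinarith [norm_nonneg (x - x₀ + ε • ν), sq_nonneg (‖x - x₀‖ - ε)]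
  refine (mul_le_mul_of_nonneg_right h2 (baseKernel_nonneg _)).trans (le_of_eq ?_)
  ring

/-- Equality of the Cauchy data determines the tangential part of the magnetic potential on the
boundary. -/
theorem sum_tangent_mul_sub_eq_zero (hn : 3 ≤ n)
    (hν : IsInnerNormal (Ω : Set (EuclideanSpace ℝ (Fin n))) x₀ ν)
    (hbdd : Bornology.IsBounded (Ω : Set (EuclideanSpace ℝ (Fin n))))
    (hx₀ : x₀ ∈ frontier (Ω : Set (EuclideanSpace ℝ (Fin n)))) (hτ : ‖τ‖ = 1)
    (hντ : inner ℝ ν τ = 0) {A₁ A₂ : EuclideanSpace ℝ (Fin n) → EuclideanSpace ℂ (Fin n)}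
    (hA₁ : ContinuousOn A₁ (closure (Ω : Set (EuclideanSpace ℝ (Fin n)))))
    (hA₂ : ContinuousOn A₂ (closure (Ω : Set (EuclideanSpace ℝ (Fin n)))))
    {q₁ q₂ : EuclideanSpace ℝ (Fin n) → ℂ}
    (hq₁ : MemLp q₁ ⊤ (vol Ω)) (hq₂ : MemLp q₂ ⊤ (vol Ω))
    (hC : cauchyData Ω A₁ q₁ = cauchyData Ω A₂ q₂) :
    ∑ j, (τ j : ℂ) * (A₁ x₀ j - A₂ x₀ j) = 0 := by
  have hx₀' : x₀ ∈ closure (Ω : Set (EuclideanSpace ℝ (Fin n))) := frontier_subset_closure hx₀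
  have hx₀Ω : x₀ ∉ (Ω : Set (EuclideanSpace ℝ (Fin n))) := by
    rw [Ω.isOpen.frontier_eq] at hx₀
    exact hx₀.2
  obtain ⟨K, hK, hmain⟩ := exists_norm_integral_kern_le hn hbdd
    (memLp_of_continuousOn_closure hbdd hA₁ ⊤) hq₁ (memLp_of_continuousOn_closure hbdd hA₂ ⊤) hq₂ hC
    hx₀Ω hτ
  have hlim := tendsto_pow_mul_integral_kern hn hν hbdd hx₀' hτ hντ (hA₁.sub hA₂)
  have hbase := tendsto_pow_mul_setIntegral_real hn hν hbdd hx₀' (g := fun _ => 1) continuous_const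
  have hbase' := tendsto_pow_mul_setIntegral_real hn hν hbdd hx₀' (g := fun x => ‖x - x₀‖ ^ 2)
    (by fun_prop)
  simp only [one_mul] at hbase
  simp only [sub_self, norm_zero, ne_eq, OfNat.ofNat_ne_zero, not_false_eq_true, zero_pow,
    zero_mul] at hbase'
  have hε2 : Tendsto (fun ε : ℝ => ε ^ 2) (𝓝[>] 0) (𝓝 0) :=
    ((by fun_prop : Continuous fun ε : ℝ => ε ^ 2).tendsto' 0 0 (by simp)).mono_left
      nhdsWithin_le_nhds
  -- This is `(K ε^{n-2} a b)²`: the factor `ε^{n-2} a²` tends to zero while `ε^{n-2} b²` converges.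
  have hup := ((((hbase'.const_mul 2).add ((hε2.mul hbase).const_mul 2)).mul hbase).const_mul
    (K ^ 2))
  simp only [mul_zero, zero_mul, add_zero] at hup
  -- Squares are compared, so that no limit of the square roots `a` and `b` has to be taken.
  have hle := le_of_tendsto_of_tendsto (hlim.norm.pow 2) hup ?_
  · have h0 := pow_eq_zero_iff two_ne_zero |>.1 (le_antisymm hle (sq_nonneg _))
    rw [norm_eq_zero, mul_eq_zero, Complex.ofReal_eq_zero] at h0
    exact h0.resolve_right (integral_kern_self_pos hn hν.1 hτ hντ).ne'
  obtain ⟨ε₀, hε₀, hlow⟩ := hν.exists_le_norm_sub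
  filter_upwards [Ioo_mem_nhdsGT hε₀, Ioo_mem_nhdsGT one_pos] with ε hε hε1
  have hxy : ∀ x, x - (x₀ - ε • ν) = x - x₀ + ε • ν := fun x => by abel
  have hyd : ∀ x ∈ (Ω : Set (EuclideanSpace ℝ (Fin n))),
      (‖x - x₀‖ + ε) / 2 ≤ ‖x - (x₀ - ε • ν)‖ := fun x hx => by
    rw [hxy]
    exact hlow ε hε.1 hε.2 x hx
  have hcl := closure_subset_compl_singleton (Ω := Ω) (y := x₀ - ε • ν) (half_pos hε.1)
    fun x hx => by linarith [hyd x hx, norm_nonneg (x - x₀)]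
  have hb0 : 0 ≤ ∫ x in Ω, baseKernel (x - x₀ + ε • ν) :=
    integral_nonneg fun x => baseKernel_nonneg _
  have hc0 : 0 ≤ ∫ x in Ω, ‖x - x₀‖ ^ 2 * baseKernel (x - x₀ + ε • ν) :=
    integral_nonneg fun x => mul_nonneg (sq_nonneg _) (baseKernel_nonneg _)
  have ha := integral_norm_sq_mul_baseKernel_le hbdd hν.1 hε.1.le hcl
  have hy1 : ‖x₀ - ε • ν - x₀‖ ≤ 1 := by
    rw [sub_sub_cancel_left, norm_neg, norm_smul, hν.1, mul_one, Real.norm_of_nonneg hε.1.le]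
    exact hε1.2.le
  have h := hmain (x₀ - ε • ν) ε hε.1 hy1 hyd
  simp only [hxy] at h ⊢
  generalize ∫ x in Ω, baseKernel (x - x₀ + ε • ν) = b at *
  generalize ∫ x in Ω, ‖x - x₀‖ ^ 2 * baseKernel (x - x₀ + ε • ν) = c at *
  -- The radicands are the upper bound from `integral_norm_sq_mul_baseKernel_le` and the integral of
  -- the kernel itself.
  have h := h (√(2 * c + 2 * ε ^ 2 * b)) (√b) (Real.sqrt_nonneg _) (Real.sqrt_nonneg _)
    (by rwa [Real.sq_sqrt (by positivity)]) (Real.sq_sqrt hb0).ge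
  have h3 := pow_le_pow_left₀ (norm_nonneg _) h 2
  rw [mul_pow, mul_pow, Real.sq_sqrt (by positivity), Real.sq_sqrt hb0] at h3
  simp only [norm_mul, norm_pow, Complex.norm_real, Real.norm_of_nonneg hε.1.le, Pi.sub_apply,
    PiLp.sub_apply]
  rw [mul_pow]
  refine (mul_le_mul_of_nonneg_left h3 (sq_nonneg _)).trans (le_of_eq ?_)
  ring

end MagneticSchrodinger

open MagneticSchrodinger in
theorem proposition4p1 {n : ℕ} (hn : 3 ≤ n)
    (Ω : Opens (EuclideanSpace ℝ (Fin n)))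
    (hconn : IsConnected (Ω : Set (EuclideanSpace ℝ (Fin n))))
    (hbdd : Bornology.IsBounded (Ω : Set (EuclideanSpace ℝ (Fin n))))
    (hC1 : HasC1Boundary (Ω : Set (EuclideanSpace ℝ (Fin n))))
    (A₁ A₂ : EuclideanSpace ℝ (Fin n) → EuclideanSpace ℂ (Fin n))
    (hA₁ : ContinuousOn A₁ (closure (Ω : Set (EuclideanSpace ℝ (Fin n)))))
    (hA₂ : ContinuousOn A₂ (closure (Ω : Set (EuclideanSpace ℝ (Fin n)))))
    (q₁ q₂ : EuclideanSpace ℝ (Fin n) → ℂ)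
    (hq₁ : MemLp q₁ ⊤ (volume.restrict (Ω : Set (EuclideanSpace ℝ (Fin n)))))
    (hq₂ : MemLp q₂ ⊤ (volume.restrict (Ω : Set (EuclideanSpace ℝ (Fin n)))))
    (hC : cauchyData Ω A₁ q₁ = cauchyData Ω A₂ q₂)
    (x₀ : EuclideanSpace ℝ (Fin n)) (hx₀ : x₀ ∈ frontier (Ω : Set (EuclideanSpace ℝ (Fin n))))
    (τ : EuclideanSpace ℝ (Fin n))
    (hτ : IsTangentVector (Ω : Set (EuclideanSpace ℝ (Fin n))) x₀ τ) (hτ1 : ‖τ‖ = 1) :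
    ∑ j, (τ j : ℂ) * (A₁ x₀ j - A₂ x₀ j) = 0 := by
  obtain ⟨ν, hν, hντ⟩ := exists_isInnerNormal hx₀ hτ
  exact sum_tangent_mul_sub_eq_zero hn hν hbdd hx₀ hτ1 hντ hA₁ hA₂ hq₁ hq₂ hC
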